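/- **Setting.** Let $M$ be a smooth manifold (Hausdorff, second countable, without boundary) of dimension at least two with a Lorentzian metric of signature $(-,+,\dots,+)$ and a time orientation, globally hyperbolic (strongly causal with compact causal diamonds $J^+(p)\cap J^-(q)$). $J^\pm(O)$ is the set of points reachable from $O$ by trivial or piecewise smooth future/past-directed causal curves; $M_O^{\pm}=M\setminus J^{\mp}(O)$, $O^\perp=M_O^+\cap M_O^-$, $\mathrm{ch}(O)=J^+(O)\cap J^-(O)$. A *region* is an open set $O$ with $\mathrm{ch}(O)=O$; $O_1\natural O_2$ means $O_1\subseteq O_2^\perp$; $D(O)=D^+(O)\cup D^-(O)$ is the domain of dependence. A *causal order* on a finite set of precompact sets is a linear order such that $O<P$ implies $\overline P\subseteq M^+_{\overline O}$. A *worldline* is a smooth future-directed inextendible causal curve $\mathbb R\to M$. *Nets.* An AQFT is a net $O\mapsto\mathfrak C(O)$ of unital *-subalgebras of a global algebra $\mathfrak C(M)$ satisfying isotony, Einstein causality (algebras of causally disjoint regions commute) and the Diamond Axiom $\mathfrak C(D(O))=\mathfrak C(O)$. It has the Haag property if, whenever $K$ is compact and $a$ commutes with $\mathfrak C(K^\perp)$,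 $a\in\mathfrak C(L)$ for every connected region $L\supseteq K$. *Hybrid model.* It is given by finitely many worldlines $\gamma_i$ with finite-dimensional Hilbert spaces $\mathcal H_i$; the global algebra is $\mathcal B(\bigotimes_i\mathcal H_i)$, and $\mathfrak A(O)$ is the smallest unital *-subalgebra containing $1\otimes\dots\otimes\mathcal B(\mathcal H_i)\otimes\dots\otimes 1$ for each $i$ such that $\gamma_i$ meets $O$. *FV measurements.* Let $\mathfrak A$, $\mathfrak B$ be hybrid models (system and probe) and $\mathfrak U(O)=\mathfrak A(O)\otimes\mathfrak B(O)$. An FV measurement on $\mathfrak A$ in the hybrid model with probe $\mathfrak B$ consists of a compact coupling zone $K$; a coupled theory $\mathfrak C$; *-isomorphisms $\phi_\pm:\mathfrak U(M)\to\mathfrak C(M)$ with $\phi_\pm(\mathfrak U(L))=\mathfrak C(L)$ for all regions $L\subseteq M_K^\pm$ and $\phi_+=\phi_-$ on $\mathfrak U(K^\perp)$; a probe state; and a probe observable. Here $\mathfrak C$ is an AQFT with the worldlines and Hilbert spaces of system and probe together, of the following kind: each worldline is cut into finitely many segments, each segment is assigned a *-subalgebra of the global algebra, and $\mathfrak C(O)$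 is the smallest unital *-subalgebra containing the algebras of all segments that meet $O$. The scattering morphism is $\Theta=\phi_-^{-1}\circ\phi_+$. **Theorem.** Let the system be the hybrid model with two worldlines $\gamma_A,\gamma_C$ and Hilbert spaces $\mathcal H_A,\mathcal H_C$, and let $O_A,O_C$ be regions with $O_A\natural O_C$ such that $\gamma_A$ meets $O_A$ and $\gamma_C$ meets $O_C$. Consider $$\Theta=(\mathrm{id}_A\otimes\psi_{BC})\circ(\chi_{AB}\otimes\mathrm{id}_C)\qquad(*)$$ with $\psi_{BC}$ and $\chi_{AB}$ *-automorphisms of $\mathcal B(\mathcal H_B\otimes\mathcal H_C)$ and $\mathcal B(\mathcal H_A\otimes\mathcal H_B)$. (i) Let $O_B$ be a region for which there is a causal order $O_A\le O_B\le O_C$. Then every FV measurement in the hybrid model whose probe has finitely many worldlines, with total Hilbert space $\mathcal H_B$, and whose coupling zone is contained in $O_B$ has a scattering morphism of the form $(*)$. (ii) Conversely, let $\gamma_B$ be a worldline that meets $\gamma_C$ at $\gamma_B(t_C)$ and $\gamma_A$ at $\gamma_B(t_A)$ for some $t_C\le t_A$, and let $\mathcal H_B$ be a finite-dimensional Hilbert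 space. Then every $\Theta$ of the form $(*)$ is the scattering morphism of an FV measurement in the hybrid model with probe $(\gamma_B,\mathcal H_B)$, with any prescribed probe state and probe observable; the coupled theory can be chosen to have the Haag property as well. Moreover, for any FV measurement in the hybrid model with a probe of one worldline whose scattering morphism has the form $(*)$, where neither $\psi_{BC}$ nor $\chi_{AB}$ is a tensor product of *-automorphisms of the individual factors, the causal hull $\mathrm{ch}(K)$ of the coupling zone contains a (possibly trivial) causal curve that meets both $\gamma_C$ and $\gamma_A$. -/

import Mathlib

open scoped Manifold ContDiff Topology Kronecker

noncomputable section

namespace HybridAQFT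

/-! ### Lorentzian geometry -/

/-- A time-oriented Lorentzian metric of signature `(-,+,…,+)` on a smooth manifold `M` (without
boundary, modelled on `E`) of dimension at least two. The time orientation is given by a smooth
timelike vector field `T`. Since `T` is timelike at every point, the signature condition says that
the metric is positive definite on the orthogonal complement of `T`. -/
structure Spacetime (E M : Type*) [NormedAddCommGroup E] [NormedSpace ℝ E]
    [TopologicalSpace M] [ChartedSpace E M] [IsManifold 𝓘(ℝ, E) ∞ M] where
  two_le_dim : 2 ≤ Module.finrank ℝ E
  /-- the metric -/
  g : ∀ x : M, TangentSpace 𝓘(ℝ, E) x →L[ℝ] TangentSpace 𝓘(ℝ, E) x →L[ℝ] ℝ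
  g_symm : ∀ (x : M) (v w : TangentSpace 𝓘(ℝ, E) x), g x v w = g x w v
  g_smooth : ContMDiff 𝓘(ℝ, E) (𝓘(ℝ, E).prod 𝓘(ℝ, E →L[ℝ] E →L[ℝ] ℝ)) ∞
    (fun x : M ↦ Bundle.TotalSpace.mk' (E →L[ℝ] E →L[ℝ] ℝ)
      (E := fun x : M ↦ TangentSpace 𝓘(ℝ, E) x →L[ℝ] TangentSpace 𝓘(ℝ, E) x →L[ℝ] ℝ) x (g x))
  /-- the future-pointing timelike vector field -/
  T : ∀ x : M, TangentSpace 𝓘(ℝ, E) x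
  T_smooth : ContMDiff 𝓘(ℝ, E) (𝓘(ℝ, E).prod 𝓘(ℝ, E)) ∞
    (fun x : M ↦ (⟨x, T x⟩ : TangentBundle 𝓘(ℝ, E) M))
  T_timelike : ∀ x : M, g x (T x) (T x) < 0
  signature : ∀ (x : M) (v : TangentSpace 𝓘(ℝ, E) x), g x (T x) v = 0 → v ≠ 0 → 0 < g x v v

namespace Spacetime

variable {E M : Type*} [NormedAddCommGroup E] [NormedSpace ℝ E]
  [TopologicalSpace M] [ChartedSpace E M] [IsManifold 𝓘(ℝ, E) ∞ M] (S : Spacetime E M)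

/-- `v` is a causal (timelike or null, nonzero) vector pointing to the future. -/
def FutureCausal (x : M) (v : TangentSpace 𝓘(ℝ, E) x) : Prop :=
  v ≠ 0 ∧ S.g x v v ≤ 0 ∧ S.g x (S.T x) v < 0

/-- `γ` restricted to `[a, b]` is a smooth future-directed causal curve. -/
def FutureOn (γ : ℝ → M) (a b : ℝ) : Prop :=
  ContMDiffOn 𝓘(ℝ, ℝ) 𝓘(ℝ, E) ∞ γ (Set.Icc a b) ∧
    ∀ t ∈ Set.Icc a b,
      S.FutureCausal (γ t) (mfderivWithin 𝓘(ℝ, ℝ) 𝓘(ℝ, E) γ (Set.Icc a b) t (1 : ℝ))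

/-- `γ` restricted to `[a, b]` is a smooth past-directed causal curve. -/
def PastOn (γ : ℝ → M) (a b : ℝ) : Prop :=
  ContMDiffOn 𝓘(ℝ, ℝ) 𝓘(ℝ, E) ∞ γ (Set.Icc a b) ∧
    ∀ t ∈ Set.Icc a b,
      S.FutureCausal (γ t) (-(mfderivWithin 𝓘(ℝ, ℝ) 𝓘(ℝ, E) γ (Set.Icc a b) t (1 : ℝ)))

/-- `q` can be reached from `p` by one smooth future-directed causal curve. -/
def Step (p q : M) : Prop :=
  ∃ (γ : ℝ → M) (a b : ℝ), a < b ∧ S.FutureOn γ a b ∧ γ a = p ∧ γ b = q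

/-- `p ≤ q`: `q = p`, or `q` can be reached from `p` by a piecewise smooth future-directed causal
curve, that is, by a finite chain of smooth ones. -/
def CausalLE (p q : M) : Prop := Relation.ReflTransGen S.Step p q

/-- The causal future of a set. -/
def JPlus (O : Set M) : Set M := {q | ∃ p ∈ O, S.CausalLE p q}

/-- The causal past of a set. -/
def JMinus (O : Set M) : Set M := {q | ∃ p ∈ O, S.CausalLE q p}

/-- The causal hull of a set. -/
def hull (O : Set M) : Set M := S.JPlus O ∩ S.JMinus O

/-- `M_O⁺`, the complement of the causal past of `O`. -/
def MPlus (O : Set M) : Set M := (S.JMinus O)ᶜ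

/-- `M_O⁻`, the complement of the causal future of `O`. -/
def MMinus (O : Set M) : Set M := (S.JPlus O)ᶜ

/-- The causal complement of a set. -/
def perp (O : Set M) : Set M := (S.JPlus O ∪ S.JMinus O)ᶜ

def CausallyDisjoint (O₁ O₂ : Set M) : Prop := O₁ ⊆ S.perp O₂

def CausallyConvex (O : Set M) : Prop := S.hull O = O

/-- The regions, to which local algebras are assigned. -/
def IsRegion (O : Set M) : Prop := IsOpen O ∧ S.CausallyConvex O

/-- `γ`, restricted to `[0, ∞)`, is a piecewise smooth future-directed causal curve which starts at
`p` and has no future endpoint (the break points are among the `τ k`). -/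
def FutureInextendibleFrom (p : M) (γ : ℝ → M) : Prop :=
  γ 0 = p ∧
  (∃ τ : ℕ → ℝ, τ 0 = 0 ∧ StrictMono τ ∧ Filter.Tendsto τ Filter.atTop Filter.atTop ∧
    ∀ k, S.FutureOn γ (τ k) (τ (k + 1))) ∧
  ∀ x, ¬ Filter.Tendsto γ Filter.atTop (𝓝 x)

/-- `γ`, restricted to `[0, ∞)`, is a piecewise smooth past-directed causal curve which starts at
`p` and has no past endpoint. -/
def PastInextendibleFrom (p : M) (γ : ℝ → M) : Prop :=
  γ 0 = p ∧
  (∃ τ : ℕ → ℝ, τ 0 = 0 ∧ StrictMono τ ∧ Filter.Tendsto τ Filter.atTop Filter.atTop ∧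
    ∀ k, S.PastOn γ (τ k) (τ (k + 1))) ∧
  ∀ x, ¬ Filter.Tendsto γ Filter.atTop (𝓝 x)

/-- The future domain of dependence. -/
def DPlus (O : Set M) : Set M :=
  {p | ∀ γ : ℝ → M, S.PastInextendibleFrom p γ → ∃ t, 0 ≤ t ∧ γ t ∈ O}

/-- The past domain of dependence. -/
def DMinus (O : Set M) : Set M :=
  {p | ∀ γ : ℝ → M, S.FutureInextendibleFrom p γ → ∃ t, 0 ≤ t ∧ γ t ∈ O}

/-- The domain of dependence. -/
def D (O : Set M) : Set M := S.DPlus O ∪ S.DMinus O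

/-- Global hyperbolicity: strong causality (every point has arbitrarily small causally convex open
neighbourhoods) and compactness of all causal diamonds. -/
def GloballyHyperbolic : Prop :=
  (∀ x : M, ∀ U ∈ 𝓝 x, ∃ V, V ⊆ U ∧ x ∈ V ∧ S.IsRegion V) ∧
  ∀ p q : M, IsCompact (S.JPlus {p} ∩ S.JMinus {q})

/-- `r` is a causal order on the set `𝒪` of precompact subsets of spacetime: a linear order on `𝒪`
in which `O < P` implies `closure P ⊆ M⁺_{closure O}`. -/
structure IsCausalOrder (𝒪 : Set (Set M)) (r : Set M → Set M → Prop) : Prop where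
  finite : 𝒪.Finite
  precompact : ∀ O ∈ 𝒪, IsCompact (closure O)
  refl : ∀ O ∈ 𝒪, r O O
  antisymm : ∀ O ∈ 𝒪, ∀ P ∈ 𝒪, r O P → r P O → O = P
  trans : ∀ O ∈ 𝒪, ∀ P ∈ 𝒪, ∀ Q ∈ 𝒪, r O P → r P Q → r O Q
  total : ∀ O ∈ 𝒪, ∀ P ∈ 𝒪, r O P ∨ r P O
  causal : ∀ O ∈ 𝒪, ∀ P ∈ 𝒪, r O P → O ≠ P → closure P ⊆ S.MPlus (closure O)

/-- A worldline: a smooth future-directed inextendible causal curve `ℝ → M`. -/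
structure Worldline where
  toFun : ℝ → M
  smooth : ContMDiff 𝓘(ℝ, ℝ) 𝓘(ℝ, E) ∞ toFun
  causal : ∀ t, S.FutureCausal (toFun t) (mfderiv 𝓘(ℝ, ℝ) 𝓘(ℝ, E) toFun t (1 : ℝ))
  no_future_endpoint : ∀ x, ¬ Filter.Tendsto toFun Filter.atTop (𝓝 x)
  no_past_endpoint : ∀ x, ¬ Filter.Tendsto toFun Filter.atBot (𝓝 x)

instance : CoeFun S.Worldline (fun _ ↦ ℝ → M) := ⟨Worldline.toFun⟩

end Spacetime

/-! ### Nets of algebras -/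

section Nets

variable {E M : Type*} [NormedAddCommGroup E] [NormedSpace ℝ E]
  [TopologicalSpace M] [ChartedSpace E M] [IsManifold 𝓘(ℝ, E) ∞ M] (S : Spacetime E M)

/-- An assignment of unital *-subalgebras of a global algebra `𝓐` to subsets of `M`; only its values
on regions are of interest. -/
abbrev Net (M 𝓐 : Type*) [Ring 𝓐] [StarRing 𝓐] [Algebra ℂ 𝓐] [StarModule ℂ 𝓐] :=
  Set M → StarSubalgebra ℂ 𝓐

variable {𝓐 : Type*} [Ring 𝓐] [StarRing 𝓐] [Algebra ℂ 𝓐] [StarModule ℂ 𝓐]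

/-- The axioms of algebraic quantum field theory. In the presence of isotony, `diamond` says that
`𝔄(D(O)) = 𝔄(O)` for every region `O`. -/
structure IsAQFT (𝔄 : Net M 𝓐) : Prop where
  global : 𝔄 Set.univ = ⊤
  isotony : ∀ O₁ O₂, S.IsRegion O₁ → S.IsRegion O₂ → O₁ ⊆ O₂ → 𝔄 O₁ ≤ 𝔄 O₂
  einstein : ∀ O₁ O₂, S.IsRegion O₁ → S.IsRegion O₂ → S.CausallyDisjoint O₁ O₂ →
    ∀ a ∈ 𝔄 O₁, ∀ b ∈ 𝔄 O₂, Commute a b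
  diamond : ∀ O O', S.IsRegion O → S.IsRegion O' → O' ⊆ S.D O → 𝔄 O' ≤ 𝔄 O

/-- The Haag property. -/
def HaagProperty (𝔄 : Net M 𝓐) : Prop :=
  ∀ K : Set M, IsCompact K → ∀ a : 𝓐, (∀ b ∈ 𝔄 (S.perp K), Commute a b) →
    ∀ L, S.IsRegion L → IsConnected L → K ⊆ L → a ∈ 𝔄 L

end Nets

/-! ### Operators on tensor products

The finite-dimensional Hilbert space with an orthonormal basis indexed by `α` has the operator
algebra `Matrix α α ℂ`, and tensor products of operators are Kronecker products. -/

section Tensor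

variable {α β : Type*} [Fintype α] [DecidableEq α] [Fintype β] [DecidableEq β]

/-- The *-algebra of bounded operators on a Hilbert space with orthonormal basis indexed by `α`. -/
abbrev Op (α : Type*) := Matrix α α ℂ

/-- A *-automorphism of an operator algebra. -/
abbrev Aut (α : Type*) [Fintype α] [DecidableEq α] := Op α ≃⋆ₐ[ℂ] Op α

/-- The linear map underlying a *-automorphism. -/
def Aut.lin (ψ : Aut α) : Op α →ₗ[ℂ] Op α where
  toFun := ψ
  map_add' := map_add ψ
  map_smul' := map_smul ψ

/-- The tensor product `f ⊗ g` of linear maps, acting on `B(H_α ⊗ H_β) = B(H_α) ⊗ B(H_β)`. -/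
def tensorMap (f : Op α →ₗ[ℂ] Op α) (g : Op β →ₗ[ℂ] Op β) : Op (α × β) →ₗ[ℂ] Op (α × β) :=
  (kroneckerLinearEquiv α α β β ℂ).toLinearMap ∘ₗ TensorProduct.map f g ∘ₗ
    (kroneckerLinearEquiv α α β β ℂ).symm.toLinearMap

theorem tensorMap_kronecker (f : Op α →ₗ[ℂ] Op α) (g : Op β →ₗ[ℂ] Op β) (a : Op α) (b : Op β) :
    tensorMap f g (a ⊗ₖ b) = f a ⊗ₖ g b := by
  simp [tensorMap]

/-- A *-automorphism of `B(H_α ⊗ H_β)` is a tensor product of *-automorphisms of the factors. -/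
def Decomposes (ψ : Aut (α × β)) : Prop :=
  ∃ (ψ₁ : Aut α) (ψ₂ : Aut β), ∀ x, ψ x = tensorMap ψ₁.lin ψ₂.lin x

/-- A state: a positive normalised linear functional. -/
structure OpState (α : Type*) [Fintype α] [DecidableEq α] where
  toFun : Op α →ₗ[ℂ] ℂ
  re_nonneg : ∀ a, 0 ≤ (toFun (star a * a)).re
  im_zero : ∀ a, (toFun (star a * a)).im = 0
  normalised : toFun 1 = 1

/-- The tensor product of two nets: `O ↦ 𝔄(O) ⊗ 𝔅(O)`. -/
def tensorNet {M : Type*} (𝔄 : Net M (Op α)) (𝔅 : Net M (Op β)) : Net M (Op (α × β)) :=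
  fun O ↦ StarAlgebra.adjoin ℂ {x | ∃ a ∈ 𝔄 O, ∃ b ∈ 𝔅 O, x = a ⊗ₖ b}

end Tensor

/-! ### The hybrid model -/

section Hybrid

variable {E M : Type*} [NormedAddCommGroup E] [NormedSpace ℝ E]
  [TopologicalSpace M] [ChartedSpace E M] [IsManifold 𝓘(ℝ, E) ∞ M] {S : Spacetime E M}

/-- The data of a hybrid model: `n` worldlines, and for each of them a finite-dimensional Hilbert
space `H_i = ℂ ^ (dim i)`. -/
structure HybridTheory (S : Spacetime E M) (n : ℕ) where
  worldline : Fin n → S.Worldline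
  dim : Fin n → ℕ

namespace HybridTheory

variable {n : ℕ} (𝔄 : HybridTheory S n)

/-- The product basis of `H_1 ⊗ ⋯ ⊗ H_n`. -/
abbrev Idx : Type := ∀ i, Fin (𝔄.dim i)

/-- The operator `1 ⊗ ⋯ ⊗ a ⊗ ⋯ ⊗ 1`, with `a` in the `i`-th factor. -/
def slot (i : Fin n) (a : Op (Fin (𝔄.dim i))) : Op 𝔄.Idx :=
  Matrix.of fun f g ↦ if ∀ j, j ≠ i → f j = g j then a (f i) (g i) else 0

/-- The net of local algebras: `𝔄(O)` is the smallest *-subalgebra that contains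
`1 ⊗ ⋯ ⊗ B(H_i) ⊗ ⋯ ⊗ 1` for each `i` such that the `i`-th worldline meets `O`. -/
def net : Net M (Op 𝔄.Idx) :=
  fun O ↦ StarAlgebra.adjoin ℂ {x | ∃ i, (∃ t, 𝔄.worldline i t ∈ O) ∧ ∃ a, x = 𝔄.slot i a}

end HybridTheory

/-- The generalised hybrid model used for coupled theories: each worldline is cut at finitely many
parameter values into segments, and each segment carries a *-subalgebra of the global algebra `𝓐`.
The segment that contains the parameter `t` of the worldline `j` carries `label j t`; the values of
`label j` at the cuts are not used. -/
structure SegmentedTheory {J : Type*} (γ : J → S.Worldline)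
    (𝓐 : Type*) [Ring 𝓐] [StarRing 𝓐] [Algebra ℂ 𝓐] [StarModule ℂ 𝓐] where
  cuts : J → Finset ℝ
  label : J → ℝ → StarSubalgebra ℂ 𝓐
  label_eq : ∀ j s t, s ≤ t → (∀ b ∈ cuts j, b ∉ Set.Icc s t) → label j s = label j t

/-- `ℭ(O)` is the smallest *-subalgebra that contains the algebras of all segments which meet `O`. -/
def SegmentedTheory.net {J : Type*} {γ : J → S.Worldline}
    {𝓐 : Type*} [Ring 𝓐] [StarRing 𝓐] [Algebra ℂ 𝓐] [StarModule ℂ 𝓐]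
    (ℭ : SegmentedTheory γ 𝓐) : Net M 𝓐 :=
  fun O ↦ StarAlgebra.adjoin ℂ
    {x | ∃ j t, t ∉ ℭ.cuts j ∧ γ j t ∈ O ∧ x ∈ ℭ.label j t}

/-- The uncoupled theory `𝔘 = 𝔄 ⊗ 𝔅`. -/
def uncoupled {m n : ℕ} (𝔄 : HybridTheory S m) (𝔅 : HybridTheory S n) :
    Net M (Op (𝔄.Idx × 𝔅.Idx)) :=
  tensorNet 𝔄.net 𝔅.net

/-- A Fewster–Verch measurement on the system `𝔄` with the probe theory `𝔅`, all theories being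
instances of the hybrid model. The coupled theory has the worldlines of the system and of the probe.
The response maps are *-isomorphisms between the global algebras. -/
structure FVMeasurement {m n : ℕ} (𝔄 : HybridTheory S m) (𝔅 : HybridTheory S n) where
  /-- the coupling zone -/
  K : Set M
  isCompact_K : IsCompact K
  /-- the coupled theory -/
  coupled : SegmentedTheory (Sum.elim 𝔄.worldline 𝔅.worldline) (Op (𝔄.Idx × 𝔅.Idx))
  isAQFT : IsAQFT S coupled.net
  /-- the advanced response map -/
  respPlus : Aut (𝔄.Idx × 𝔅.Idx)
  /-- the retarded response map -/
  respMinus : Aut (𝔄.Idx × 𝔅.Idx)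
  /-- the response maps preserve localisation -/
  respPlus_image : ∀ L, S.IsRegion L → L ⊆ S.MPlus K →
    respPlus '' (uncoupled 𝔄 𝔅 L) = coupled.net L
  respMinus_image : ∀ L, S.IsRegion L → L ⊆ S.MMinus K →
    respMinus '' (uncoupled 𝔄 𝔅 L) = coupled.net L
  /-- the response maps agree on the causal complement of the coupling zone -/
  agree : ∀ u ∈ uncoupled 𝔄 𝔅 (S.perp K), respPlus u = respMinus u
  /-- the initial state of the probe -/
  probeState : OpState 𝔅.Idx
  /-- the measured probe observable -/
  probeObs : Op 𝔅.Idx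

/-- The scattering morphism `Θ = φ₋⁻¹ ∘ φ₊`. -/
def FVMeasurement.scattering {m n : ℕ} {𝔄 : HybridTheory S m} {𝔅 : HybridTheory S n}
    (μ : FVMeasurement 𝔄 𝔅) : Aut (𝔄.Idx × 𝔅.Idx) :=
  μ.respPlus.trans μ.respMinus.symm

/-! ### Three parties

The system consists of two worldlines: number `0` belongs to Alice, number `1` to Charlie. The probe
belongs to Bob. -/

section ThreeParties

variable {n : ℕ} (𝔄 : HybridTheory S 2) (𝔅 : HybridTheory S n)

/-- The basis of `H_B ⊗ H_C`. -/
abbrev IdxBC : Type := 𝔅.Idx × Fin (𝔄.dim 1)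

/-- The basis of `H_A ⊗ H_B`. -/
abbrev IdxAB : Type := Fin (𝔄.dim 0) × 𝔅.Idx

/-- The identification of `H_AC ⊗ H_B` with `H_A ⊗ H_BC`. -/
def splitA_BC : 𝔄.Idx × 𝔅.Idx ≃ Fin (𝔄.dim 0) × IdxBC 𝔄 𝔅 where
  toFun x := (x.1 0, (x.2, x.1 1))
  invFun y := ((piFinTwoEquiv fun i ↦ Fin (𝔄.dim i)).symm (y.1, y.2.2), y.2.1)
  left_inv x := by
    ext i
    · fin_cases i <;> rfl
    · rfl
  right_inv _ := rfl

/-- The identification of `H_AC ⊗ H_B` with `H_AB ⊗ H_C`. -/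
def splitAB_C : 𝔄.Idx × 𝔅.Idx ≃ IdxAB 𝔄 𝔅 × Fin (𝔄.dim 1) where
  toFun x := ((x.1 0, x.2), x.1 1)
  invFun y := ((piFinTwoEquiv fun i ↦ Fin (𝔄.dim i)).symm (y.1.1, y.2), y.1.2)
  left_inv x := by
    ext i
    · fin_cases i <;> rfl
    · rfl
  right_inv _ := rfl

variable {𝔄 𝔅}

/-- `id_A ⊗ ψ_BC`, as a map on `B(H_ABC)`. -/
def idA_tensor (ψ : Aut (IdxBC 𝔄 𝔅)) (x : Op (𝔄.Idx × 𝔅.Idx)) : Op (𝔄.Idx × 𝔅.Idx) :=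
  (Matrix.reindex (splitA_BC 𝔄 𝔅) (splitA_BC 𝔄 𝔅)).symm
    (tensorMap LinearMap.id ψ.lin (Matrix.reindex (splitA_BC 𝔄 𝔅) (splitA_BC 𝔄 𝔅) x))

/-- `χ_AB ⊗ id_C`, as a map on `B(H_ABC)`. -/
def tensor_idC (χ : Aut (IdxAB 𝔄 𝔅)) (x : Op (𝔄.Idx × 𝔅.Idx)) : Op (𝔄.Idx × 𝔅.Idx) :=
  (Matrix.reindex (splitAB_C 𝔄 𝔅) (splitAB_C 𝔄 𝔅)).symm
    (tensorMap χ.lin LinearMap.id (Matrix.reindex (splitAB_C 𝔄 𝔅) (splitAB_C 𝔄 𝔅) x))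

/-- `Θ = (id_A ⊗ ψ_BC) ∘ (χ_AB ⊗ id_C)`. -/
def HasForm (Θ : Aut (𝔄.Idx × 𝔅.Idx)) (ψ : Aut (IdxBC 𝔄 𝔅)) (χ : Aut (IdxAB 𝔄 𝔅)) : Prop :=
  ∀ x, Θ x = idA_tensor ψ (tensor_idC χ x)

end ThreeParties

end Hybrid

end HybridAQFT

end

/-!
Three facts about globally hyperbolic spacetimes are used throughout. The causal relation is
closed, so that `J⁺(K)` and `J⁻(K)` are closed for compact `K`. A worldline leaves `J⁻(K)` towards
the future and `J⁺(K)` towards the past, so it meets the causal complement or the hull of `K`, and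
in the latter case it has an entry into the hull and an exit from it. The set of points which are
neither before a compact set `X` nor after a compact set `Y` has the whole spacetime as its domain
of dependence if no point of `Y` is before a point of `X` (`Spacetime.D_slice`). On the algebraic
side, everything rests on the fact that the commutant of some tensor factors is the product of the
others (`IsFactorization.mem_iSup_of_commute`).

*Necessity of the form.* If Alice's laboratory is not after the coupling zone and Charlie's is not
before it, then Alice's incoming observables commute with Charlie's outgoing ones, because the
laboratories are causally disjoint. So `Θ` maps `B(H_C)` into `B(H_BC)`. A representation of a
matrix algebra is unitarily equivalent to a multiple of the defining one, so there is an
automorphism `ψ_BC` with the same restriction to `B(H_C)`, and `(id ⊗ ψ_BC)⁻¹ ∘ Θ` fixes `B(H_C)`;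
hence it is of the form `χ_AB ⊗ id` (`exists_hasForm`).

*Existence.* The coupling zone is the part of Bob's worldline between his meeting with Charlie and
his later meeting with Alice. In the coupled theory, each worldline carries the image of its
tensor factor under `id`, `id ⊗ ψ_BC` or `(id ⊗ ψ_BC) ∘ (χ_AB ⊗ id)`, before, between and after
the two meetings. The diamond axiom holds as each meeting preserves the algebra that its two
participants generate together. Causally unrelated pieces of worldlines belong to a common stage,
which gives Einstein causality, and the Haag property holds since a suitable stage of each
worldline meets the causal complement or the hull of a given compact set.

*The coupling zone.* Suppose that no causal curve in the hull connects Alice and Charlie. If Bob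
cannot signal to Alice within the hull, then Alice's outgoing observables commute with the
incoming observables of the two others, so `Θ` preserves her algebra and `χ_AB` decomposes;
similarly, `ψ_BC` decomposes if Bob cannot signal to Charlie. Otherwise there is a last point of
Bob's worldline from which he can reach both of them before they leave the hull. Just after it he
cannot reach one of them, say Alice, while he is not yet in the future of the entries of Alice and
Charlie. There is a slice through this point and through points of Alice and Charlie just before
their entries into the hull. By the diamond axiom, the coupled theory near this slice generates
everything. It is generated by incoming observables of Alice and by operators which commute with
her incoming and outgoing observables; so her outgoing observables are among the incoming ones,
and `χ_AB` decomposes again (`FVMeasurement.scattering_mem_factor_of_slice`).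
-/

open scoped Manifold ContDiff Topology Kronecker

noncomputable section

namespace HybridAQFT


namespace Spacetime

variable {E M : Type*} [NormedAddCommGroup E] [NormedSpace ℝ E]
  [TopologicalSpace M] [ChartedSpace E M] [IsManifold 𝓘(ℝ, E) ∞ M] (S : Spacetime E M)

/-! ### Time reversal -/

/-- The spacetime with the opposite time orientation. -/
def reverse : Spacetime E M where
  two_le_dim := S.two_le_dim
  g := S.g
  g_symm := S.g_symm
  g_smooth := S.g_smooth
  T x := -S.T x
  T_smooth := S.T_smooth.neg_section
  T_timelike x := by simpa using S.T_timelike x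
  signature x v h hv := S.signature x v (by simpa using h) hv

theorem futureCausal_reverse (x : M) (v : TangentSpace 𝓘(ℝ, E) x) :
    S.reverse.FutureCausal x v ↔ S.FutureCausal x (-v) := by
  simp [FutureCausal, reverse]

theorem futureOn_reverse (γ : ℝ → M) (a b : ℝ) : S.reverse.FutureOn γ a b ↔ S.PastOn γ a b := by
  simp only [FutureOn, PastOn, futureCausal_reverse]

theorem pastOn_reverse (γ : ℝ → M) (a b : ℝ) : S.reverse.PastOn γ a b ↔ S.FutureOn γ a b := by
  simp only [FutureOn, PastOn, futureCausal_reverse, neg_neg]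

variable {S}

/-! ### Operations on causal curves -/

theorem FutureOn.continuousOn {γ : ℝ → M} {a b : ℝ} (h : S.FutureOn γ a b) :
    ContinuousOn γ (Set.Icc a b) := h.1.continuousOn

theorem FutureOn.mono {γ : ℝ → M} {a b a' b' : ℝ} (h : S.FutureOn γ a b) (ha : a ≤ a')
    (hb : b' ≤ b) (hab : a' < b') : S.FutureOn γ a' b' := by
  have hsub : Set.Icc a' b' ⊆ Set.Icc a b := Set.Icc_subset_Icc ha hb
  refine ⟨h.1.mono hsub, fun t ht ↦ ?_⟩
  have hd : mfderivWithin 𝓘(ℝ, ℝ) 𝓘(ℝ, E) γ (Set.Icc a' b') t =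
      mfderivWithin 𝓘(ℝ, ℝ) 𝓘(ℝ, E) γ (Set.Icc a b) t :=
    mfderivWithin_subset hsub ((uniqueDiffOn_Icc hab t ht).uniqueMDiffWithinAt)
      ((h.1 t (hsub ht)).mdifferentiableWithinAt (by simp))
  rw [hd]
  exact h.2 t (hsub ht)

theorem FutureOn.congr {γ γ' : ℝ → M} {a b : ℝ} (h : S.FutureOn γ a b)
    (hγ : ∀ t ∈ Set.Icc a b, γ' t = γ t) : S.FutureOn γ' a b := by
  refine ⟨h.1.congr hγ, fun t ht ↦ ?_⟩
  have := h.2 t ht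
  rw [mfderivWithin_congr hγ (hγ t ht)]
  have e := hγ t ht
  revert this
  generalize (mfderivWithin 𝓘(ℝ, ℝ) 𝓘(ℝ, E) γ (Set.Icc a b) t) = D
  intro this
  change S.FutureCausal (γ' t) (D (1:ℝ) : E)
  rw [e]
  exact this

omit [IsManifold 𝓘(ℝ, E) ∞ M] in
/-- The derivative of a curve that is reparametrised by an affine map. -/
theorem mfderivWithin_comp_affine {γ : ℝ → M} {s s' : Set ℝ} {c d t : ℝ}
    (hγ : MDifferentiableWithinAt 𝓘(ℝ, ℝ) 𝓘(ℝ, E) γ s (c * t + d))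
    (hs : s' ⊆ (fun u ↦ c * u + d) ⁻¹' s) (hu : UniqueDiffWithinAt ℝ s' t) :
    (mfderivWithin 𝓘(ℝ, ℝ) 𝓘(ℝ, E) (fun u ↦ γ (c * u + d)) s' t (1 : ℝ) : E) =
      c • (mfderivWithin 𝓘(ℝ, ℝ) 𝓘(ℝ, E) γ s (c * t + d) (1 : ℝ) : E) := by
  have hd : HasDerivAt (fun u : ℝ ↦ c * u + d) c t := by
    simpa using ((hasDerivAt_id t).const_mul c).add_const d
  have h1 : HasMFDerivWithinAt 𝓘(ℝ, ℝ) 𝓘(ℝ, ℝ) (fun u : ℝ ↦ c * u + d) s' t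
      (ContinuousLinearMap.toSpanSingleton ℝ c) :=
    hd.hasFDerivAt.hasFDerivWithinAt.hasMFDerivWithinAt
  have h2 := (hγ.hasMFDerivWithinAt.comp t h1 hs).mfderivWithin hu.uniqueMDiffWithinAt
  have h3 := congrArg (fun L : ℝ →L[ℝ] E ↦ L 1) h2
  refine h3.trans ?_
  have h4 : ∀ D : ℝ →L[ℝ] E, D (ContinuousLinearMap.toSpanSingleton ℝ c (1 : ℝ)) = c • D 1 :=
    fun D ↦ by rw [ContinuousLinearMap.toSpanSingleton_apply, one_smul, ← map_smul, smul_eq_mul,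
      mul_one]
  exact h4 _

theorem FutureOn.comp_add {γ : ℝ → M} {a b : ℝ} (h : S.FutureOn γ a b) (hab : a < b) (d : ℝ) :
    S.FutureOn (fun t ↦ γ (t + d)) (a - d) (b - d) := by
  have hsub : Set.Icc (a - d) (b - d) ⊆ (fun u ↦ 1 * u + d) ⁻¹' Set.Icc a b := fun t ht ↦ by
    simp only [Set.mem_preimage, Set.mem_Icc] at ht ⊢
    constructor <;> linarith [ht.1, ht.2]
  have e : (fun t ↦ γ (t + d)) = fun t ↦ γ (1 * t + d) := by simp
  rw [e]
  refine ⟨?_, fun t ht ↦ ?_⟩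
  · refine h.1.comp (ContDiff.contMDiff (by fun_prop)).contMDiffOn hsub
  · have := mfderivWithin_comp_affine ((h.1 _ (hsub ht)).mdifferentiableWithinAt (by simp)) hsub
      (uniqueDiffOn_Icc (by linarith) t ht)
    rw [one_smul] at this
    have h2 := h.2 _ (hsub ht)
    change S.FutureCausal _ (_ : E)
    rw [this]
    exact h2

theorem PastOn.comp_neg {γ : ℝ → M} {a b : ℝ} (h : S.PastOn γ a b) (hab : a < b) :
    S.FutureOn (fun t ↦ γ (-t)) (-b) (-a) := by
  have hsub : Set.Icc (-b) (-a) ⊆ (fun u ↦ (-1) * u + 0) ⁻¹' Set.Icc a b := fun t ht ↦ by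
    simp only [Set.mem_preimage, Set.mem_Icc] at ht ⊢
    constructor <;> linarith [ht.1, ht.2]
  have e : (fun t ↦ γ (-t)) = fun t ↦ γ ((-1) * t + 0) := by simp
  rw [e]
  refine ⟨?_, fun t ht ↦ ?_⟩
  · refine h.1.comp (ContDiff.contMDiff (by fun_prop)).contMDiffOn hsub
  · have := mfderivWithin_comp_affine ((h.1 _ (hsub ht)).mdifferentiableWithinAt (by simp)) hsub
      (uniqueDiffOn_Icc (by linarith) t ht)
    rw [neg_one_smul] at this
    have h2 := h.2 _ (hsub ht)
    change S.FutureCausal _ (_ : E)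
    rw [this]
    exact h2

theorem FutureOn.comp_neg {γ : ℝ → M} {a b : ℝ} (h : S.FutureOn γ a b) (hab : a < b) :
    S.PastOn (fun t ↦ γ (-t)) (-b) (-a) := by
  rw [← futureOn_reverse]
  exact PastOn.comp_neg ((S.pastOn_reverse γ a b).2 h) hab

theorem PastOn.congr {γ γ' : ℝ → M} {a b : ℝ} (h : S.PastOn γ a b)
    (hγ : ∀ t ∈ Set.Icc a b, γ' t = γ t) : S.PastOn γ' a b := by
  rw [← futureOn_reverse] at h ⊢
  exact h.congr hγ

theorem PastOn.comp_add {γ : ℝ → M} {a b : ℝ} (h : S.PastOn γ a b) (hab : a < b) (d : ℝ) :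
    S.PastOn (fun t ↦ γ (t + d)) (a - d) (b - d) := by
  rw [← futureOn_reverse] at h ⊢
  exact h.comp_add hab d

/-! ### The causal relation -/

theorem FutureOn.causalLE {γ : ℝ → M} {a b s t : ℝ} (h : S.FutureOn γ a b) (hs : a ≤ s)
    (hst : s ≤ t) (ht : t ≤ b) : S.CausalLE (γ s) (γ t) := by
  rcases hst.eq_or_lt with rfl | hst
  · exact .refl
  · exact .single ⟨γ, s, t, hst, h.mono hs ht hst, rfl, rfl⟩

theorem CausalLE.refl (p : M) : S.CausalLE p p := Relation.ReflTransGen.refl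

theorem CausalLE.trans {p q r : M} (h : S.CausalLE p q) (h' : S.CausalLE q r) : S.CausalLE p r :=
  Relation.ReflTransGen.trans h h'

theorem Step.reverse {p q : M} (h : S.Step p q) : S.reverse.Step q p := by
  obtain ⟨γ, a, b, hab, h, rfl, rfl⟩ := h
  refine ⟨fun t ↦ γ (-t), -b, -a, by linarith, ?_, by simp, by simp⟩
  rw [futureOn_reverse]
  exact h.comp_neg hab

variable (S) in
theorem reverse_reverse : S.reverse.reverse = S := by
  cases S; simp [reverse]

variable (S) in
theorem causalLE_reverse (p q : M) : S.reverse.CausalLE p q ↔ S.CausalLE q p := by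
  have key : ∀ (S : Spacetime E M) (p q : M), S.CausalLE p q → S.reverse.CausalLE q p := by
    intro S p q h
    induction h with
    | refl => exact .refl _
    | tail _ h ih => exact CausalLE.trans (.single (Step.reverse h)) ih
  refine ⟨fun h ↦ ?_, key S q p⟩
  have := key _ _ _ h
  rwa [reverse_reverse] at this

variable (S)

theorem JPlus_reverse (O : Set M) : S.reverse.JPlus O = S.JMinus O := by
  ext; simp [JPlus, JMinus, causalLE_reverse]

theorem JMinus_reverse (O : Set M) : S.reverse.JMinus O = S.JPlus O := by
  ext; simp [JPlus, JMinus, causalLE_reverse]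

theorem hull_reverse (O : Set M) : S.reverse.hull O = S.hull O := by
  rw [hull, hull, JPlus_reverse, JMinus_reverse, Set.inter_comm]

theorem isRegion_reverse (O : Set M) : S.reverse.IsRegion O ↔ S.IsRegion O := by
  rw [IsRegion, IsRegion, CausallyConvex, CausallyConvex, hull_reverse]

theorem futureInextendibleFrom_reverse (p : M) (γ : ℝ → M) :
    S.reverse.FutureInextendibleFrom p γ ↔ S.PastInextendibleFrom p γ := by
  simp only [FutureInextendibleFrom, PastInextendibleFrom, futureOn_reverse]

theorem pastInextendibleFrom_reverse (p : M) (γ : ℝ → M) :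
    S.reverse.PastInextendibleFrom p γ ↔ S.FutureInextendibleFrom p γ := by
  simp only [FutureInextendibleFrom, PastInextendibleFrom, pastOn_reverse]

theorem DPlus_reverse (O : Set M) : S.reverse.DPlus O = S.DMinus O := by
  simp only [DPlus, DMinus, pastInextendibleFrom_reverse]

theorem DMinus_reverse (O : Set M) : S.reverse.DMinus O = S.DPlus O := by
  simp only [DPlus, DMinus, futureInextendibleFrom_reverse]

variable {S}

theorem GloballyHyperbolic.reverse (h : S.GloballyHyperbolic) : S.reverse.GloballyHyperbolic := by
  refine ⟨fun x U hU ↦ ?_, fun p q ↦ ?_⟩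
  · simpa only [isRegion_reverse] using h.1 x U hU
  · rw [JPlus_reverse, JMinus_reverse, Set.inter_comm]
    exact h.2 q p

namespace Worldline

theorem continuous (γ : S.Worldline) : Continuous γ := γ.smooth.continuous

theorem futureOn (γ : S.Worldline) {a b : ℝ} (hab : a < b) : S.FutureOn γ a b := by
  refine ⟨γ.smooth.contMDiffOn, fun t ht ↦ ?_⟩
  rw [mfderivWithin_eq_mfderiv ((uniqueDiffOn_Icc hab t ht).uniqueMDiffWithinAt)
    (γ.smooth.mdifferentiableAt (by simp))]
  exact γ.causal t

theorem causalLE (γ : S.Worldline) {s t : ℝ} (h : s ≤ t) : S.CausalLE (γ s) (γ t) := by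
  rcases h.eq_or_lt with rfl | h
  · exact .refl _
  · exact (γ.futureOn h).causalLE le_rfl h.le le_rfl

/-- A worldline, traversed backwards, is a worldline of the time-reversed spacetime. -/
def reverse (γ : S.Worldline) : S.reverse.Worldline where
  toFun t := γ (-t)
  smooth := γ.smooth.comp (ContDiff.contMDiff (by fun_prop))
  causal t := by
    have h : S.reverse.FutureOn (fun t ↦ γ (-t)) (-(-t + 1)) (-(-t - 1)) :=
      (S.futureOn_reverse _ _ _).2 ((γ.futureOn (by linarith)).comp_neg (by linarith))
    have h2 := h.2 t (by constructor <;> linarith)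
    rwa [mfderivWithin_of_mem_nhds (Icc_mem_nhds (by linarith) (by linarith))] at h2
  no_future_endpoint x h := γ.no_past_endpoint x (by
    simpa [Function.comp_def] using h.comp Filter.tendsto_neg_atBot_atTop)
  no_past_endpoint x h := γ.no_future_endpoint x (by
    simpa [Function.comp_def] using h.comp Filter.tendsto_neg_atTop_atBot)

theorem reverse_apply (γ : S.Worldline) (t : ℝ) : γ.reverse t = γ (-t) := rfl

end Worldline

end Spacetime

namespace Spacetime

variable {E M : Type*} [NormedAddCommGroup E] [NormedSpace ℝ E]
  [TopologicalSpace M] [ChartedSpace E M] [IsManifold 𝓘(ℝ, E) ∞ M] {S : Spacetime E M}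

/-! ### Short causal curves in a chart -/

/-- The tangent vector at `φ⁻¹ y` that has the coordinates `v` in the preferred chart `φ` at `p`. -/
def chartVector (p : M) (y v : E) : TangentSpace 𝓘(ℝ, E) ((extChartAt 𝓘(ℝ, E) p).symm y) :=
  (trivializationAt E (TangentSpace 𝓘(ℝ, E)) p).symmL ℝ ((extChartAt 𝓘(ℝ, E) p).symm y) v

variable (S) in
/-- In a chart, there is an open set of coordinate velocities that are future-directed causal at all
points close to `p`: by continuity, one may take the velocities close to that of the time
orientation `T p`. -/
theorem eventually_futureCausal_chartVector (p : M) : ∃ v₀ : E,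
    ∀ᶠ z : E × E in 𝓝 (extChartAt 𝓘(ℝ, E) p p, v₀),
      S.FutureCausal ((extChartAt 𝓘(ℝ, E) p).symm z.1) (chartVector p z.1 z.2) := by
  set φ := extChartAt 𝓘(ℝ, E) p with hφ
  set e := trivializationAt E (TangentSpace 𝓘(ℝ, E)) p with he
  have hp : p ∈ e.baseSet := FiberBundle.mem_baseSet_trivializationAt' p
  have hinv : φ.symm (φ p) = p := extChartAt_to_inv p
  refine ⟨e.continuousLinearMapAt ℝ p (S.T p), ?_⟩
  set v₀ : E := e.continuousLinearMapAt ℝ p (S.T p) with hv₀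
  -- the base point depends continuously on the coordinates
  have hb : ContinuousAt (fun z : E × E ↦ φ.symm z.1) (φ p, v₀) :=
    ContinuousAt.comp (f := Prod.fst) (g := φ.symm) (continuousAt_extChartAt_symm p)
      continuousAt_fst
  have hW : ContinuousAt (fun z : E × E ↦ (⟨φ.symm z.1, chartVector p z.1 z.2⟩ :
      Bundle.TotalSpace E (TangentSpace 𝓘(ℝ, E) : M → Type _))) (φ p, v₀) := by
    have h1 : ContinuousAt (fun z : E × E ↦ e.toOpenPartialHomeomorph.symm (φ.symm z.1, z.2))
        (φ p, v₀) := by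
      refine ContinuousAt.comp (f := fun z : E × E ↦ (φ.symm z.1, z.2))
        (g := e.toOpenPartialHomeomorph.symm) ?_ (hb.prodMk continuousAt_snd)
      refine e.toOpenPartialHomeomorph.symm.continuousAt ?_
      simp only [hinv]
      exact e.mem_target.2 hp
    refine h1.congr ?_
    have : ∀ᶠ z : E × E in 𝓝 (φ p, v₀), φ.symm z.1 ∈ e.baseSet :=
      hb.eventually_mem (e.open_baseSet.mem_nhds (by simpa only [hinv] using hp))
    filter_upwards [this] with z hz
    rw [← e.mk_symm hz z.2, ← e.symmL_apply (R := ℝ) hz]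
    rfl
  have hT : ContinuousAt (fun z : E × E ↦ (⟨φ.symm z.1, S.T (φ.symm z.1)⟩ :
      Bundle.TotalSpace E (TangentSpace 𝓘(ℝ, E) : M → Type _))) (φ p, v₀) :=
    ContinuousAt.comp (f := fun z : E × E ↦ φ.symm z.1)
      (g := fun x ↦ (⟨x, S.T x⟩ : Bundle.TotalSpace E (TangentSpace 𝓘(ℝ, E) : M → Type _)))
      S.T_smooth.continuous.continuousAt hb
  have hg : ContinuousAt (fun z : E × E ↦ Bundle.TotalSpace.mk' (E →L[ℝ] E →L[ℝ] ℝ)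
      (E := fun x : M ↦ TangentSpace 𝓘(ℝ, E) x →L[ℝ] TangentSpace 𝓘(ℝ, E) x →L[ℝ]
        Bundle.Trivial M ℝ x)
      (φ.symm z.1) (S.g (φ.symm z.1))) (φ p, v₀) :=
    ContinuousAt.comp (f := fun z : E × E ↦ φ.symm z.1)
      (g := fun x : M ↦ Bundle.TotalSpace.mk' (E →L[ℝ] E →L[ℝ] ℝ)
      (E := fun x : M ↦ TangentSpace 𝓘(ℝ, E) x →L[ℝ] TangentSpace 𝓘(ℝ, E) x →L[ℝ] ℝ) x (S.g x))
      S.g_smooth.continuous.continuousAt hb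
  have real_part : ∀ f : ∀ z : E × E, Bundle.Trivial M ℝ (φ.symm z.1),
      ContinuousAt (fun z : E × E ↦ Bundle.TotalSpace.mk' ℝ (E := Bundle.Trivial M ℝ)
        (φ.symm z.1) (f z)) (φ p, v₀) → ContinuousAt (fun z ↦ (f z : ℝ)) (φ p, v₀) := by
    intro f hf
    exact ((FiberBundle.continuousAt_totalSpace (F := ℝ) _).1 hf).2
  have hWW := real_part _ (hg.clm_bundle_apply₂ (F₁ := E) (F₂ := E) (F₃ := ℝ) hW hW)
  have hTW := real_part _ (hg.clm_bundle_apply₂ (F₁ := E) (F₂ := E) (F₃ := ℝ) hT hW)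
  have hW₀ : chartVector p (φ p) v₀ = (S.T (φ.symm (φ p)) : E) := by
    change (e.symmL ℝ (φ.symm (φ p)) v₀ : E) = _
    rw [hinv]
    exact e.symmL_continuousLinearMapAt hp (S.T p)
  have h1 : S.g (φ.symm (φ p)) (chartVector p (φ p) v₀) (chartVector p (φ p) v₀) < 0 := by
    rw [hW₀]; exact S.T_timelike _
  have h2 : S.g (φ.symm (φ p)) (S.T (φ.symm (φ p))) (chartVector p (φ p) v₀) < 0 := by
    rw [hW₀]; exact S.T_timelike _
  filter_upwards [hWW.eventually_lt_const h1, hTW.eventually_lt_const h2] with z hz1 hz2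
  refine ⟨fun h0 ↦ ?_, le_of_lt hz1, hz2⟩
  rw [h0] at hz1
  simp at hz1

/-- A coordinate line whose coordinate velocity gives future-directed causal vectors is a
future-directed causal curve. -/
theorem futureOn_chart_line (p : M) (y v : E) {b : ℝ} (hb : 0 < b)
    (hmem : ∀ t ∈ Set.Icc 0 b, y + t • v ∈ (extChartAt 𝓘(ℝ, E) p).target)
    (hc : ∀ t ∈ Set.Icc 0 b, S.FutureCausal ((extChartAt 𝓘(ℝ, E) p).symm (y + t • v))
      (chartVector p (y + t • v) v)) :
    S.FutureOn (fun t ↦ (extChartAt 𝓘(ℝ, E) p).symm (y + t • v)) 0 b := by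
  have hsm := contMDiffOn_extChartAt_symm (I := 𝓘(ℝ, E)) (n := ∞) p
  refine ⟨hsm.comp (ContDiff.contMDiff (by fun_prop)).contMDiffOn hmem, fun t ht ↦ ?_⟩
  set φ := extChartAt 𝓘(ℝ, E) p with hφ
  have hd : HasDerivAt (fun u : ℝ ↦ y + u • v) v t := by
    simpa using ((hasDerivAt_id t).smul_const v).const_add y
  have h1 : HasMFDerivWithinAt 𝓘(ℝ, ℝ) 𝓘(ℝ, E) (fun u : ℝ ↦ y + u • v) (Set.Icc 0 b) t
      (ContinuousLinearMap.toSpanSingleton ℝ v) :=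
    hd.hasFDerivAt.hasFDerivWithinAt.hasMFDerivWithinAt
  have h0 : MDifferentiableWithinAt 𝓘(ℝ, E) 𝓘(ℝ, E) φ.symm (Set.range 𝓘(ℝ, E)) (y + t • v) :=
    mdifferentiableWithinAt_extChartAt_symm (hmem t ht)
  have h2 := (h0.hasMFDerivWithinAt.comp t h1 (fun _ _ ↦ by simp)).mfderivWithin
    (uniqueDiffOn_Icc hb t ht).uniqueMDiffWithinAt
  have hs : φ.symm (y + t • v) ∈ (chartAt E p).source := by
    rw [← extChartAt_source 𝓘(ℝ, E)]; exact φ.map_target (hmem t ht)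
  have h3 := TangentBundle.symmL_trivializationAt (I := 𝓘(ℝ, E)) hs
  rw [φ.right_inv (hmem t ht)] at h3
  have h4 := hc t ht
  have h5 : (mfderivWithin 𝓘(ℝ, ℝ) 𝓘(ℝ, E) (fun t ↦ φ.symm (y + t • v)) (Set.Icc 0 b) t (1 : ℝ) : E)
      = chartVector p (y + t • v) v := by
    refine (congrArg (fun L : ℝ →L[ℝ] E ↦ L 1) h2).trans ?_
    refine Eq.trans ?_ (congrArg (fun L : E →L[ℝ] E ↦ L v) h3).symm
    have h6 : ∀ D : E →L[ℝ] E, D (ContinuousLinearMap.toSpanSingleton ℝ v (1 : ℝ)) = D v :=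
      fun D ↦ by rw [ContinuousLinearMap.toSpanSingleton_apply, one_smul]
    exact h6 _
  change S.FutureCausal _ (_ : E)
  rw [h5]
  exact h4

/-- Arbitrarily close to every point there are points in its past whose causal future contains a
neighbourhood of the point. -/
theorem exists_JPlus_mem_nhds (p : M) {U : Set M} (hU : U ∈ 𝓝 p) :
    ∃ p' ∈ U, S.JPlus {p'} ∈ 𝓝 p := by
  obtain ⟨v₀, h⟩ := S.eventually_futureCausal_chartVector p
  set φ := extChartAt 𝓘(ℝ, E) p with hφ
  have hinv : φ.symm (φ p) = p := extChartAt_to_inv p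
  have hcont : ContinuousAt φ.symm (φ p) := continuousAt_extChartAt_symm p
  -- all velocities in `Q` are future-directed causal at all points of a ball around `φ p`
  obtain ⟨P, hP, Q, hQ, hPQ⟩ := Filter.eventually_prod_iff.1 (by rw [nhds_prod_eq] at h; exact h)
  have hN : {y | P y} ∩ φ.target ∩ φ.symm ⁻¹' U ∈ 𝓝 (φ p) :=
    Filter.inter_mem (Filter.inter_mem hP (extChartAt_target_mem_nhds p))
      (hcont (by rwa [hinv]))
  obtain ⟨r, hr, hball⟩ := Metric.mem_nhds_iff.1 hN
  -- go back from `φ p` by `ε v₀`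
  obtain ⟨ε, hε, hεr⟩ : ∃ ε : ℝ, 0 < ε ∧ φ p - ε • v₀ ∈ Metric.ball (φ p) r := by
    have : Filter.Tendsto (fun ε : ℝ ↦ φ p - ε • v₀) (𝓝 0) (𝓝 (φ p)) := by
      have : ContinuousAt (fun ε : ℝ ↦ φ p - ε • v₀) 0 := by fun_prop
      simpa [ContinuousAt] using this
    obtain ⟨ε, h1, h2⟩ := ((this.eventually (Metric.ball_mem_nhds _ hr)).filter_mono
      nhdsWithin_le_nhds |>.and self_mem_nhdsWithin : ∀ᶠ ε in 𝓝[>] (0 : ℝ), _ ∧ _).exists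
    exact ⟨ε, h2, h1⟩
  refine ⟨φ.symm (φ p - ε • v₀), (hball hεr).2, ?_⟩
  have hvel : ∀ᶠ y in 𝓝 (φ p), Q (ε⁻¹ • (y - (φ p - ε • v₀))) := by
    have : ContinuousAt (fun y ↦ ε⁻¹ • (y - (φ p - ε • v₀))) (φ p) := by fun_prop
    refine this.eventually ?_
    have e : ε⁻¹ • (φ p - (φ p - ε • v₀)) = v₀ := by
      rw [sub_sub_cancel, smul_smul, inv_mul_cancel₀ hε.ne', one_smul]
    simpa only [e] using hQ
  have hφc : ContinuousAt φ p := continuousAt_extChartAt p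
  filter_upwards [hφc.eventually hvel, hφc.eventually (Metric.ball_mem_nhds _ hr),
    extChartAt_source_mem_nhds (I := 𝓘(ℝ, E)) p] with q hq1 hq2 hq3
  set v := ε⁻¹ • (φ q - (φ p - ε • v₀)) with hv
  have hend : φ p - ε • v₀ + ε • v = φ q := by
    rw [hv, smul_smul, mul_inv_cancel₀ hε.ne', one_smul]; abel
  have hseg : ∀ t ∈ Set.Icc 0 ε, φ p - ε • v₀ + t • v ∈ Metric.ball (φ p) r := by
    intro t ht
    have h01 : t / ε ∈ Set.Icc (0 : ℝ) 1 :=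
      ⟨div_nonneg ht.1 hε.le, (div_le_one hε).2 ht.2⟩
    have := (convex_ball (φ p) r).add_smul_sub_mem hεr hq2 h01
    convert this using 2
    rw [hv, smul_smul, div_eq_mul_inv]
  refine ⟨_, rfl, .single ⟨_, 0, ε, hε, futureOn_chart_line p (φ p - ε • v₀) v hε
    (fun t ht ↦ (hball (hseg t ht)).1.2) (fun t ht ↦ hPQ (hball (hseg t ht)).1.1 hq1), ?_, ?_⟩⟩
  · simp [hφ]
  · simp only [hend]
    exact φ.left_inv hq3

theorem exists_JMinus_mem_nhds (p : M) {U : Set M} (hU : U ∈ 𝓝 p) :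
    ∃ p' ∈ U, S.JMinus {p'} ∈ 𝓝 p := by
  obtain ⟨p', h1, h2⟩ := exists_JPlus_mem_nhds (S := S.reverse) p hU
  exact ⟨p', h1, by rwa [JPlus_reverse] at h2⟩

end Spacetime

namespace Spacetime

variable {E M : Type*} [NormedAddCommGroup E] [NormedSpace ℝ E]
  [TopologicalSpace M] [ChartedSpace E M] [IsManifold 𝓘(ℝ, E) ∞ M] {S : Spacetime E M}

/-! ### Causal futures and pasts -/

theorem subset_JPlus (O : Set M) : O ⊆ S.JPlus O := fun p hp ↦ ⟨p, hp, .refl p⟩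

theorem subset_JMinus (O : Set M) : O ⊆ S.JMinus O := fun p hp ↦ ⟨p, hp, .refl p⟩

theorem JPlus_of_le {O : Set M} {p q : M} (hp : p ∈ S.JPlus O) (h : S.CausalLE p q) :
    q ∈ S.JPlus O := by
  obtain ⟨o, ho, h'⟩ := hp
  exact ⟨o, ho, h'.trans h⟩

theorem JMinus_of_le {O : Set M} {p q : M} (hq : q ∈ S.JMinus O) (h : S.CausalLE p q) :
    p ∈ S.JMinus O := by
  obtain ⟨o, ho, h'⟩ := hq
  exact ⟨o, ho, h.trans h'⟩

theorem JPlus_mono {O P : Set M} (h : O ⊆ P) : S.JPlus O ⊆ S.JPlus P :=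
  fun _ ⟨p, hp, h'⟩ ↦ ⟨p, h hp, h'⟩

theorem JMinus_mono {O P : Set M} (h : O ⊆ P) : S.JMinus O ⊆ S.JMinus P :=
  fun _ ⟨p, hp, h'⟩ ↦ ⟨p, h hp, h'⟩

theorem mem_JPlus_singleton {p q : M} : q ∈ S.JPlus {p} ↔ S.CausalLE p q := by
  simp [JPlus]

theorem mem_JMinus_singleton {p q : M} : q ∈ S.JMinus {p} ↔ S.CausalLE q p := by
  simp [JMinus]

theorem mem_perp {O : Set M} {p : M} : p ∈ S.perp O ↔ p ∉ S.JPlus O ∧ p ∉ S.JMinus O := by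
  simp [perp]

theorem IsRegion.mem_of_le {O : Set M} (hO : S.IsRegion O) {p q r : M} (hp : p ∈ O) (hr : r ∈ O)
    (hpq : S.CausalLE p q) (hqr : S.CausalLE q r) : q ∈ O :=
  hO.2 ▸ ⟨⟨p, hp, hpq⟩, ⟨r, hr, hqr⟩⟩

theorem IsRegion.hull_subset {O K : Set M} (hO : S.IsRegion O) (hK : K ⊆ O) : S.hull K ⊆ O := by
  rintro q ⟨⟨p, hp, hpq⟩, ⟨r, hr, hqr⟩⟩
  exact hO.mem_of_le (hK hp) (hK hr) hpq hqr

theorem isRegion_of_mem {O : Set M} (hO : IsOpen O)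
    (h : ∀ p ∈ O, ∀ r ∈ O, ∀ q, S.CausalLE p q → S.CausalLE q r → q ∈ O) : S.IsRegion O := by
  refine ⟨hO, Set.Subset.antisymm ?_ fun p hp ↦ ⟨subset_JPlus O hp, subset_JMinus O hp⟩⟩
  rintro q ⟨⟨p, hp, hpq⟩, ⟨r, hr, hqr⟩⟩
  exact h p hp r hr q hpq hqr

variable (S) in
theorem isRegion_univ : S.IsRegion (Set.univ : Set M) :=
  isRegion_of_mem isOpen_univ fun _ _ _ _ _ _ _ ↦ trivial

theorem JPlus_eq_biUnion (O : Set M) : S.JPlus O = ⋃ p ∈ O, S.JPlus {p} := by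
  ext q; simp [JPlus]

/-- The causal future of a compact set is covered by the futures of finitely many points, which can
be chosen outside a given closed set that the compact set avoids. -/
theorem exists_finite_JPlus_cover (S : Spacetime E M) {K C : Set M} (hK : IsCompact K)
    (hC : IsClosed C) (hKC : Disjoint K C) :
    ∃ F : Set M, F.Finite ∧ Disjoint F C ∧ K ⊆ S.JPlus F := by
  have : ∀ k ∈ K, ∃ p' ∈ Cᶜ, S.JPlus {p'} ∈ 𝓝 k := fun k hk ↦
    exists_JPlus_mem_nhds k (hC.isOpen_compl.mem_nhds (Set.disjoint_left.1 hKC hk))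
  choose! f hf1 hf2 using this
  obtain ⟨t, ht1, ht2⟩ := hK.elim_nhds_subcover (fun k ↦ S.JPlus {f k}) hf2
  refine ⟨f '' t, t.finite_toSet.image f, ?_, ?_⟩
  · rw [Set.disjoint_left]
    rintro _ ⟨k, hk, rfl⟩
    exact hf1 k (ht1 k hk)
  · intro k hk
    obtain ⟨j, hj, hjk⟩ := Set.mem_iUnion₂.1 (ht2 hk)
    exact JPlus_mono (by simpa using ⟨j, hj, rfl⟩) hjk

/-! ### Consequences of global hyperbolicity -/

section GloballyHyperbolic

variable [T2Space M] (hS : S.GloballyHyperbolic)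

include hS

/-- The causal future of a point is closed: near `q` it agrees with the compact causal diamond
between `p` and a point slightly to the future of `q`. -/
theorem isClosed_JPlus_singleton (p : M) : IsClosed (S.JPlus {p}) := by
  refine isClosed_of_closure_subset fun q hq ↦ ?_
  obtain ⟨q', -, hq'⟩ := exists_JMinus_mem_nhds (S := S) q Filter.univ_mem
  have h1 : q ∈ closure (S.JPlus {p} ∩ S.JMinus {q'}) := by
    rw [mem_closure_iff_nhds] at hq ⊢
    intro t ht
    obtain ⟨x, ⟨hx1, hx2⟩, hx3⟩ := hq _ (Filter.inter_mem ht hq')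
    exact ⟨x, hx1, hx3, hx2⟩
  exact ((hS.2 p q').isClosed.closure_eq ▸ h1).1

theorem isClosed_JMinus_singleton (p : M) : IsClosed (S.JMinus {p}) := by
  rw [← JPlus_reverse]
  exact isClosed_JPlus_singleton hS.reverse p

/-- The causal relation is closed. -/
theorem eventually_not_causalLE {p q : M} (h : ¬ S.CausalLE p q) :
    ∀ᶠ z : M × M in 𝓝 (p, q), ¬ S.CausalLE z.1 z.2 := by
  obtain ⟨p', hp', hn⟩ := exists_JPlus_mem_nhds (S := S) p
    ((isClosed_JMinus_singleton hS q).isOpen_compl.mem_nhds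
      (by simpa [mem_JMinus_singleton] using h))
  have hq : (S.JPlus {p'})ᶜ ∈ 𝓝 q := (isClosed_JPlus_singleton hS p').isOpen_compl.mem_nhds
      (by simpa [mem_JMinus_singleton, mem_JPlus_singleton] using hp')
  filter_upwards [prod_mem_nhds hn hq] with z ⟨hz1, hz2⟩ h
  exact hz2 (JPlus_of_le hz1 h)

theorem isClosed_JPlus {K : Set M} (hK : IsCompact K) : IsClosed (S.JPlus K) := by
  refine isClosed_of_closure_subset fun q hq ↦ ?_
  by_contra hqK
  obtain ⟨F, hF, hFC, hKF⟩ := S.exists_finite_JPlus_cover hK (isClosed_JMinus_singleton hS q)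
    (Set.disjoint_left.2 fun k hk hkq ↦ hqK ⟨k, hk, mem_JMinus_singleton.1 hkq⟩)
  have hcl : IsClosed (S.JPlus F) := by
    rw [JPlus_eq_biUnion]
    exact hF.isClosed_biUnion fun p _ ↦ isClosed_JPlus_singleton hS p
  have hsub : S.JPlus K ⊆ S.JPlus F := fun x ⟨k, hk, hkx⟩ ↦ JPlus_of_le (hKF hk) hkx
  obtain ⟨p, hp, hpq⟩ := closure_minimal hsub hcl hq
  exact Set.disjoint_left.1 hFC hp (mem_JMinus_singleton.2 hpq)

theorem isClosed_JMinus {K : Set M} (hK : IsCompact K) : IsClosed (S.JMinus K) := by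
  rw [← JPlus_reverse]
  exact isClosed_JPlus hS.reverse hK

theorem isOpen_perp {K : Set M} (hK : IsCompact K) : IsOpen (S.perp K) :=
  ((isClosed_JPlus hS hK).union (isClosed_JMinus hS hK)).isOpen_compl

theorem isOpen_MPlus {K : Set M} (hK : IsCompact K) : IsOpen (S.MPlus K) :=
  (isClosed_JMinus hS hK).isOpen_compl

theorem isOpen_MMinus {K : Set M} (hK : IsCompact K) : IsOpen (S.MMinus K) :=
  (isClosed_JPlus hS hK).isOpen_compl

theorem isCompact_JPlus_inter_JMinus {K : Set M} (hK : IsCompact K) (q : M) :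
    IsCompact (S.JPlus {q} ∩ S.JMinus K) := by
  obtain ⟨F, hF, -, hKF⟩ := S.reverse.exists_finite_JPlus_cover hK isClosed_empty
    (Set.disjoint_empty K)
  rw [JPlus_reverse] at hKF
  have hc : IsCompact (⋃ p ∈ F, S.JPlus {q} ∩ S.JMinus {p}) :=
    hF.isCompact_biUnion fun p _ ↦ hS.2 q p
  refine hc.of_isClosed_subset ((isClosed_JPlus_singleton hS q).inter (isClosed_JMinus hS hK)) ?_
  rintro x ⟨hx, k, hk, hxk⟩
  obtain ⟨p, hp, hkp⟩ := hKF hk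
  exact Set.mem_biUnion hp ⟨hx, mem_JMinus_singleton.2 (hxk.trans hkp)⟩

/-- The causal relation is antisymmetric, by strong causality. -/
theorem causalLE_antisymm {p q : M} (h : S.CausalLE p q) (h' : S.CausalLE q p) : p = q := by
  by_contra hne
  obtain ⟨V, hV1, hV2, hV3⟩ := hS.1 p {q}ᶜ (isOpen_compl_singleton.mem_nhds hne)
  exact hV1 (hV3.mem_of_le hV2 hV2 h h') rfl

/-- A worldline never returns to its past. -/
theorem Worldline.not_causalLE (γ : S.Worldline) {s t : ℝ} (h : s < t) :
    ¬ S.CausalLE (γ t) (γ s) := by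
  intro hle
  have hconst : ∀ u ∈ Set.Icc s t, γ u = γ s := fun u hu ↦
    (causalLE_antisymm hS (γ.causalLE hu.1) ((γ.causalLE hu.2).trans hle)).symm
  have hc : S.FutureOn (fun _ ↦ γ s) s t := (γ.futureOn h).congr fun u hu ↦ (hconst u hu).symm
  refine (hc.2 s ⟨le_rfl, h.le⟩).1 ?_
  rw [mfderivWithin_const]
  rfl

omit [T2Space M] in
/-- A causal curve without future endpoint leaves every compact set. -/
theorem exists_notMem_of_isCompact {γ : ℝ → M}
    (hmono : ∀ s t, 0 ≤ s → s ≤ t → S.CausalLE (γ s) (γ t))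
    (hend : ∀ x, ¬ Filter.Tendsto γ Filter.atTop (𝓝 x)) {C : Set M} (hC : IsCompact C) :
    ∃ t, 0 ≤ t ∧ γ t ∉ C := by
  by_contra! hcon
  obtain ⟨x, -, hx⟩ := hC (f := Filter.map γ Filter.atTop)
    (Filter.le_principal_iff.2 (Filter.mem_map.2
      (Filter.mem_atTop_sets.2 ⟨0, fun t ht ↦ hcon t ht⟩)))
  refine hend x fun U hU ↦ ?_
  obtain ⟨V, hVU, hxV, hV⟩ := hS.1 x U hU
  have hfreq : ∃ᶠ t in Filter.atTop, γ t ∈ V :=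
    (Filter.HasBasis.mapClusterPt_iff_frequently (𝓝 x).basis_sets).1 hx V (hV.1.mem_nhds hxV)
  obtain ⟨s, hs0, hs⟩ := Filter.frequently_atTop.1 hfreq 0
  refine Filter.mem_map.2 (Filter.mem_atTop_sets.2 ⟨s, fun t ht ↦ hVU ?_⟩)
  obtain ⟨u, hu0, hu⟩ := Filter.frequently_atTop.1 hfreq t
  exact hV.mem_of_le hs hu (hmono s t hs0 ht) (hmono t u (hs0.trans ht) hu0)

theorem Worldline.exists_notMem_JMinus (γ : S.Worldline) {K : Set M} (hK : IsCompact K) :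
    ∃ t, γ t ∉ S.JMinus K := by
  obtain ⟨t, ht, h⟩ := exists_notMem_of_isCompact hS (fun s t _ h ↦ γ.causalLE h)
    γ.no_future_endpoint (isCompact_JPlus_inter_JMinus hS hK (γ 0))
  exact ⟨t, fun h' ↦ h ⟨mem_JPlus_singleton.2 (γ.causalLE ht), h'⟩⟩

theorem Worldline.exists_notMem_JPlus (γ : S.Worldline) {K : Set M} (hK : IsCompact K) :
    ∃ t, γ t ∉ S.JPlus K := by
  obtain ⟨t, ht⟩ := γ.reverse.exists_notMem_JMinus hS.reverse hK
  exact ⟨-t, by rwa [JMinus_reverse] at ht⟩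

/-- A part of a worldline that avoids the hull and the causal complement of `K` lies entirely in
`J⁺(K) \ J⁻(K)` or entirely in `J⁻(K) \ J⁺(K)`. -/
theorem Worldline.exists_mem_hull_or_perp (γ : S.Worldline) {K : Set M} (hK : IsCompact K)
    {I : Set ℝ} (hI : IsPreconnected I) (h1 : ∃ t ∈ I, γ t ∈ S.JMinus K ∨ γ t ∉ S.JPlus K)
    (h2 : ∃ t ∈ I, γ t ∈ S.JPlus K ∨ γ t ∉ S.JMinus K) :
    (∃ t ∈ I, γ t ∈ S.hull K) ∨ ∃ t ∈ I, γ t ∈ S.perp K := by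
  by_contra! hcon
  obtain ⟨hh, hp⟩ := hcon
  have hcov : ∀ t ∈ I, γ t ∈ S.JPlus K ∨ γ t ∈ S.JMinus K := fun t ht ↦ by
    by_contra h
    exact hp t ht h
  obtain ⟨t₁, ht₁, h1⟩ := h1
  obtain ⟨t₂, ht₂, h2⟩ := h2
  obtain ⟨t, htI, ht⟩ := isPreconnected_closed_iff.1 hI _ _
    ((isClosed_JPlus hS hK).preimage γ.continuous) ((isClosed_JMinus hS hK).preimage γ.continuous)
    hcov ⟨t₂, ht₂, h2.elim id fun h ↦ (hcov t₂ ht₂).resolve_right h⟩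
    ⟨t₁, ht₁, h1.elim id fun h ↦ (hcov t₁ ht₁).resolve_left h⟩
  exact hh t htI ht

/-- A worldline which avoids the causal complement of a compact set meets its causal hull. -/
theorem Worldline.meets_hull_or_perp (γ : S.Worldline) {K : Set M} (hK : IsCompact K) :
    (∃ t, γ t ∈ S.hull K) ∨ ∃ t, γ t ∈ S.perp K := by
  obtain ⟨t₁, ht₁⟩ := γ.exists_notMem_JMinus hS hK
  obtain ⟨t₂, ht₂⟩ := γ.exists_notMem_JPlus hS hK
  simpa using γ.exists_mem_hull_or_perp hS hK isPreconnected_univ ⟨t₂, trivial, Or.inr ht₂⟩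
    ⟨t₁, trivial, Or.inr ht₁⟩

/-- A worldline that meets the causal hull of a compact set `K` has a first point in `J⁺(K)`; it
belongs to the hull. -/
theorem Worldline.exists_entry (γ : S.Worldline) {K : Set M} (hK : IsCompact K)
    (h : ∃ t, γ t ∈ S.hull K) : ∃ a, γ a ∈ S.hull K ∧ ∀ t < a, γ t ∉ S.JPlus K := by
  obtain ⟨t₀, ht₀⟩ := h
  obtain ⟨t₁, ht₁⟩ := γ.exists_notMem_JPlus hS hK
  have hbdd : BddBelow {t | γ t ∈ S.JPlus K} := ⟨t₁, fun t ht ↦ by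
    by_contra hlt
    exact ht₁ (JPlus_of_le ht (γ.causalLE (not_le.1 hlt).le))⟩
  have hmem := ((isClosed_JPlus hS hK).preimage γ.continuous).csInf_mem ⟨t₀, ht₀.1⟩ hbdd
  refine ⟨_, ⟨hmem, JMinus_of_le ht₀.2 (γ.causalLE (csInf_le hbdd ht₀.1))⟩, fun t ht h ↦ ?_⟩
  exact not_le.2 ht (csInf_le hbdd h)

theorem Worldline.exists_exit (γ : S.Worldline) {K : Set M} (hK : IsCompact K)
    (h : ∃ t, γ t ∈ S.hull K) : ∃ a, γ a ∈ S.hull K ∧ ∀ t > a, γ t ∉ S.JMinus K := by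
  obtain ⟨t₀, ht₀⟩ := h
  obtain ⟨a, h1, h2⟩ := γ.reverse.exists_entry hS.reverse hK
    ⟨-t₀, by rw [hull_reverse, reverse_apply, neg_neg]; exact ht₀⟩
  refine ⟨-a, by rwa [hull_reverse] at h1, fun t ht h ↦ h2 (-t) (by linarith) ?_⟩
  rw [JPlus_reverse, reverse_apply, neg_neg]
  exact h

/-- Causally unrelated points have causally disjoint neighbourhoods that are regions. -/
theorem exists_causallyDisjoint {p q : M} (h : ¬ S.CausalLE p q) (h' : ¬ S.CausalLE q p) :
    ∃ V W, p ∈ V ∧ q ∈ W ∧ S.IsRegion V ∧ S.IsRegion W ∧ S.CausallyDisjoint V W := by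
  have h1 := eventually_not_causalLE hS h
  have h2 := (eventually_not_causalLE hS h')
  rw [← Prod.swap_prod_mk, nhds_swap] at h2
  obtain ⟨U₁, hU₁, U₂, hU₂, hU⟩ := Filter.mem_prod_iff.1
    (nhds_prod_eq (x := p) (y := q) ▸ h1.and (Filter.eventually_map.1 h2))
  obtain ⟨V, hV1, hV2, hV3⟩ := hS.1 p U₁ hU₁
  obtain ⟨W, hW1, hW2, hW3⟩ := hS.1 q U₂ hU₂
  refine ⟨V, W, hV2, hW2, hV3, hW3, fun x hx ↦ mem_perp.2 ⟨?_, ?_⟩⟩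
  · rintro ⟨y, hy, hyx⟩
    exact (hU (Set.mk_mem_prod (hV1 hx) (hW1 hy))).2 hyx
  · rintro ⟨y, hy, hxy⟩
    exact (hU (Set.mk_mem_prod (hV1 hx) (hW1 hy))).1 hxy

end GloballyHyperbolic

end Spacetime

namespace Spacetime

variable {E M : Type*} [NormedAddCommGroup E] [NormedSpace ℝ E]
  [TopologicalSpace M] [ChartedSpace E M] [IsManifold 𝓘(ℝ, E) ∞ M] {S : Spacetime E M}

/-! ### Domains of dependence -/

theorem exists_mem_Ico_of_tendsto {τ : ℕ → ℝ} (h0 : τ 0 = 0)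
    (hτ : Filter.Tendsto τ Filter.atTop Filter.atTop) {t : ℝ} (ht : 0 ≤ t) :
    ∃ k, t ∈ Set.Ico (τ k) (τ (k + 1)) := by
  classical
  have hex : ∃ n, t < τ n := (hτ.eventually_gt_atTop t).exists
  obtain ⟨k, hk⟩ : ∃ k, Nat.find hex = k + 1 := Nat.exists_eq_succ_of_ne_zero fun h ↦ by
    have := Nat.find_spec hex
    rw [h, h0] at this
    linarith
  refine ⟨k, not_lt.1 (Nat.find_min hex (by omega)), hk ▸ Nat.find_spec hex⟩

theorem FutureInextendibleFrom.causalLE {p : M} {γ : ℝ → M} (h : S.FutureInextendibleFrom p γ)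
    {s t : ℝ} (hs : 0 ≤ s) (hst : s ≤ t) : S.CausalLE (γ s) (γ t) := by
  obtain ⟨-, ⟨τ, h0, hmono, hτ, hγ⟩, -⟩ := h
  obtain ⟨k, hk⟩ := exists_mem_Ico_of_tendsto h0 hτ hs
  obtain ⟨l, hl⟩ := exists_mem_Ico_of_tendsto h0 hτ (hs.trans hst)
  rcases lt_trichotomy k l with hkl | rfl | hkl
  · have h1 : ∀ n, k + 1 ≤ n → S.CausalLE (γ (τ (k + 1))) (γ (τ n)) := by
      intro n hn
      induction n, hn using Nat.le_induction with
      | base => exact .refl _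
      | succ n _ ih =>
        exact ih.trans ((hγ n).causalLE le_rfl (hmono (Nat.lt_succ_self n)).le le_rfl)
    exact ((hγ k).causalLE hk.1 hk.2.le le_rfl).trans
      ((h1 l hkl).trans ((hγ l).causalLE le_rfl hl.1 hl.2.le))
  · exact (hγ k).causalLE hk.1 hst hl.2.le
  · have := hmono.monotone (Nat.succ_le_of_lt hkl)
    exact absurd hst (not_le.2 (by linarith [hl.2, hk.1]))

theorem FutureInextendibleFrom.continuousOn {p : M} {γ : ℝ → M}
    (h : S.FutureInextendibleFrom p γ) : ContinuousOn γ (Set.Ici 0) := by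
  obtain ⟨-, ⟨τ, h0, hmono, hτ, hγ⟩, -⟩ := h
  have hn : ∀ n, ContinuousOn γ (Set.Icc 0 (τ n)) := by
    intro n
    induction n with
    | zero => rw [h0, Set.Icc_self]; exact continuousOn_singleton _ _
    | succ n ih =>
      rw [← Set.Icc_union_Icc_eq_Icc (h0 ▸ hmono.monotone (Nat.zero_le n))
        (hmono (Nat.lt_succ_self n)).le]
      exact ih.union_of_isClosed (hγ n).continuousOn isClosed_Icc isClosed_Icc
  intro t ht
  obtain ⟨k, hk⟩ := exists_mem_Ico_of_tendsto h0 hτ ht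
  refine ((hn (k + 1)) t ⟨ht, hk.2.le⟩).mono_of_mem_nhdsWithin ?_
  filter_upwards [self_mem_nhdsWithin, mem_nhdsWithin_of_mem_nhds (Iio_mem_nhds hk.2)] with u h1 h2
  exact ⟨h1, le_of_lt h2⟩

section Slice

variable [T2Space M] {X Y : Set M}

theorem isRegion_slice (hS : S.GloballyHyperbolic) (hX : IsCompact X) (hY : IsCompact Y) :
    S.IsRegion (S.MPlus X ∩ S.MMinus Y) := by
  refine isRegion_of_mem ((isOpen_MPlus hS hX).inter (isOpen_MMinus hS hY)) ?_
  rintro p ⟨hp, -⟩ r ⟨-, hr⟩ q hpq hqr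
  exact ⟨fun h ↦ hp (JMinus_of_le h hpq), fun h ↦ hr (JPlus_of_le h hqr)⟩

theorem mem_D_slice_of_mem_JMinus (hS : S.GloballyHyperbolic) (hX : IsCompact X)
    (hY : IsCompact Y) (hXY : ∀ x ∈ X, ∀ y ∈ Y, ¬ S.CausalLE y x) {p : M} (hp : p ∈ S.JMinus X) :
    p ∈ S.DMinus (S.MPlus X ∩ S.MMinus Y) := by
  intro γ hγ
  by_contra! hcon
  have hdisj : ∀ z, z ∈ S.JMinus X → z ∉ S.JPlus Y := by
    rintro z ⟨x, hx, hzx⟩ ⟨y, hy, hyz⟩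
    exact hXY x hx y hy (hyz.trans hzx)
  have hcov : ∀ t, 0 ≤ t → γ t ∈ S.JMinus X ∨ γ t ∈ S.JPlus Y := by
    intro t ht
    by_contra! h
    exact hcon t ht h
  have hall : ∀ t, 0 ≤ t → γ t ∈ S.JMinus X := by
    by_contra! h
    obtain ⟨t, ht, htX⟩ := h
    obtain ⟨u, hu, ⟨hu1, -⟩, ⟨hu2, -⟩⟩ := isPreconnected_closed_iff.1
      (isPreconnected_Ici (a := (0 : ℝ)))
      (γ ⁻¹' S.JMinus X ∩ Set.Ici 0) (γ ⁻¹' S.JPlus Y ∩ Set.Ici 0)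
      (by simpa only [Set.inter_comm] using
        hγ.continuousOn.preimage_isClosed_of_isClosed isClosed_Ici (isClosed_JMinus hS hX))
      (by simpa only [Set.inter_comm] using
        hγ.continuousOn.preimage_isClosed_of_isClosed isClosed_Ici (isClosed_JPlus hS hY))
      (fun t ht ↦ (hcov t ht).imp (fun h ↦ ⟨h, ht⟩) (fun h ↦ ⟨h, ht⟩))
      ⟨0, Set.self_mem_Ici, by rw [Set.mem_preimage, hγ.1]; exact hp,
        Set.self_mem_Ici⟩
      ⟨t, ht, (hcov t ht).resolve_left htX, ht⟩
    exact hdisj _ hu1 hu2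
  obtain ⟨t, ht, h⟩ := exists_notMem_of_isCompact hS (fun s t ↦ hγ.causalLE) hγ.2.2
    (isCompact_JPlus_inter_JMinus hS hX p)
  refine h ⟨mem_JPlus_singleton.2 ?_, hall t ht⟩
  have := hγ.causalLE le_rfl ht
  rwa [hγ.1] at this

/-- If no point of the compact set `Y` lies in the past of the compact set `X`, then there is room
for a Cauchy surface between them: the set of the points neither before `X` nor after `Y` has the
whole spacetime as its domain of dependence. The reason is that an inextendible causal curve cannot
stay in `J⁻(X)` forever, and cannot pass from `J⁻(X)` to `J⁺(Y)` directly, as these are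
disjoint closed sets. -/
theorem D_slice (hS : S.GloballyHyperbolic) (hX : IsCompact X) (hY : IsCompact Y)
    (hXY : ∀ x ∈ X, ∀ y ∈ Y, ¬ S.CausalLE y x) :
    S.D (S.MPlus X ∩ S.MMinus Y) = Set.univ := by
  refine Set.eq_univ_of_forall fun p ↦ ?_
  by_cases h1 : p ∈ S.JMinus X
  · exact Or.inr (mem_D_slice_of_mem_JMinus hS hX hY hXY h1)
  · left
    by_cases h2 : p ∈ S.JPlus Y
    · have := mem_D_slice_of_mem_JMinus (S := S.reverse) hS.reverse hY hX
        (fun y hy x hx h ↦ hXY x hx y hy ((causalLE_reverse S x y).1 h))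
        (by rwa [JMinus_reverse])
      rw [DMinus_reverse, MPlus, MMinus, JMinus_reverse, JPlus_reverse, Set.inter_comm] at this
      exact this
    · exact fun γ hγ ↦ ⟨0, le_rfl, by rw [hγ.1]; exact ⟨h1, h2⟩⟩

end Slice

/-- A past-directed causal curve from `p` to `q`, followed by a past-inextendible one. -/
theorem PastInextendibleFrom.concat {p q : M} {γ γ' : ℝ → M} {l : ℝ} (hl : 0 < l)
    (h : S.PastOn γ 0 l) (hp : γ 0 = p) (hq : γ l = q) (h' : S.PastInextendibleFrom q γ') :
    S.PastInextendibleFrom p (fun t ↦ if t ≤ l then γ t else γ' (t - l)) := by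
  obtain ⟨h0, ⟨τ, hτ0, hmono, hτ, hγ⟩, hend⟩ := h'
  have hafter : ∀ t, l ≤ t → (if t ≤ l then γ t else γ' (t - l)) = γ' (t + -l) := by
    intro t ht
    rcases ht.eq_or_lt with rfl | ht
    · simp [hq, h0]
    · simp [not_le.2 ht, sub_eq_add_neg]
  refine ⟨by simp [hl.le, hp], ⟨fun k ↦ Nat.casesOn k 0 fun k ↦ τ k + l, rfl, ?_, ?_, ?_⟩, ?_⟩
  · refine strictMono_nat_of_lt_succ fun k ↦ ?_
    cases k with
    | zero => simpa [hτ0] using hl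
    | succ k => simpa using hmono (Nat.lt_succ_self k)
  · rw [← Filter.tendsto_add_atTop_iff_nat 1]
    exact Filter.tendsto_atTop_add_const_right _ _ hτ
  · intro k
    cases k with
    | zero =>
      simp only [hτ0, zero_add]
      exact h.congr fun t ht ↦ if_pos ht.2
    | succ k =>
      have := (hγ k).comp_add (hmono (Nat.lt_succ_self k)) (-l)
      simp only [sub_neg_eq_add] at this
      refine this.congr fun t ht ↦ hafter t ?_
      have : 0 ≤ τ k := hτ0 ▸ hmono.monotone (Nat.zero_le k)
      linarith [ht.1]
  · intro x hx
    refine hend x ?_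
    refine (hx.comp (Filter.tendsto_atTop_add_const_right _ l Filter.tendsto_id)).congr' ?_
    filter_upwards [Filter.eventually_ge_atTop 0] with t ht
    simpa using hafter (t + l) (by linarith)

namespace Worldline

variable (γ : S.Worldline) {O : Set M}

theorem pastInextendibleFrom (t : ℝ) : S.PastInextendibleFrom (γ t) (fun u ↦ γ (t - u)) := by
  refine ⟨by simp, ⟨fun k ↦ k, by simp, Nat.strictMono_cast, tendsto_natCast_atTop_atTop,
    fun k ↦ ?_⟩, fun x hx ↦ γ.no_past_endpoint x ?_⟩
  · have h1 := (γ.futureOn (a := t - (k + 1 : ℕ)) (b := t - k)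
      (by push_cast; linarith)).comp_neg (by push_cast; linarith)
    have h2 := h1.comp_add (by push_cast; linarith) (-t)
    simp only [neg_sub, sub_neg_eq_add, sub_add_cancel, neg_add_rev, neg_neg] at h2
    exact h2
  · have h1 : Filter.Tendsto (fun u : ℝ ↦ t - u) Filter.atBot Filter.atTop :=
      Filter.tendsto_atTop_add_const_left _ t Filter.tendsto_neg_atBot_atTop
    refine (hx.comp h1).congr fun u ↦ ?_
    simp

theorem exists_le_mem_of_mem_DPlus {t : ℝ} (h : γ t ∈ S.DPlus O) : ∃ u ≤ t, γ u ∈ O := by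
  obtain ⟨u, hu, huO⟩ := h _ (γ.pastInextendibleFrom t)
  exact ⟨t - u, by linarith, huO⟩

/-- Following a worldline back from a point of `D⁺(O)`, one stays in `D⁺(O)` until one meets `O`. -/
theorem mem_DPlus_of_le {s t : ℝ} (hst : s ≤ t) (h : γ t ∈ S.DPlus O) :
    (∃ u ∈ Set.Icc s t, γ u ∈ O) ∨ γ s ∈ S.DPlus O := by
  rcases hst.eq_or_lt with rfl | hst
  · exact Or.inr h
  by_cases hO : ∃ u ∈ Set.Icc s t, γ u ∈ O
  · exact Or.inl hO
  refine Or.inr fun γ' hγ' ↦ ?_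
  have h1 := ((γ.futureOn hst).comp_neg hst).comp_add (by linarith) (-t)
  simp only [sub_neg_eq_add, neg_add_cancel, neg_add_rev, neg_neg] at h1
  have h2 := PastInextendibleFrom.concat (by linarith) h1 (p := γ t) (q := γ s) (by simp) (by simp)
    hγ'
  obtain ⟨u, hu0, hu⟩ := h _ h2
  by_cases hul : u ≤ -s + t
  · rw [if_pos hul] at hu
    exact absurd ⟨t + -u, ⟨by linarith, by linarith⟩, hu⟩ hO
  · rw [if_neg hul] at hu
    exact ⟨_, by linarith, hu⟩

theorem exists_ge_mem_of_mem_DMinus {t : ℝ} (h : γ t ∈ S.DMinus O) : ∃ u ≥ t, γ u ∈ O := by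
  obtain ⟨u, hu, huO⟩ := γ.reverse.exists_le_mem_of_mem_DPlus (t := -t) (O := O)
    (by rwa [DPlus_reverse, reverse_apply, neg_neg])
  exact ⟨-u, by linarith, huO⟩

theorem mem_DMinus_of_le {s t : ℝ} (hst : s ≤ t) (h : γ s ∈ S.DMinus O) :
    (∃ u ∈ Set.Icc s t, γ u ∈ O) ∨ γ t ∈ S.DMinus O := by
  have := γ.reverse.mem_DPlus_of_le (s := -t) (t := -s) (O := O) (by linarith)
    (by rwa [DPlus_reverse, reverse_apply, neg_neg])
  rw [DPlus_reverse, reverse_apply, neg_neg] at this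
  refine this.imp_left ?_
  rintro ⟨u, hu, huO⟩
  exact ⟨-u, ⟨by linarith [hu.2], by linarith [hu.1]⟩, huO⟩

end Worldline

end Spacetime

/-! ### Commutants of matrix algebras -/

section Commutant

variable {N : Type*} [Ring N] [StarRing N] [Algebra ℂ N] [StarModule ℂ N]

theorem le_centralizer_iff {X Y : StarSubalgebra ℂ N} :
    X ≤ StarSubalgebra.centralizer ℂ (Y : Set N) ↔ ∀ x ∈ X, ∀ y ∈ Y, Commute x y := by
  refine ⟨fun h x hx y hy ↦ ((StarSubalgebra.mem_centralizer_iff ℂ).1 (h hx) y hy).1.symm,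
    fun h x hx ↦ (StarSubalgebra.mem_centralizer_iff ℂ).2 fun y hy ↦
      ⟨(h x hx y hy).symm, (h x hx _ (star_mem hy)).symm⟩⟩

theorem iSup_le_centralizer {ι : Sort*} {X : ι → StarSubalgebra ℂ N} {Y : StarSubalgebra ℂ N}
    (h : ∀ i, ∀ x ∈ X i, ∀ y ∈ Y, Commute x y) :
    ∀ x ∈ ⨆ i, X i, ∀ y ∈ Y, Commute x y :=
  le_centralizer_iff.1 (iSup_le fun i ↦ le_centralizer_iff.2 (h i))

variable {κ : Type*} [Fintype κ] [DecidableEq κ] (ρ : Op κ →⋆ₐ[ℂ] N)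

/-- The coefficients of `x = ∑ ρ(e_ab) c_ab` with respect to a system of matrix units: `c_ab` is
`∑_i ρ(e_ia) x ρ(e_bi)`, which commutes with the matrix units. -/
def matrixCoeff (a b : κ) (x : N) : N :=
  ∑ i, ρ (Matrix.single i a 1) * x * ρ (Matrix.single b i 1)

omit [StarModule ℂ N] in
theorem sum_map_single_self : ∑ i, ρ (Matrix.single i i 1) = 1 := by
  rw [← map_sum, ← map_one ρ]
  congr 1
  ext j k
  simp [Matrix.sum_apply, Matrix.single_apply, Matrix.one_apply, ite_and]

omit [StarModule ℂ N] in
theorem map_single_mul (a b c d : κ) :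
    ρ (Matrix.single a b 1) * ρ (Matrix.single c d 1) =
      if b = c then ρ (Matrix.single a d 1) else 0 := by
  rw [← map_mul]
  split_ifs with h
  · subst h; simp
  · simp [Matrix.single_mul_single_of_ne _ _ _ _ h]

omit [StarModule ℂ N] in
theorem matrixCoeff_mul (a b : κ) (x y : N) :
    matrixCoeff ρ a b (x * y) = ∑ k, matrixCoeff ρ a k x * matrixCoeff ρ k b y := by
  simp only [matrixCoeff, Finset.sum_mul_sum]
  have h : ∀ k i j, ρ (Matrix.single i a 1) * x * ρ (Matrix.single k i 1) *
      (ρ (Matrix.single j k 1) * y * ρ (Matrix.single b j 1)) =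
      if i = j then ρ (Matrix.single i a 1) * x * ρ (Matrix.single k k 1) * y *
        ρ (Matrix.single b i 1) else 0 := by
    intro k i j
    calc _ = ρ (Matrix.single i a 1) * x * (ρ (Matrix.single k i 1) * ρ (Matrix.single j k 1)) * y *
        ρ (Matrix.single b j 1) := by noncomm_ring
      _ = _ := by
        rw [map_single_mul]
        split_ifs with h
        · subst h; rfl
        · simp
  simp only [h, Finset.sum_ite_eq, Finset.mem_univ, if_true]
  rw [Finset.sum_comm]
  refine Finset.sum_congr rfl fun i _ ↦ ?_
  rw [← Finset.sum_mul, ← Finset.sum_mul, ← Finset.mul_sum, sum_map_single_self]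
  noncomm_ring

omit [StarModule ℂ N] in
theorem matrixCoeff_star (a b : κ) (x : N) :
    matrixCoeff ρ a b (star x) = star (matrixCoeff ρ b a x) := by
  simp only [matrixCoeff, star_sum, star_mul, ← map_star, Matrix.star_eq_conjTranspose,
    Matrix.conjTranspose_single, star_one, mul_assoc]

omit [StarModule ℂ N] in
theorem matrixCoeff_map (a b : κ) (z : Op κ) :
    matrixCoeff ρ a b (ρ z) = algebraMap ℂ N (z a b) := by
  have : ∀ i, Matrix.single i a (1 : ℂ) * z * Matrix.single b i 1 =
      z a b • Matrix.single i i 1 := by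
    intro i
    rw [Matrix.single_mul_mul_single]
    simp
  simp only [matrixCoeff, ← map_mul, this, map_smul]
  rw [← Finset.smul_sum, sum_map_single_self, Algebra.algebraMap_eq_smul_one]

omit [StarModule ℂ N] in
theorem matrixCoeff_of_commute (a b : κ) {x : N} (hx : ∀ z, Commute (ρ z) x) :
    matrixCoeff ρ a b x = if a = b then x else 0 := by
  simp only [matrixCoeff, mul_assoc, ← (hx _).eq]
  simp only [← mul_assoc, map_single_mul]
  split_ifs
  · rw [← Finset.sum_mul, sum_map_single_self, one_mul]
  · simp

/-- The relative commutant of a matrix algebra `ρ(M_κ)` in the *-algebra that it generates together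
with a commuting *-algebra `Y` is `Y`. -/
theorem mem_of_mem_range_sup {Y : StarSubalgebra ℂ N} (hY : ∀ z, ∀ y ∈ Y, Commute (ρ z) y) {x : N}
    (hx : x ∈ ρ.range ⊔ Y) (hc : ∀ z, Commute (ρ z) x) : x ∈ Y := by
  -- all elements of `ρ.range ⊔ Y` have their coefficients in `Y`
  let T : StarSubalgebra ℂ N :=
    { carrier := {x | ∀ a b, matrixCoeff ρ a b x ∈ Y}
      mul_mem' := fun {x y} hx hy a b ↦ by
        rw [matrixCoeff_mul]
        exact sum_mem fun k _ ↦ mul_mem (hx a k) (hy k b)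
      add_mem' := fun {x y} hx hy a b ↦ by
        have : matrixCoeff ρ a b (x + y) = matrixCoeff ρ a b x + matrixCoeff ρ a b y := by
          simp only [matrixCoeff, mul_add, add_mul, Finset.sum_add_distrib]
        rw [this]
        exact add_mem (hx a b) (hy a b)
      algebraMap_mem' := fun r a b ↦ by
        rw [← AlgHomClass.commutes ρ r, matrixCoeff_map]
        exact algebraMap_mem Y _
      star_mem' := fun {x} hx a b ↦ by
        rw [matrixCoeff_star]
        exact star_mem (hx b a) }
  have hT : ρ.range ⊔ Y ≤ T := by
    refine sup_le ?_ fun y hy a b ↦ ?_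
    · rintro _ ⟨z, rfl⟩ a b
      exact matrixCoeff_map ρ a b z ▸ algebraMap_mem Y _
    · rw [matrixCoeff_of_commute ρ a b fun z ↦ hY z y hy]
      split_ifs
      exacts [hy, zero_mem Y]
  rcases isEmpty_or_nonempty κ with hκ | ⟨⟨a⟩⟩
  · have h1 : (1 : N) = 0 := by rw [← map_one ρ, Subsingleton.elim (1 : Op κ) 0, map_zero]
    rw [← mul_one x, h1, mul_zero]
    exact zero_mem Y
  · simpa [matrixCoeff_of_commute ρ a a hc] using hT hx a a

/-- `R` is the image of a full matrix algebra. -/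
def IsMatrixAlgebra (R : StarSubalgebra ℂ N) : Prop :=
  ∃ (κ : Type) (_ : Fintype κ) (_ : DecidableEq κ) (ρ : Op κ →⋆ₐ[ℂ] N), ρ.range = R

theorem IsMatrixAlgebra.mem_of_mem_sup {R Y : StarSubalgebra ℂ N} (hR : IsMatrixAlgebra R)
    (hY : ∀ z ∈ R, ∀ y ∈ Y, Commute z y) {x : N} (hx : x ∈ R ⊔ Y) (hc : ∀ z ∈ R, Commute z x) :
    x ∈ Y := by
  obtain ⟨κ, _, _, ρ, rfl⟩ := hR
  exact mem_of_mem_range_sup ρ (fun z ↦ hY _ ⟨z, rfl⟩) hx fun z ↦ hc _ ⟨z, rfl⟩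

/-- The *-algebra `N` is the tensor product of the matrix algebras `R j`. -/
structure IsFactorization {J : Type*} (R : J → StarSubalgebra ℂ N) : Prop where
  matrix : ∀ j, IsMatrixAlgebra (R j)
  commute : ∀ i j, i ≠ j → ∀ x ∈ R i, ∀ y ∈ R j, Commute x y
  iSup_eq : ⨆ j, R j = ⊤

namespace IsFactorization

variable {J : Type*} {R : J → StarSubalgebra ℂ N} (hR : IsFactorization R)

include hR

/-- The commutant of some of the tensor factors is the tensor product of the others. -/
theorem mem_iSup_of_commute [Finite J] (P : Set J) {x : N}
    (hx : ∀ j ∈ P, ∀ z ∈ R j, Commute z x) : x ∈ ⨆ j, ⨆ (_ : j ∉ P), R j := by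
  classical
  suffices h : ∀ (F : Set J), F.Finite → (∀ j ∈ F, ∀ z ∈ R j, Commute z x) →
      x ∈ ⨆ j, ⨆ (_ : j ∉ F), R j from h P (Set.toFinite P) hx
  intro F hF
  induction F, hF using Set.Finite.induction_on with
  | empty =>
    intro _
    simp only [Set.mem_empty_iff_false, not_false_eq_true, iSup_pos, hR.iSup_eq]
    trivial
  | @insert i F hi _ ih =>
    intro hcomm
    have h1 := ih fun j hj ↦ hcomm j (Set.mem_insert_of_mem i hj)
    refine (hR.matrix i).mem_of_mem_sup (fun z hz y hy ↦ ?_) ?_ (hcomm i (Set.mem_insert i F))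
    · refine (iSup_le_centralizer (Y := R i) (fun j ↦ iSup_le_centralizer fun hj ↦ ?_)
        y hy z hz).symm
      exact hR.commute j i fun h ↦ hj (h ▸ Set.mem_insert i F)
    · refine (iSup_le fun j ↦ iSup_le fun hj ↦ ?_ : (⨆ j, ⨆ (_ : j ∉ F), R j) ≤ _) h1
      by_cases hji : j = i
      · exact hji ▸ le_sup_left
      · exact le_sup_of_le_right (le_iSup₂_of_le j (by simp [hji, hj]) le_rfl)

theorem mem_of_commute [Finite J] (i : J) {x : N}
    (hx : ∀ j, j ≠ i → ∀ z ∈ R j, Commute z x) : x ∈ R i := by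
  have := hR.mem_iSup_of_commute {j | j ≠ i} hx
  simpa using this

/-- If `D` commutes with the factor `R i` and generates everything together with it, then `D` is the
product of the other factors; so its commutant is `R i`. -/
theorem mem_of_commute_of_sup_eq_top [Finite J] (i : J) {D : StarSubalgebra ℂ N}
    (hD : ∀ z ∈ R i, ∀ d ∈ D, Commute z d) (htop : R i ⊔ D = ⊤) {x : N}
    (hx : ∀ d ∈ D, Commute d x) : x ∈ R i := by
  refine hR.mem_of_commute i fun j hj y hy ↦ hx y ?_
  refine (hR.matrix i).mem_of_mem_sup hD (htop ▸ trivial) fun z hz ↦ ?_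
  exact hR.commute i j hj.symm z hz y hy

end IsFactorization

end Commutant

/-! ### Tensor products of matrix algebras -/

section TensorFactors

variable {α β : Type*} [Fintype α] [DecidableEq α] [Fintype β] [DecidableEq β]

/-- The embedding `a ↦ a ⊗ 1`. -/
def inLeft (α β : Type*) [Fintype α] [DecidableEq α] [Fintype β] [DecidableEq β] :
    Op α →⋆ₐ[ℂ] Op (α × β) where
  toFun a := a ⊗ₖ 1
  map_one' := Matrix.one_kronecker_one
  map_mul' a b := by rw [← Matrix.mul_kronecker_mul, one_mul]
  map_zero' := Matrix.zero_kronecker _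
  map_add' a b := Matrix.add_kronecker a b _
  commutes' r := by
    rw [Algebra.algebraMap_eq_smul_one, Matrix.smul_kronecker, Matrix.one_kronecker_one,
      Algebra.algebraMap_eq_smul_one]
  map_star' a := by
    simp [Matrix.star_eq_conjTranspose, Matrix.conjTranspose_kronecker]

/-- The embedding `b ↦ 1 ⊗ b`. -/
def inRight (α β : Type*) [Fintype α] [DecidableEq α] [Fintype β] [DecidableEq β] :
    Op β →⋆ₐ[ℂ] Op (α × β) where
  toFun b := (1 : Op α) ⊗ₖ b
  map_one' := Matrix.one_kronecker_one
  map_mul' a b := by rw [← Matrix.mul_kronecker_mul, one_mul]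
  map_zero' := Matrix.kronecker_zero _
  map_add' a b := Matrix.kronecker_add _ a b
  commutes' r := by
    rw [Algebra.algebraMap_eq_smul_one, Matrix.kronecker_smul, Matrix.one_kronecker_one,
      Algebra.algebraMap_eq_smul_one]
  map_star' a := by
    simp [Matrix.star_eq_conjTranspose, Matrix.conjTranspose_kronecker]

theorem inLeft_apply (a : Op α) : inLeft α β a = a ⊗ₖ 1 := rfl

theorem inRight_apply (b : Op β) : inRight α β b = (1 : Op α) ⊗ₖ b := rfl

theorem inLeft_mul_inRight (a : Op α) (b : Op β) : inLeft α β a * inRight α β b = a ⊗ₖ b := by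
  rw [inLeft_apply, inRight_apply, ← Matrix.mul_kronecker_mul, one_mul, mul_one]

theorem inRight_mul_inLeft (a : Op α) (b : Op β) : inRight α β b * inLeft α β a = a ⊗ₖ b := by
  rw [inLeft_apply, inRight_apply, ← Matrix.mul_kronecker_mul, one_mul, mul_one]

theorem commute_inLeft_inRight (a : Op α) (b : Op β) :
    Commute (inLeft α β a) (inRight α β b) := by
  rw [Commute, SemiconjBy, inLeft_mul_inRight, inRight_mul_inLeft]

theorem kronecker_induction {P : Op (α × β) → Prop} (h : ∀ a b, P (a ⊗ₖ b))
    (hadd : ∀ x y, P x → P y → P (x + y)) (x : Op (α × β)) : P x := by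
  obtain ⟨t, rfl⟩ := (kroneckerLinearEquiv α α β β ℂ).surjective x
  induction t with
  | zero => simpa using h 0 0
  | tmul a b => simpa using h a b
  | add s t hs ht => rw [map_add]; exact hadd _ _ hs ht

theorem inLeft_range_sup_inRight_range : (inLeft α β).range ⊔ (inRight α β).range = ⊤ := by
  refine eq_top_iff.2 fun x _ ↦ ?_
  induction x using kronecker_induction with
  | h a b =>
    rw [← inLeft_mul_inRight]
    exact mul_mem (le_sup_left (a := (inLeft α β).range) ⟨a, rfl⟩)
      (le_sup_right (a := (inLeft α β).range) ⟨b, rfl⟩)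
  | hadd x y hx hy => exact add_mem (hx trivial) (hy trivial)

theorem inLeft_injective [Nonempty β] : Function.Injective (inLeft α β) := by
  intro a b h
  obtain ⟨k⟩ := ‹Nonempty β›
  ext i j
  simpa [inLeft_apply] using congrFun (congrFun h (i, k)) (j, k)

theorem inRight_injective [Nonempty α] : Function.Injective (inRight α β) := by
  intro a b h
  obtain ⟨k⟩ := ‹Nonempty α›
  ext i j
  simpa [inRight_apply] using congrFun (congrFun h (k, i)) (k, j)

theorem tensorMap_symm_tensorMap (φ : Aut α) (ψ : Aut β) (x : Op (α × β)) :
    tensorMap (Aut.lin φ.symm) (Aut.lin ψ.symm) (tensorMap φ.lin ψ.lin x) = x := by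
  induction x using kronecker_induction with
  | h a b => simp [tensorMap_kronecker, Aut.lin]
  | hadd x y hx hy => rw [map_add, map_add, hx, hy]

theorem tensorMap_mul (φ : Aut α) (ψ : Aut β) (x y : Op (α × β)) :
    tensorMap φ.lin ψ.lin (x * y) = tensorMap φ.lin ψ.lin x * tensorMap φ.lin ψ.lin y := by
  induction x using kronecker_induction with
  | h a b =>
    induction y using kronecker_induction with
    | h c d => simp [tensorMap_kronecker, ← Matrix.mul_kronecker_mul, Aut.lin]
    | hadd x y hx hy => rw [mul_add, map_add, hx, hy, map_add, mul_add]
  | hadd x y hx hy => rw [add_mul, map_add, hx, hy, map_add, add_mul]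

theorem tensorMap_star (φ : Aut α) (ψ : Aut β) (x : Op (α × β)) :
    tensorMap φ.lin ψ.lin (star x) = star (tensorMap φ.lin ψ.lin x) := by
  induction x using kronecker_induction with
  | h a b =>
    simp only [Matrix.star_eq_conjTranspose, Matrix.conjTranspose_kronecker, tensorMap_kronecker]
    simp [Aut.lin, ← Matrix.star_eq_conjTranspose, map_star]
  | hadd x y hx hy => rw [star_add, map_add, hx, hy, map_add, star_add]

/-- The tensor product of two *-automorphisms. -/
def tensorAut (φ : Aut α) (ψ : Aut β) : Aut (α × β) where
  toFun := tensorMap φ.lin ψ.lin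
  invFun := tensorMap (Aut.lin φ.symm) (Aut.lin ψ.symm)
  left_inv := tensorMap_symm_tensorMap φ ψ
  right_inv := tensorMap_symm_tensorMap φ.symm ψ.symm
  map_mul' := tensorMap_mul φ ψ
  map_add' := map_add _
  map_star' := tensorMap_star φ ψ
  map_smul' := map_smul _

theorem tensorAut_apply (φ : Aut α) (ψ : Aut β) (x : Op (α × β)) :
    tensorAut φ ψ x = tensorMap φ.lin ψ.lin x := rfl

theorem tensorAut_inLeft (φ : Aut α) (ψ : Aut β) (a : Op α) :
    tensorAut φ ψ (inLeft α β a) = inLeft α β (φ a) := by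
  rw [tensorAut_apply, inLeft_apply, tensorMap_kronecker]
  simp [Aut.lin, inLeft_apply]

theorem tensorAut_inRight (φ : Aut α) (ψ : Aut β) (b : Op β) :
    tensorAut φ ψ (inRight α β b) = inRight α β (ψ b) := by
  rw [tensorAut_apply, inRight_apply, tensorMap_kronecker]
  simp [Aut.lin, inRight_apply]

theorem hom_ext_of_inLeft_inRight {N F G : Type*} [Ring N] [FunLike F (Op (α × β)) N]
    [FunLike G (Op (α × β)) N] [RingHomClass F (Op (α × β)) N] [RingHomClass G (Op (α × β)) N]
    {f : F} {g : G} (h : ∀ a, f (inLeft α β a) = g (inLeft α β a))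
    (h' : ∀ b, f (inRight α β b) = g (inRight α β b)) (x : Op (α × β)) : f x = g x := by
  induction x using kronecker_induction with
  | h a b => rw [← inLeft_mul_inRight, map_mul, map_mul, h, h']
  | hadd x y hx hy => rw [map_add, map_add, hx, hy]

theorem mem_inLeft_range_of_commute {x : Op (α × β)} (h : ∀ b, Commute (inRight α β b) x) :
    x ∈ (inLeft α β).range := by
  refine mem_of_mem_range_sup (inRight α β) ?_ ?_ h
  · rintro b _ ⟨a, rfl⟩
    exact (commute_inLeft_inRight a b).symm
  · rw [sup_comm, inLeft_range_sup_inRight_range]; trivial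

theorem mem_inRight_range_of_commute {x : Op (α × β)} (h : ∀ a, Commute (inLeft α β a) x) :
    x ∈ (inRight α β).range := by
  refine mem_of_mem_range_sup (inLeft α β) ?_ ?_ h
  · rintro a _ ⟨b, rfl⟩
    exact commute_inLeft_inRight a b
  · rw [inLeft_range_sup_inRight_range]; trivial

/-- An automorphism that maps an embedded matrix algebra into itself restricts to an automorphism
of it. -/
theorem exists_aut_of_map_range {N : Type*} [Ring N] [StarRing N] [Algebra ℂ N] [StarModule ℂ N]
    (ρ : Op α →⋆ₐ[ℂ] N) (hρ : Function.Injective ρ) (Θ : N ≃⋆ₐ[ℂ] N)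
    (h : ∀ a, Θ (ρ a) ∈ ρ.range) : ∃ φ : Aut α, ∀ a, Θ (ρ a) = ρ (φ a) := by
  choose f hf' using h
  have hf : ∀ a, ρ (f a) = Θ (ρ a) := hf'
  let F : Op α →⋆ₐ[ℂ] Op α :=
    { toFun := f
      map_one' := hρ (by simp [hf])
      map_mul' := fun a b ↦ hρ (by simp [hf])
      map_zero' := hρ (by simp [hf])
      map_add' := fun a b ↦ hρ (by simp [hf])
      commutes' := fun r ↦ hρ (by
        rw [hf, AlgHomClass.commutes ρ, Algebra.algebraMap_eq_smul_one, map_smul, map_one])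
      map_star' := fun a ↦ hρ (by rw [hf, map_star, map_star, map_star, hf]) }
  have hFi : Function.Injective F := fun a b hab ↦ hρ (Θ.injective (by
    change Θ (ρ a) = Θ (ρ b)
    rw [← hf, ← hf]; exact congrArg ρ hab))
  have hFs : Function.Surjective F :=
    LinearMap.surjective_of_injective (f := (F.toAlgHom.toLinearMap)) hFi
  exact ⟨StarAlgEquiv.ofBijective F ⟨hFi, hFs⟩, fun a ↦ (hf a).symm⟩

theorem decomposes_of_isEmpty (ψ : Aut (α × β)) (h : IsEmpty (α × β)) : Decomposes ψ :=
  ⟨StarAlgEquiv.refl ℂ _, StarAlgEquiv.refl ℂ _, fun _ ↦ Subsingleton.elim _ _⟩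

theorem decomposes_of_inLeft (ψ : Aut (α × β))
    (h : ∀ a, ψ (inLeft α β a) ∈ (inLeft α β).range) : Decomposes ψ := by
  rcases isEmpty_or_nonempty (α × β) with he | he
  · exact decomposes_of_isEmpty ψ he
  obtain ⟨_, _⟩ := nonempty_prod.1 he
  obtain ⟨φ₁, h₁⟩ := exists_aut_of_map_range _ inLeft_injective ψ h
  obtain ⟨φ₂, h₂⟩ := exists_aut_of_map_range (inRight α β) inRight_injective ψ fun b ↦ by
    refine mem_inRight_range_of_commute fun a ↦ ?_
    have := (commute_inLeft_inRight (φ₁.symm a) b).map ψ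
    rwa [h₁, StarAlgEquiv.apply_symm_apply] at this
  refine ⟨φ₁, φ₂, hom_ext_of_inLeft_inRight (f := ψ) (g := tensorAut φ₁ φ₂) ?_ ?_⟩
  · intro a; rw [h₁, tensorAut_inLeft]
  · intro b; rw [h₂, tensorAut_inRight]

theorem decomposes_of_inRight (ψ : Aut (α × β))
    (h : ∀ b, ψ (inRight α β b) ∈ (inRight α β).range) : Decomposes ψ := by
  rcases isEmpty_or_nonempty (α × β) with he | he
  · exact decomposes_of_isEmpty ψ he
  obtain ⟨_, _⟩ := nonempty_prod.1 he
  obtain ⟨φ₂, h₂⟩ := exists_aut_of_map_range (inRight α β) inRight_injective ψ h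
  refine decomposes_of_inLeft ψ fun a ↦ mem_inLeft_range_of_commute fun b ↦ ?_
  have := (commute_inLeft_inRight a (φ₂.symm b)).symm.map ψ
  rwa [h₂, StarAlgEquiv.apply_symm_apply] at this

end TensorFactors

/-! ### Representations of matrix algebras are unitarily equivalent -/

section SkolemNoether

/-- An orthonormal basis of the range of an idempotent matrix, as the columns of a matrix. -/
theorem exists_isometry_of_idempotent {ι κ : Type*} [Fintype ι] [DecidableEq ι] [Fintype κ]
    [DecidableEq κ] (P : Matrix ι ι ℂ) (hP : P * P = P) (htr : P.trace = Fintype.card κ) :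
    ∃ F : Matrix ι κ ℂ, F.conjTranspose * F = 1 ∧ P * F = F := by
  let f : EuclideanSpace ℂ ι →ₗ[ℂ] EuclideanSpace ℂ ι := Matrix.toEuclideanLin P
  have hff : ∀ v, f (f v) = f v := fun v ↦ by
    simp only [f, Matrix.toLpLin_apply, Matrix.mulVec_mulVec, hP]
  have hproj : LinearMap.IsProj (LinearMap.range f) f :=
    ⟨fun v ↦ ⟨v, rfl⟩, by rintro _ ⟨v, rfl⟩; exact hff v⟩
  have hrank : Module.finrank ℂ (LinearMap.range f) = Fintype.card κ := by
    have h1 := hproj.trace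
    have h2 : LinearMap.trace ℂ _ f = P.trace := by
      simp only [f, Matrix.toLpLin_eq_toLin, Matrix.trace_toLin_eq]
    rw [h2, htr] at h1
    exact_mod_cast h1.symm
  let b := (stdOrthonormalBasis ℂ (LinearMap.range f)).reindex
    (Fintype.equivOfCardEq (by rw [Fintype.card_fin, hrank]) : _ ≃ κ)
  refine ⟨Matrix.of fun i k ↦ (b k : EuclideanSpace ℂ ι) i, ?_, ?_⟩
  · ext k l
    have h := orthonormal_iff_ite.1 b.orthonormal k l
    rw [Submodule.coe_inner, PiLp.inner_apply] at h
    rw [Matrix.one_apply, ← h, Matrix.mul_apply]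
    refine Finset.sum_congr rfl fun i _ ↦ ?_
    simp [mul_comm]
  · ext i k
    have h := hproj.map_id _ (b k).2
    have h2 := congrArg (fun v : EuclideanSpace ℂ ι ↦ v i) h
    simpa [f, Matrix.toLpLin_apply, Matrix.mul_apply, Matrix.mulVec, dotProduct] using h2

variable {β γ : Type*} [Fintype β] [DecidableEq β] [Fintype γ] [DecidableEq γ]

/-- The images of the diagonal matrix units under a unital representation of a matrix algebra on a
multiple of its defining space have equal traces. -/
theorem trace_map_single [Nonempty γ] (ρ : Op γ →⋆ₐ[ℂ] Op (β × γ)) (i : γ) :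
    (ρ (Matrix.single i i 1)).trace = Fintype.card β := by
  have h1 : ∀ j, (ρ (Matrix.single j j 1)).trace = (ρ (Matrix.single i i 1)).trace := by
    intro j
    have e1 := map_single_mul ρ j i i j
    have e2 := map_single_mul ρ i j j i
    rw [if_pos rfl] at e1 e2
    rw [← e1, ← e2, Matrix.trace_mul_comm]
  have h2 := congrArg Matrix.trace (sum_map_single_self ρ)
  rw [Matrix.trace_sum, Finset.sum_congr rfl fun j _ ↦ h1 j, Finset.sum_const, Matrix.trace_one,
    Fintype.card_prod, Finset.card_univ, nsmul_eq_mul, Nat.cast_mul, mul_comm] at h2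
  exact mul_right_cancel₀ (Nat.cast_ne_zero.2 Fintype.card_ne_zero) h2

/-- A representation of `B(H_γ)` on `H_β ⊗ H_γ` is unitarily equivalent to `c ↦ 1 ⊗ c`. -/
theorem exists_aut_inRight (ρ : Op γ →⋆ₐ[ℂ] Op (β × γ)) :
    ∃ ψ : Aut (β × γ), ∀ c, ψ (inRight β γ c) = ρ c := by
  rcases isEmpty_or_nonempty γ with hγ | ⟨⟨o⟩⟩
  · exact ⟨StarAlgEquiv.refl ℂ _, fun c ↦ Subsingleton.elim _ _⟩
  have : Nonempty γ := ⟨o⟩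
  obtain ⟨F, hF1, hF2⟩ := exists_isometry_of_idempotent (κ := β) (ρ (Matrix.single o o 1))
    (by rw [map_single_mul, if_pos rfl]) (trace_map_single ρ o)
  -- the columns of the unitary `W` are the vectors `ρ(e_io) f_k`
  let W : Op (β × γ) := Matrix.of fun x ki ↦ (ρ (Matrix.single ki.2 o 1) * F) x ki.1
  have hstar : ∀ i j, (ρ (Matrix.single i j 1)).conjTranspose = ρ (Matrix.single j i 1) := by
    intro i j
    rw [← Matrix.star_eq_conjTranspose, ← map_star, Matrix.star_eq_conjTranspose,
      Matrix.conjTranspose_single, star_one]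
  have hW : W.conjTranspose * W = 1 := by
    ext ⟨k, i⟩ ⟨l, j⟩
    have h1 : (W.conjTranspose * W) (k, i) (l, j) =
        ((ρ (Matrix.single i o 1) * F).conjTranspose * (ρ (Matrix.single j o 1) * F)) k l := by
      simp only [Matrix.mul_apply, Matrix.conjTranspose_apply, W, Matrix.of_apply]
    rw [h1, Matrix.conjTranspose_mul, hstar, Matrix.mul_assoc, ← Matrix.mul_assoc (ρ _) (ρ _),
      map_single_mul]
    split_ifs with hij
    · subst hij
      rw [hF2, hF1]
      simp [Matrix.one_apply]
    · simp [hij]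
  have hW' : W * W.conjTranspose = 1 := mul_eq_one_comm.1 hW
  let U : unitary (Op (β × γ)) := ⟨W, Unitary.mem_iff.2 ⟨hW, hW'⟩⟩
  refine ⟨Unitary.conjStarAlgAut ℂ _ U, fun c ↦ ?_⟩
  have key : W * inRight β γ c = ρ c * W := by
    have hsingle : ∀ i j, W * inRight β γ (Matrix.single i j 1) = ρ (Matrix.single i j 1) * W := by
      intro i j
      ext x ⟨k, l⟩
      have h1 : (ρ (Matrix.single i j 1) * W) x (k, l) =
          (ρ (Matrix.single i j 1) * ρ (Matrix.single l o 1) * F) x k := by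
        rw [Matrix.mul_assoc]
        simp only [Matrix.mul_apply, W, Matrix.of_apply]
      rw [h1, map_single_mul, Matrix.mul_apply, Fintype.sum_prod_type]
      simp only [inRight_apply, Matrix.kroneckerMap_apply, Matrix.one_apply, Matrix.single_apply,
        mul_ite, mul_one, mul_zero, W, Matrix.of_apply]
      split_ifs with hjl
      · subst hjl
        rw [Finset.sum_eq_single k, Finset.sum_eq_single i]
        · simp
        · intro b _ hb; simp [hb.symm]
        · simp
        · intro b _ hb; simp [hb]
        · simp
      · simp [hjl]
    rw [Matrix.matrix_eq_sum_single c]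
    simp only [map_sum, Finset.mul_sum, Finset.sum_mul]
    refine Finset.sum_congr rfl fun i _ ↦ Finset.sum_congr rfl fun j _ ↦ ?_
    have h : Matrix.single i j (c i j) = c i j • Matrix.single i j (1 : ℂ) := by
      rw [Matrix.smul_single, smul_eq_mul, mul_one]
    rw [h, map_smul, map_smul, mul_smul_comm, smul_mul_assoc, hsingle]
  calc W * inRight β γ c * star W = ρ c * W * W.conjTranspose := by rw [key]; rfl
    _ = ρ c := by rw [Matrix.mul_assoc, hW', Matrix.mul_one]

end SkolemNoether

/-! ### The tensor factors of the three-party system -/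

section ThreeParties

variable {E M : Type*} [NormedAddCommGroup E] [NormedSpace ℝ E]
  [TopologicalSpace M] [ChartedSpace E M] [IsManifold 𝓘(ℝ, E) ∞ M] {S : Spacetime E M}

/-- The isomorphism of operator algebras that is induced by a relabelling of the basis. -/
def reindexOp {α β : Type*} [Fintype α] [DecidableEq α] [Fintype β] [DecidableEq β] (e : α ≃ β) :
    Op α ≃⋆ₐ[ℂ] Op β where
  toFun := Matrix.reindex e e
  invFun := (Matrix.reindex e e).symm
  left_inv := (Matrix.reindex e e).left_inv
  right_inv := (Matrix.reindex e e).right_inv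
  map_mul' x y := by simp [Matrix.submatrix_mul_equiv]
  map_add' _ _ := rfl
  map_star' _ := rfl
  map_smul' _ _ := rfl

variable {n : ℕ} (𝔄 : HybridTheory S 2) (𝔅 : HybridTheory S n)

/-- `B(H_A ⊗ H_C ⊗ H_B)` as `B(H_A ⊗ H_BC)`. -/
def equivA_BC : Op (𝔄.Idx × 𝔅.Idx) ≃⋆ₐ[ℂ] Op (Fin (𝔄.dim 0) × IdxBC 𝔄 𝔅) :=
  reindexOp (splitA_BC 𝔄 𝔅)

/-- `B(H_A ⊗ H_C ⊗ H_B)` as `B(H_AB ⊗ H_C)`. -/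
def equivAB_C : Op (𝔄.Idx × 𝔅.Idx) ≃⋆ₐ[ℂ] Op (IdxAB 𝔄 𝔅 × Fin (𝔄.dim 1)) :=
  reindexOp (splitAB_C 𝔄 𝔅)

/-- The embedding of Alice's operators. -/
def opA : Op (Fin (𝔄.dim 0)) →⋆ₐ[ℂ] Op (𝔄.Idx × 𝔅.Idx) :=
  (equivA_BC 𝔄 𝔅).symm.toStarAlgHom.comp (inLeft _ _)

/-- The embedding of the operators of Bob and Charlie. -/
def opBC : Op (IdxBC 𝔄 𝔅) →⋆ₐ[ℂ] Op (𝔄.Idx × 𝔅.Idx) :=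
  (equivA_BC 𝔄 𝔅).symm.toStarAlgHom.comp (inRight _ _)

/-- The embedding of the operators of Alice and Bob. -/
def opAB : Op (IdxAB 𝔄 𝔅) →⋆ₐ[ℂ] Op (𝔄.Idx × 𝔅.Idx) :=
  (equivAB_C 𝔄 𝔅).symm.toStarAlgHom.comp (inLeft _ _)

/-- The embedding of Charlie's operators. -/
def opC : Op (Fin (𝔄.dim 1)) →⋆ₐ[ℂ] Op (𝔄.Idx × 𝔅.Idx) :=
  (equivAB_C 𝔄 𝔅).symm.toStarAlgHom.comp (inRight _ _)

/-- The embedding of Bob's operators. -/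
def opB : Op 𝔅.Idx →⋆ₐ[ℂ] Op (𝔄.Idx × 𝔅.Idx) := inRight _ _

theorem opA_eq (a : Op (Fin (𝔄.dim 0))) : opA 𝔄 𝔅 a = opAB 𝔄 𝔅 (inLeft _ _ a) := by
  ext x y
  change (a (x.1 0) (y.1 0) * (1 : Op (IdxBC 𝔄 𝔅)) (x.2, x.1 1) (y.2, y.1 1)) =
    a (x.1 0) (y.1 0) * (1 : Op 𝔅.Idx) x.2 y.2 * (1 : Op (Fin (𝔄.dim 1))) (x.1 1) (y.1 1)
  simp only [Matrix.one_apply, Prod.mk.injEq, ite_and]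
  split_ifs <;> simp

theorem opC_eq (c : Op (Fin (𝔄.dim 1))) : opC 𝔄 𝔅 c = opBC 𝔄 𝔅 (inRight _ _ c) := by
  ext x y
  change (1 : Op (IdxAB 𝔄 𝔅)) (x.1 0, x.2) (y.1 0, y.2) * c (x.1 1) (y.1 1) =
    (1 : Op (Fin (𝔄.dim 0))) (x.1 0) (y.1 0) * ((1 : Op 𝔅.Idx) x.2 y.2 * c (x.1 1) (y.1 1))
  simp only [Matrix.one_apply, Prod.mk.injEq, ite_and]
  split_ifs <;> simp

theorem idx_eq_iff (x y : 𝔄.Idx) : x = y ↔ x 0 = y 0 ∧ x 1 = y 1 :=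
  ⟨fun h ↦ by simp [h], fun h ↦ funext fun i ↦ by fin_cases i; exacts [h.1, h.2]⟩

theorem opB_eq_opAB (b : Op 𝔅.Idx) : opB 𝔄 𝔅 b = opAB 𝔄 𝔅 (inRight _ _ b) := by
  ext x y
  change (1 : Op 𝔄.Idx) x.1 y.1 * b x.2 y.2 =
    (1 : Op (Fin (𝔄.dim 0))) (x.1 0) (y.1 0) * b x.2 y.2 *
      (1 : Op (Fin (𝔄.dim 1))) (x.1 1) (y.1 1)
  simp only [Matrix.one_apply, idx_eq_iff, ite_and]
  split_ifs <;> simp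

theorem opB_eq_opBC (b : Op 𝔅.Idx) : opB 𝔄 𝔅 b = opBC 𝔄 𝔅 (inLeft _ _ b) := by
  ext x y
  change (1 : Op 𝔄.Idx) x.1 y.1 * b x.2 y.2 =
    (1 : Op (Fin (𝔄.dim 0))) (x.1 0) (y.1 0) * (b x.2 y.2 *
      (1 : Op (Fin (𝔄.dim 1))) (x.1 1) (y.1 1))
  simp only [Matrix.one_apply, idx_eq_iff, ite_and]
  split_ifs <;> simp

theorem slot_zero_kronecker_one (a : Op (Fin (𝔄.dim 0))) :
    𝔄.slot 0 a ⊗ₖ (1 : Op 𝔅.Idx) = opA 𝔄 𝔅 a := by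
  ext x y
  change (if ∀ j : Fin 2, j ≠ 0 → x.1 j = y.1 j then a (x.1 0) (y.1 0) else 0) *
      (1 : Op 𝔅.Idx) x.2 y.2 =
    a (x.1 0) (y.1 0) * (1 : Op (IdxBC 𝔄 𝔅)) (x.2, x.1 1) (y.2, y.1 1)
  simp only [Matrix.one_apply, Prod.mk.injEq, Fin.forall_fin_two, ite_and]
  simp

theorem slot_one_kronecker_one (c : Op (Fin (𝔄.dim 1))) :
    𝔄.slot 1 c ⊗ₖ (1 : Op 𝔅.Idx) = opC 𝔄 𝔅 c := by
  ext x y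
  change (if ∀ j : Fin 2, j ≠ 1 → x.1 j = y.1 j then c (x.1 1) (y.1 1) else 0) *
      (1 : Op 𝔅.Idx) x.2 y.2 =
    (1 : Op (IdxAB 𝔄 𝔅)) (x.1 0, x.2) (y.1 0, y.2) * c (x.1 1) (y.1 1)
  simp only [Matrix.one_apply, Prod.mk.injEq, Fin.forall_fin_two, ite_and]
  simp only [ne_eq, zero_ne_one, not_false_eq_true, forall_const, not_true_eq_false,
    IsEmpty.forall_iff]
  split_ifs <;> simp

theorem opBC_range_eq : (opBC 𝔄 𝔅).range = (opB 𝔄 𝔅).range ⊔ (opC 𝔄 𝔅).range := by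
  have hB : opB 𝔄 𝔅 = (opBC 𝔄 𝔅).comp (inLeft _ _) := StarAlgHom.ext (opB_eq_opBC 𝔄 𝔅)
  have hC : opC 𝔄 𝔅 = (opBC 𝔄 𝔅).comp (inRight _ _) := StarAlgHom.ext (opC_eq 𝔄 𝔅)
  rw [hB, hC]
  simp only [StarAlgHom.range_eq_map_top, ← StarSubalgebra.map_map]
  rw [← StarSubalgebra.map_sup]
  simp only [← StarAlgHom.range_eq_map_top, inLeft_range_sup_inRight_range]

theorem opAB_range_eq : (opAB 𝔄 𝔅).range = (opA 𝔄 𝔅).range ⊔ (opB 𝔄 𝔅).range := by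
  have hA : opA 𝔄 𝔅 = (opAB 𝔄 𝔅).comp (inLeft _ _) := StarAlgHom.ext (opA_eq 𝔄 𝔅)
  have hB : opB 𝔄 𝔅 = (opAB 𝔄 𝔅).comp (inRight _ _) := StarAlgHom.ext (opB_eq_opAB 𝔄 𝔅)
  rw [hA, hB]
  simp only [StarAlgHom.range_eq_map_top, ← StarSubalgebra.map_map]
  rw [← StarSubalgebra.map_sup]
  simp only [← StarAlgHom.range_eq_map_top, inLeft_range_sup_inRight_range]

theorem range_toStarAlgHom {N N' : Type*} [Ring N] [StarRing N] [Algebra ℂ N]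
    [StarModule ℂ N] [Ring N'] [StarRing N'] [Algebra ℂ N'] [StarModule ℂ N'] (e : N ≃⋆ₐ[ℂ] N') :
    e.toStarAlgHom.range = ⊤ :=
  eq_top_iff.2 fun x _ ↦ ⟨e.symm x, e.apply_symm_apply x⟩

theorem opA_range_sup_opBC_range : (opA 𝔄 𝔅).range ⊔ (opBC 𝔄 𝔅).range = ⊤ := by
  rw [opA, opBC]
  simp only [StarAlgHom.range_eq_map_top, ← StarSubalgebra.map_map]
  rw [← StarSubalgebra.map_sup]
  simp only [← StarAlgHom.range_eq_map_top, inLeft_range_sup_inRight_range]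
  rw [range_toStarAlgHom]

theorem opAB_range_sup_opC_range : (opAB 𝔄 𝔅).range ⊔ (opC 𝔄 𝔅).range = ⊤ := by
  rw [opC, opAB]
  simp only [StarAlgHom.range_eq_map_top, ← StarSubalgebra.map_map]
  rw [← StarSubalgebra.map_sup]
  simp only [← StarAlgHom.range_eq_map_top, inLeft_range_sup_inRight_range]
  rw [range_toStarAlgHom]

variable {𝔄 𝔅}

theorem commute_opA_opBC (a : Op (Fin (𝔄.dim 0))) (z : Op (IdxBC 𝔄 𝔅)) :
    Commute (opA 𝔄 𝔅 a) (opBC 𝔄 𝔅 z) :=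
  (commute_inLeft_inRight a z).map (equivA_BC 𝔄 𝔅).symm

theorem commute_opAB_opC (y : Op (IdxAB 𝔄 𝔅)) (c : Op (Fin (𝔄.dim 1))) :
    Commute (opAB 𝔄 𝔅 y) (opC 𝔄 𝔅 c) :=
  (commute_inLeft_inRight y c).map (equivAB_C 𝔄 𝔅).symm

theorem commute_opA_opC (a : Op (Fin (𝔄.dim 0))) (c : Op (Fin (𝔄.dim 1))) :
    Commute (opA 𝔄 𝔅 a) (opC 𝔄 𝔅 c) :=
  opC_eq 𝔄 𝔅 c ▸ commute_opA_opBC a _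

theorem commute_opA_opB (a : Op (Fin (𝔄.dim 0))) (b : Op 𝔅.Idx) :
    Commute (opA 𝔄 𝔅 a) (opB 𝔄 𝔅 b) :=
  opB_eq_opBC 𝔄 𝔅 b ▸ commute_opA_opBC a _

theorem commute_opB_opC (b : Op 𝔅.Idx) (c : Op (Fin (𝔄.dim 1))) :
    Commute (opB 𝔄 𝔅 b) (opC 𝔄 𝔅 c) :=
  opB_eq_opAB 𝔄 𝔅 b ▸ commute_opAB_opC _ c

theorem opBC_injective [Nonempty (Fin (𝔄.dim 0))] : Function.Injective (opBC 𝔄 𝔅) :=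
  (equivA_BC 𝔄 𝔅).symm.injective.comp inRight_injective

theorem opAB_injective [Nonempty (Fin (𝔄.dim 1))] : Function.Injective (opAB 𝔄 𝔅) :=
  (equivAB_C 𝔄 𝔅).symm.injective.comp inLeft_injective

theorem mem_opBC_range_of_commute {x : Op (𝔄.Idx × 𝔅.Idx)}
    (h : ∀ a, Commute (opA 𝔄 𝔅 a) x) : x ∈ (opBC 𝔄 𝔅).range := by
  refine mem_of_mem_range_sup (opA 𝔄 𝔅) ?_ (opA_range_sup_opBC_range 𝔄 𝔅 ▸ trivial) h
  rintro a _ ⟨z, rfl⟩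
  exact commute_opA_opBC a z

theorem mem_opAB_range_of_commute {x : Op (𝔄.Idx × 𝔅.Idx)}
    (h : ∀ c, Commute (opC 𝔄 𝔅 c) x) : x ∈ (opAB 𝔄 𝔅).range := by
  refine mem_of_mem_range_sup (opC 𝔄 𝔅) ?_
    (by rw [sup_comm, opAB_range_sup_opC_range]; trivial) h
  rintro c _ ⟨y, rfl⟩
  exact (commute_opAB_opC y c).symm

theorem aut_ext_of_opAB_opC {Θ Θ' : Aut (𝔄.Idx × 𝔅.Idx)}
    (h : ∀ y, Θ (opAB 𝔄 𝔅 y) = Θ' (opAB 𝔄 𝔅 y)) (h' : ∀ c, Θ (opC 𝔄 𝔅 c) = Θ' (opC 𝔄 𝔅 c))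
    (x : Op (𝔄.Idx × 𝔅.Idx)) : Θ x = Θ' x := by
  have := hom_ext_of_inLeft_inRight (f := (equivAB_C 𝔄 𝔅).symm.trans Θ)
    (g := (equivAB_C 𝔄 𝔅).symm.trans Θ') h h' (equivAB_C 𝔄 𝔅 x)
  simpa using this

/-- The automorphism `id_A ⊗ ψ_BC`. -/
def autBC (ψ : Aut (IdxBC 𝔄 𝔅)) : Aut (𝔄.Idx × 𝔅.Idx) :=
  ((equivA_BC 𝔄 𝔅).trans (tensorAut (StarAlgEquiv.refl ℂ _) ψ)).trans (equivA_BC 𝔄 𝔅).symm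

/-- The automorphism `χ_AB ⊗ id_C`. -/
def autAB (χ : Aut (IdxAB 𝔄 𝔅)) : Aut (𝔄.Idx × 𝔅.Idx) :=
  ((equivAB_C 𝔄 𝔅).trans (tensorAut χ (StarAlgEquiv.refl ℂ _))).trans (equivAB_C 𝔄 𝔅).symm

theorem hasForm_iff {Θ : Aut (𝔄.Idx × 𝔅.Idx)} {ψ : Aut (IdxBC 𝔄 𝔅)} {χ : Aut (IdxAB 𝔄 𝔅)} :
    HasForm Θ ψ χ ↔ ∀ x, Θ x = autBC ψ (autAB χ x) := Iff.rfl

theorem autBC_opA (ψ : Aut (IdxBC 𝔄 𝔅)) (a) : autBC ψ (opA 𝔄 𝔅 a) = opA 𝔄 𝔅 a := by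
  simp [autBC, opA, tensorAut_inLeft]

theorem autBC_opBC (ψ : Aut (IdxBC 𝔄 𝔅)) (z) : autBC ψ (opBC 𝔄 𝔅 z) = opBC 𝔄 𝔅 (ψ z) := by
  simp [autBC, opBC, tensorAut_inRight]

theorem autAB_opC (χ : Aut (IdxAB 𝔄 𝔅)) (c) : autAB χ (opC 𝔄 𝔅 c) = opC 𝔄 𝔅 c := by
  simp [autAB, opC, tensorAut_inRight]

theorem autAB_opAB (χ : Aut (IdxAB 𝔄 𝔅)) (y) : autAB χ (opAB 𝔄 𝔅 y) = opAB 𝔄 𝔅 (χ y) := by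
  simp [autAB, opAB, tensorAut_inLeft]

/-- An automorphism `Θ` is of the form `(id_A ⊗ ψ_BC) ∘ (χ_AB ⊗ id_C)` as soon as it maps Charlie's
operators to operators that commute with Alice's. Indeed, `Θ` then embeds `B(H_C)` into `B(H_BC)`;
this embedding extends to an automorphism `ψ_BC`, and `(id_A ⊗ ψ_BC)⁻¹ ∘ Θ` is the identity on
Charlie's operators. -/
theorem exists_hasForm (Θ : Aut (𝔄.Idx × 𝔅.Idx))
    (h : ∀ a c, Commute (opA 𝔄 𝔅 a) (Θ (opC 𝔄 𝔅 c))) : ∃ ψ χ, HasForm Θ ψ χ := by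
  rcases isEmpty_or_nonempty (Fin (𝔄.dim 0)) with hA | hA
  · have : IsEmpty 𝔄.Idx := ⟨fun x ↦ hA.false (x 0)⟩
    exact ⟨StarAlgEquiv.refl ℂ _, StarAlgEquiv.refl ℂ _, fun x ↦ Subsingleton.elim _ _⟩
  rcases isEmpty_or_nonempty (Fin (𝔄.dim 1)) with hC | hC
  · have : IsEmpty 𝔄.Idx := ⟨fun x ↦ hC.false (x 1)⟩
    exact ⟨StarAlgEquiv.refl ℂ _, StarAlgEquiv.refl ℂ _, fun x ↦ Subsingleton.elim _ _⟩
  have hinj : Function.Injective (opBC 𝔄 𝔅) := opBC_injective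
  choose f hf' using fun c ↦ mem_opBC_range_of_commute fun a ↦ h a c
  have hf : ∀ c, opBC 𝔄 𝔅 (f c) = Θ (opC 𝔄 𝔅 c) := hf'
  let ρ : Op (Fin (𝔄.dim 1)) →⋆ₐ[ℂ] Op (IdxBC 𝔄 𝔅) :=
    { toFun := f
      map_one' := hinj (by simp [hf])
      map_mul' := fun a b ↦ hinj (by simp [hf])
      map_zero' := hinj (by simp [hf])
      map_add' := fun a b ↦ hinj (by simp [hf])
      commutes' := fun r ↦ hinj (by
        rw [hf, AlgHomClass.commutes (opC 𝔄 𝔅), AlgHomClass.commutes (opBC 𝔄 𝔅),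
          Algebra.algebraMap_eq_smul_one, map_smul, map_one])
      map_star' := fun a ↦ hinj (by rw [hf, map_star, map_star, map_star, hf]) }
  obtain ⟨ψ, hψ⟩ := exists_aut_inRight ρ
  let Θ' : Aut (𝔄.Idx × 𝔅.Idx) := Θ.trans (autBC ψ).symm
  have hΘ' : ∀ c, Θ' (opC 𝔄 𝔅 c) = opC 𝔄 𝔅 c := fun c ↦ by
    change (autBC ψ).symm (Θ (opC 𝔄 𝔅 c)) = _
    rw [← hf, StarAlgEquiv.symm_apply_eq, opC_eq, autBC_opBC, hψ]
    rfl
  obtain ⟨χ, hχ⟩ := exists_aut_of_map_range (opAB 𝔄 𝔅) opAB_injective Θ' fun y ↦ by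
    refine mem_opAB_range_of_commute fun c ↦ ?_
    have := (commute_opAB_opC y c).symm.map Θ'
    rwa [hΘ'] at this
  refine ⟨ψ, χ, hasForm_iff.2 fun x ↦ ?_⟩
  rw [← aut_ext_of_opAB_opC (Θ := Θ') (Θ' := autAB χ) (fun y ↦ by rw [hχ, autAB_opAB])
    (fun c ↦ by rw [hΘ', autAB_opC]) x]
  exact ((autBC ψ).apply_symm_apply (Θ x)).symm

variable {Θ : Aut (𝔄.Idx × 𝔅.Idx)} {ψ : Aut (IdxBC 𝔄 𝔅)} {χ : Aut (IdxAB 𝔄 𝔅)}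

/-- If `Θ` maps Alice's operators to Alice's operators, then `χ_AB` is a tensor product (unless the
tensor product `H_BC` is trivial). -/
theorem HasForm.decomposes_of_opA (h : HasForm Θ ψ χ)
    (hA : ∀ a, Θ (opA 𝔄 𝔅 a) ∈ (opA 𝔄 𝔅).range) : Decomposes ψ ∨ Decomposes χ := by
  rcases isEmpty_or_nonempty (Fin (𝔄.dim 1)) with hC | hC
  · exact Or.inl (decomposes_of_isEmpty ψ ⟨fun x ↦ hC.false x.2⟩)
  refine Or.inr (decomposes_of_inLeft χ fun a ↦ ?_)
  obtain ⟨a', ha'⟩ := hA a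
  refine ⟨a', opAB_injective (𝔄 := 𝔄) (𝔅 := 𝔅) ((autBC ψ).injective ?_)⟩
  change autBC ψ (opAB 𝔄 𝔅 (inLeft _ _ a')) = autBC ψ (opAB 𝔄 𝔅 (χ (inLeft _ _ a)))
  rw [← autAB_opAB, ← opA_eq, ← opA_eq, autBC_opA, ← hasForm_iff.1 h]
  exact ha'

theorem HasForm.decomposes_of_opC (h : HasForm Θ ψ χ)
    (hC : ∀ c, Θ (opC 𝔄 𝔅 c) ∈ (opC 𝔄 𝔅).range) : Decomposes ψ ∨ Decomposes χ := by
  rcases isEmpty_or_nonempty (Fin (𝔄.dim 0)) with hA | hA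
  · exact Or.inr (decomposes_of_isEmpty χ ⟨fun x ↦ hA.false x.1⟩)
  refine Or.inl (decomposes_of_inRight ψ fun c ↦ ?_)
  obtain ⟨c', hc'⟩ := hC c
  refine ⟨c', opBC_injective (𝔄 := 𝔄) (𝔅 := 𝔅) ?_⟩
  change opBC 𝔄 𝔅 (inRight _ _ c') = opBC 𝔄 𝔅 (ψ (inRight _ _ c))
  rw [← autBC_opBC, ← opC_eq, ← opC_eq, ← autAB_opC χ c, ← hasForm_iff.1 h]
  exact hc'

end ThreeParties

/-! ### Local algebras of the uncoupled theory -/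

section LocalAlgebras

variable {E M : Type*} [NormedAddCommGroup E] [NormedSpace ℝ E]
  [TopologicalSpace M] [ChartedSpace E M] [IsManifold 𝓘(ℝ, E) ∞ M] {S : Spacetime E M}

theorem HybridTheory.net_mono {n : ℕ} (𝔄 : HybridTheory S n) {L L' : Set M} (h : L ⊆ L') :
    𝔄.net L ≤ 𝔄.net L' :=
  StarAlgebra.adjoin_mono fun _ ⟨i, ⟨t, ht⟩, ha⟩ ↦ ⟨i, ⟨t, h ht⟩, ha⟩

theorem uncoupled_mono {m n : ℕ} (𝔄 : HybridTheory S m) (𝔅 : HybridTheory S n) {L L' : Set M}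
    (h : L ⊆ L') : uncoupled 𝔄 𝔅 L ≤ uncoupled 𝔄 𝔅 L' :=
  StarAlgebra.adjoin_mono fun _ ⟨a, ha, b, hb, hx⟩ ↦
    ⟨a, 𝔄.net_mono h ha, b, 𝔅.net_mono h hb, hx⟩

theorem kronecker_one_mem_uncoupled {m n : ℕ} {𝔄 : HybridTheory S m} (𝔅 : HybridTheory S n)
    {L : Set M} {a : Op 𝔄.Idx} (ha : a ∈ 𝔄.net L) : a ⊗ₖ (1 : Op 𝔅.Idx) ∈ uncoupled 𝔄 𝔅 L :=
  StarAlgebra.subset_adjoin ℂ _ ⟨a, ha, 1, one_mem _, rfl⟩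

theorem one_kronecker_mem_uncoupled {m n : ℕ} (𝔄 : HybridTheory S m) {𝔅 : HybridTheory S n}
    {L : Set M} {b : Op 𝔅.Idx} (hb : b ∈ 𝔅.net L) : (1 : Op 𝔄.Idx) ⊗ₖ b ∈ uncoupled 𝔄 𝔅 L :=
  StarAlgebra.subset_adjoin ℂ _ ⟨1, one_mem _, b, hb, rfl⟩

theorem HybridTheory.slot_mem_net {n : ℕ} (𝔄 : HybridTheory S n) {L : Set M} {i : Fin n}
    (h : ∃ t, 𝔄.worldline i t ∈ L) (a : Op (Fin (𝔄.dim i))) : 𝔄.slot i a ∈ 𝔄.net L :=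
  StarAlgebra.subset_adjoin ℂ _ ⟨i, h, a, rfl⟩

theorem opA_mem_uncoupled {n : ℕ} {𝔄 : HybridTheory S 2} {𝔅 : HybridTheory S n} {L : Set M}
    (h : ∃ t, 𝔄.worldline 0 t ∈ L) (a) : opA 𝔄 𝔅 a ∈ uncoupled 𝔄 𝔅 L := by
  rw [← slot_zero_kronecker_one]
  exact kronecker_one_mem_uncoupled 𝔅 (𝔄.slot_mem_net h a)

theorem opC_mem_uncoupled {n : ℕ} {𝔄 : HybridTheory S 2} {𝔅 : HybridTheory S n} {L : Set M}
    (h : ∃ t, 𝔄.worldline 1 t ∈ L) (c) : opC 𝔄 𝔅 c ∈ uncoupled 𝔄 𝔅 L := by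
  rw [← slot_one_kronecker_one]
  exact kronecker_one_mem_uncoupled 𝔅 (𝔄.slot_mem_net h c)

theorem HybridTheory.exists_slot_eq (𝔅 : HybridTheory S 1) (b : Op 𝔅.Idx) :
    ∃ b', 𝔅.slot 0 b' = b := by
  refine ⟨Matrix.of fun k l ↦ b (fun i ↦ Fin.cases k (fun j ↦ j.elim0) i)
    (fun i ↦ Fin.cases l (fun j ↦ j.elim0) i), ?_⟩
  ext f g
  have h : ∀ j : Fin 1, j ≠ 0 → f j = g j := fun j hj ↦ absurd (Subsingleton.elim j 0) hj
  simp only [HybridTheory.slot, Matrix.of_apply]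
  rw [if_pos h]
  congr 1 <;> (ext j; rw [Subsingleton.elim j 0]; rfl)

theorem opB_mem_uncoupled {𝔄 : HybridTheory S 2} {𝔅 : HybridTheory S 1} {L : Set M}
    (h : ∃ t, 𝔅.worldline 0 t ∈ L) (b) : opB 𝔄 𝔅 b ∈ uncoupled 𝔄 𝔅 L := by
  obtain ⟨b', rfl⟩ := 𝔅.exists_slot_eq b
  exact one_kronecker_mem_uncoupled 𝔄 (𝔅.slot_mem_net h b')

/-- The three tensor factors of the global algebra, labelled by the worldlines: `inl 0` is Alice,
`inl 1` is Charlie and `inr 0` is Bob. -/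
def factor (𝔄 : HybridTheory S 2) (𝔅 : HybridTheory S 1) :
    Fin 2 ⊕ Fin 1 → StarSubalgebra ℂ (Op (𝔄.Idx × 𝔅.Idx)) :=
  Sum.elim ![(opA 𝔄 𝔅).range, (opC 𝔄 𝔅).range] fun _ ↦ (opB 𝔄 𝔅).range

/-- The worldlines of system and probe. -/
abbrev lines {m n : ℕ} (𝔄 : HybridTheory S m) (𝔅 : HybridTheory S n) :
    Fin m ⊕ Fin n → S.Worldline := Sum.elim 𝔄.worldline 𝔅.worldline

theorem forall_lines {P : Fin 2 ⊕ Fin 1 → Prop} :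
    (∀ j, P j) ↔ P (.inl 0) ∧ P (.inl 1) ∧ P (.inr 0) := by
  simp [Sum.forall, Fin.forall_fin_two, and_assoc]

variable (𝔄 : HybridTheory S 2) (𝔅 : HybridTheory S 1)

theorem isFactorization_factor : IsFactorization (factor 𝔄 𝔅) where
  matrix := forall_lines.2 ⟨⟨_, _, _, opA 𝔄 𝔅, rfl⟩, ⟨_, _, _, opC 𝔄 𝔅, rfl⟩,
    ⟨_, _, _, opB 𝔄 𝔅, rfl⟩⟩
  commute := by
    have hAC : ∀ x ∈ (opA 𝔄 𝔅).range, ∀ y ∈ (opC 𝔄 𝔅).range, Commute x y := by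
      rintro _ ⟨a, rfl⟩ _ ⟨c, rfl⟩; exact commute_opA_opC a c
    have hAB : ∀ x ∈ (opA 𝔄 𝔅).range, ∀ y ∈ (opB 𝔄 𝔅).range, Commute x y := by
      rintro _ ⟨a, rfl⟩ _ ⟨b, rfl⟩; exact commute_opA_opB a b
    have hBC : ∀ x ∈ (opB 𝔄 𝔅).range, ∀ y ∈ (opC 𝔄 𝔅).range, Commute x y := by
      rintro _ ⟨b, rfl⟩ _ ⟨c, rfl⟩; exact commute_opB_opC b c
    refine forall_lines.2 ⟨forall_lines.2 ⟨fun h ↦ absurd rfl h, fun _ ↦ hAC, fun _ ↦ hAB⟩,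
      forall_lines.2 ⟨fun _ x hx y hy ↦ (hAC y hy x hx).symm, fun h ↦ absurd rfl h,
        fun _ x hx y hy ↦ (hBC y hy x hx).symm⟩,
      forall_lines.2 ⟨fun _ x hx y hy ↦ (hAB y hy x hx).symm, fun _ ↦ hBC,
        fun h ↦ absurd rfl h⟩⟩
  iSup_eq := by
    refine eq_top_iff.2 ((opA_range_sup_opBC_range 𝔄 𝔅).ge.trans (sup_le ?_ ?_))
    · exact le_iSup (factor 𝔄 𝔅) (.inl 0)
    · rw [opBC_range_eq]
      exact sup_le (le_iSup (factor 𝔄 𝔅) (.inr 0)) (le_iSup (factor 𝔄 𝔅) (.inl 1))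

/-- The local algebra of the uncoupled theory is the product of the factors whose worldlines meet
the region. -/
theorem uncoupled_eq (L : Set M) :
    uncoupled 𝔄 𝔅 L = ⨆ j, ⨆ (_ : ∃ t, lines 𝔄 𝔅 j t ∈ L), factor 𝔄 𝔅 j := by
  apply le_antisymm
  · refine StarAlgebra.adjoin_le ?_
    rintro _ ⟨a, ha, b, hb, rfl⟩
    rw [SetLike.mem_coe, ← inLeft_mul_inRight]
    have h1 : 𝔄.net L ≤ StarSubalgebra.comap (inLeft 𝔄.Idx 𝔅.Idx)
        (⨆ j, ⨆ (_ : ∃ t, lines 𝔄 𝔅 j t ∈ L), factor 𝔄 𝔅 j) := by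
      refine StarAlgebra.adjoin_le ?_
      rintro _ ⟨i, hi, a, rfl⟩
      refine le_iSup₂_of_le (f := fun j (_ : ∃ t, lines 𝔄 𝔅 j t ∈ L) ↦ factor 𝔄 𝔅 j)
        (Sum.inl i) hi le_rfl ?_
      change 𝔄.slot i a ⊗ₖ (1 : Op 𝔅.Idx) ∈ factor 𝔄 𝔅 (Sum.inl i)
      revert i
      refine Fin.forall_fin_two.2 ⟨fun _ a ↦ ?_, fun _ a ↦ ?_⟩
      · rw [slot_zero_kronecker_one]; exact ⟨a, rfl⟩
      · rw [slot_one_kronecker_one]; exact ⟨a, rfl⟩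
    have h2 : 𝔅.net L ≤ StarSubalgebra.comap (inRight 𝔄.Idx 𝔅.Idx)
        (⨆ j, ⨆ (_ : ∃ t, lines 𝔄 𝔅 j t ∈ L), factor 𝔄 𝔅 j) := by
      refine StarAlgebra.adjoin_le ?_
      rintro _ ⟨i, hi, b, rfl⟩
      exact le_iSup₂_of_le (f := fun j (_ : ∃ t, lines 𝔄 𝔅 j t ∈ L) ↦ factor 𝔄 𝔅 j)
        (Sum.inr i) hi le_rfl ⟨_, rfl⟩
    exact mul_mem (h1 ha) (h2 hb)
  · refine iSup_le (forall_lines.2 ⟨?_, ?_, ?_⟩) <;> refine iSup_le fun h ↦ ?_ <;>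
      rintro _ ⟨x, rfl⟩
    exacts [opA_mem_uncoupled h x, opC_mem_uncoupled h x, opB_mem_uncoupled h x]

variable {𝔄 𝔅}

theorem factor_le_uncoupled {L : Set M} {j : Fin 2 ⊕ Fin 1} (h : ∃ t, lines 𝔄 𝔅 j t ∈ L) :
    factor 𝔄 𝔅 j ≤ uncoupled 𝔄 𝔅 L := by
  rw [uncoupled_eq]
  exact le_iSup₂_of_le (f := fun j (_ : ∃ t, lines 𝔄 𝔅 j t ∈ L) ↦ factor 𝔄 𝔅 j) j h le_rfl

theorem uncoupled_le_factor {L : Set M} {i : Fin 2 ⊕ Fin 1}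
    (h : ∀ j, j ≠ i → ∀ t, lines 𝔄 𝔅 j t ∉ L) : uncoupled 𝔄 𝔅 L ≤ factor 𝔄 𝔅 i := by
  rw [uncoupled_eq]
  refine iSup_le fun j ↦ iSup_le fun ⟨t, ht⟩ ↦ ?_
  by_cases hji : j = i
  · rw [hji]
  · exact absurd ht (h j hji t)

end LocalAlgebras

/-! ### Locality of the scattering morphism -/

section Scattering

variable {E M : Type*} [NormedAddCommGroup E] [NormedSpace ℝ E]
  [TopologicalSpace M] [ChartedSpace E M] [IsManifold 𝓘(ℝ, E) ∞ M] {S : Spacetime E M}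

namespace FVMeasurement

section General

variable {m n : ℕ} {𝔄 : HybridTheory S m} {𝔅 : HybridTheory S n} (μ : FVMeasurement 𝔄 𝔅)

theorem scattering_apply (x : Op (𝔄.Idx × 𝔅.Idx)) :
    μ.scattering x = μ.respMinus.symm (μ.respPlus x) := rfl

theorem scattering_of_mem_perp {u : Op (𝔄.Idx × 𝔅.Idx)} (hu : u ∈ uncoupled 𝔄 𝔅 (S.perp μ.K)) :
    μ.scattering u = u := by
  rw [scattering_apply, μ.agree u hu, StarAlgEquiv.symm_apply_apply]

theorem respPlus_mem {L : Set M} (hL : S.IsRegion L) (h : L ⊆ S.MPlus μ.K)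
    {u : Op (𝔄.Idx × 𝔅.Idx)} (hu : u ∈ uncoupled 𝔄 𝔅 L) : μ.respPlus u ∈ μ.coupled.net L := by
  rw [← SetLike.mem_coe, ← μ.respPlus_image L hL h]
  exact ⟨u, hu, rfl⟩

theorem respMinus_mem {L : Set M} (hL : S.IsRegion L) (h : L ⊆ S.MMinus μ.K)
    {u : Op (𝔄.Idx × 𝔅.Idx)} (hu : u ∈ uncoupled 𝔄 𝔅 L) : μ.respMinus u ∈ μ.coupled.net L := by
  rw [← SetLike.mem_coe, ← μ.respMinus_image L hL h]
  exact ⟨u, hu, rfl⟩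

/-- Observables localised outside the future of the coupling zone commute with the scattered
observables of a causally disjoint region outside the past of the coupling zone. -/
theorem commute_scattering {L L' : Set M} (hL : S.IsRegion L) (hL' : S.IsRegion L')
    (h : L ⊆ S.MMinus μ.K) (h' : L' ⊆ S.MPlus μ.K) (hd : S.CausallyDisjoint L L')
    {u v : Op (𝔄.Idx × 𝔅.Idx)} (hu : u ∈ uncoupled 𝔄 𝔅 L) (hv : v ∈ uncoupled 𝔄 𝔅 L') :
    Commute u (μ.scattering v) := by
  have := (μ.isAQFT.einstein L L' hL hL' hd _ (μ.respMinus_mem hL h hu) _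
    (μ.respPlus_mem hL' h' hv)).map μ.respMinus.symm
  rwa [StarAlgEquiv.symm_apply_apply] at this

end General

/-- If there is a causal order in which Bob's laboratory comes after Alice's and before Charlie's,
then the scattered observables of Charlie commute with those of Alice. -/
theorem commute_opA_scattering_opC {n : ℕ} {𝔄 : HybridTheory S 2} {𝔅 : HybridTheory S n}
    (μ : FVMeasurement 𝔄 𝔅) {O_A O_B O_C : Set M} (hO_A : S.IsRegion O_A) (hO_C : S.IsRegion O_C)
    (hA : ∃ t, 𝔄.worldline 0 t ∈ O_A) (hC : ∃ t, 𝔄.worldline 1 t ∈ O_C)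
    (hAC : S.CausallyDisjoint O_A O_C) {r : Set M → Set M → Prop}
    (hr : S.IsCausalOrder {O_A, O_B, O_C} r) (hAB : r O_A O_B) (hBC : r O_B O_C)
    (hK : μ.K ⊆ O_B) (a c) : Commute (opA 𝔄 𝔅 a) (μ.scattering (opC 𝔄 𝔅 c)) := by
  have hdisj : ∀ p ∈ O_A, ∀ q ∈ O_C, ¬ S.CausalLE p q ∧ ¬ S.CausalLE q p := fun p hp q hq ↦
    ⟨fun h ↦ hAC hp (Or.inr ⟨q, hq, h⟩), fun h ↦ hAC hp (Or.inl ⟨q, hq, h⟩)⟩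
  by_cases h1 : O_A = O_B
  · -- the coupling zone lies in Alice's laboratory, so Charlie does not notice it
    have hsub : O_C ⊆ S.perp μ.K := fun q hq ↦ Spacetime.mem_perp.2
      ⟨fun ⟨k, hk, h⟩ ↦ (hdisj k (h1 ▸ hK hk) q hq).1 h,
        fun ⟨k, hk, h⟩ ↦ (hdisj k (h1 ▸ hK hk) q hq).2 h⟩
    rw [μ.scattering_of_mem_perp (uncoupled_mono 𝔄 𝔅 hsub (opC_mem_uncoupled hC c))]
    exact commute_opA_opC a c
  by_cases h2 : O_B = O_C
  · have hsub : O_A ⊆ S.perp μ.K := fun p hp ↦ Spacetime.mem_perp.2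
      ⟨fun ⟨k, hk, h⟩ ↦ (hdisj p hp k (h2 ▸ hK hk)).2 h,
        fun ⟨k, hk, h⟩ ↦ (hdisj p hp k (h2 ▸ hK hk)).1 h⟩
    have := (commute_opA_opC a c).map μ.scattering
    rwa [μ.scattering_of_mem_perp (uncoupled_mono 𝔄 𝔅 hsub (opA_mem_uncoupled hA a))] at this
  have hB := hr.causal O_A (by simp) O_B (by simp) hAB h1
  have hC' := hr.causal O_B (by simp) O_C (by simp) hBC h2
  refine μ.commute_scattering hO_A hO_C (fun p hp ↦ ?_) (fun q hq ↦ ?_) hAC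
    (opA_mem_uncoupled hA a) (opC_mem_uncoupled hC c)
  · rintro ⟨k, hk, h⟩
    exact hB (subset_closure (hK hk)) ⟨p, subset_closure hp, h⟩
  · rintro ⟨k, hk, h⟩
    exact hC' (subset_closure hq) ⟨k, subset_closure (hK hk), h⟩

end FVMeasurement

end Scattering

/-! ### The coupling zone -/

section CouplingZone

variable {E M : Type*} [NormedAddCommGroup E] [NormedSpace ℝ E]
  [TopologicalSpace M] [ChartedSpace E M] [IsManifold 𝓘(ℝ, E) ∞ M] {S : Spacetime E M}

theorem exists_lt_forall_Icc {P : ℝ → Prop} {a : ℝ} (h : ∀ᶠ t in 𝓝 a, P t) :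
    ∃ b < a, ∀ t ∈ Set.Icc b a, P t := by
  obtain ⟨b, hb, h'⟩ := exists_Ioc_subset_of_mem_nhds h ⟨a - 1, by linarith⟩
  exact ⟨(b + a) / 2, by linarith, fun t ht ↦ h' ⟨by linarith [ht.1], ht.2⟩⟩

theorem exists_gt_forall_Icc {P : ℝ → Prop} {a : ℝ} (h : ∀ᶠ t in 𝓝 a, P t) :
    ∃ b > a, ∀ t ∈ Set.Icc a b, P t := by
  obtain ⟨b, hb, h'⟩ := exists_Ico_subset_of_mem_nhds h ⟨a + 1, by linarith⟩
  exact ⟨(b + a) / 2, by linarith, fun t ht ↦ h' ⟨ht.1, by linarith [ht.2]⟩⟩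

theorem SegmentedTheory.label_le_net {J : Type*} {γ : J → S.Worldline} {𝓐 : Type*} [Ring 𝓐]
    [StarRing 𝓐] [Algebra ℂ 𝓐] [StarModule ℂ 𝓐] (ℭ : SegmentedTheory γ 𝓐) {j : J} {t : ℝ}
    (ht : t ∉ ℭ.cuts j) {L : Set M} (hL : γ j t ∈ L) : ℭ.label j t ≤ ℭ.net L :=
  fun _ hx ↦ StarAlgebra.subset_adjoin ℂ _ ⟨j, t, ht, hL, hx⟩

namespace FVMeasurement

variable {𝔄 : HybridTheory S 2} {𝔅 : HybridTheory S 1} (μ : FVMeasurement 𝔄 𝔅)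

section Hausdorff

variable [T2Space M] (hS : S.GloballyHyperbolic)

include hS

/-- Near a point that is causally unrelated to the entry of a worldline into the causal hull of the
coupling zone, the coupled theory commutes with the incoming observables of that worldline. -/
theorem exists_commute_respMinus {j : Fin 2 ⊕ Fin 1} {a : ℝ}
    (ha : ∀ t < a, lines 𝔄 𝔅 j t ∉ S.JPlus μ.K) {y : M} (hy : ¬ S.CausalLE y (lines 𝔄 𝔅 j a))
    (hy' : ¬ S.CausalLE (lines 𝔄 𝔅 j a) y) : ∃ V, y ∈ V ∧ S.IsRegion V ∧
      ∀ r ∈ factor 𝔄 𝔅 j, ∀ z ∈ μ.coupled.net V, Commute (μ.respMinus r) z := by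
  obtain ⟨V, W, haV, hyW, hV, hW, hd⟩ := Spacetime.exists_causallyDisjoint hS hy' hy
  obtain ⟨b, hb, hbV⟩ := exists_lt_forall_Icc
    ((lines 𝔄 𝔅 j).continuous.continuousAt.eventually_mem (hV.1.mem_nhds haV))
  obtain ⟨L, hLU, hbL, hL⟩ := hS.1 (lines 𝔄 𝔅 j b) (V ∩ S.MMinus μ.K)
    ((hV.1.inter (Spacetime.isOpen_MMinus hS μ.isCompact_K)).mem_nhds
      ⟨hbV b ⟨le_rfl, hb.le⟩, ha b hb⟩)
  refine ⟨W, hyW, hW, fun r hr z hz ↦ ?_⟩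
  exact μ.isAQFT.einstein L W hL hW (fun p hp ↦ hd (hLU hp).1) _
    (μ.respMinus_mem hL (fun p hp ↦ (hLU hp).2) (factor_le_uncoupled ⟨b, hbL⟩ hr)) z hz

theorem exists_commute_respPlus {j : Fin 2 ⊕ Fin 1} {a : ℝ}
    (ha : ∀ t > a, lines 𝔄 𝔅 j t ∉ S.JMinus μ.K) {y : M} (hy : ¬ S.CausalLE y (lines 𝔄 𝔅 j a))
    (hy' : ¬ S.CausalLE (lines 𝔄 𝔅 j a) y) : ∃ V, y ∈ V ∧ S.IsRegion V ∧
      ∀ r ∈ factor 𝔄 𝔅 j, ∀ z ∈ μ.coupled.net V, Commute (μ.respPlus r) z := by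
  obtain ⟨V, W, haV, hyW, hV, hW, hd⟩ := Spacetime.exists_causallyDisjoint hS hy' hy
  obtain ⟨b, hb, hbV⟩ := exists_gt_forall_Icc
    ((lines 𝔄 𝔅 j).continuous.continuousAt.eventually_mem (hV.1.mem_nhds haV))
  obtain ⟨L, hLU, hbL, hL⟩ := hS.1 (lines 𝔄 𝔅 j b) (V ∩ S.MPlus μ.K)
    ((hV.1.inter (Spacetime.isOpen_MPlus hS μ.isCompact_K)).mem_nhds
      ⟨hbV b ⟨hb.le, le_rfl⟩, ha b hb⟩)
  refine ⟨W, hyW, hW, fun r hr z hz ↦ ?_⟩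
  exact μ.isAQFT.einstein L W hL hW (fun p hp ↦ hd (hLU hp).1) _
    (μ.respPlus_mem hL (fun p hp ↦ (hLU hp).2) (factor_le_uncoupled ⟨b, hbL⟩ hr)) z hz

/-- Unless a signal can be sent from worldline `i` to worldline `j` within the causal hull of the
coupling zone, the observables of `i` commute with the scattered observables of `j`. -/
theorem commute_factor_scattering {i j : Fin 2 ⊕ Fin 1} (hij : i ≠ j)
    (h : ∀ s t, lines 𝔄 𝔅 i s ∈ S.hull μ.K → lines 𝔄 𝔅 j t ∈ S.hull μ.K →
      ¬ S.CausalLE (lines 𝔄 𝔅 i s) (lines 𝔄 𝔅 j t)) :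
    ∀ x ∈ factor 𝔄 𝔅 i, ∀ y ∈ factor 𝔄 𝔅 j, Commute x (μ.scattering y) := by
  intro x hx y hy
  have hxy := (isFactorization_factor 𝔄 𝔅).commute i j hij x hx y hy
  have hK := μ.isCompact_K
  rcases (lines 𝔄 𝔅 i).meets_hull_or_perp hS hK with hi | hi
  swap
  · have := hxy.map μ.scattering
    rwa [μ.scattering_of_mem_perp (factor_le_uncoupled hi hx)] at this
  rcases (lines 𝔄 𝔅 j).meets_hull_or_perp hS hK with hj | hj
  swap
  · rwa [μ.scattering_of_mem_perp (factor_le_uncoupled hj hy)]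
  obtain ⟨a, haK, ha⟩ := (lines 𝔄 𝔅 i).exists_entry hS hK hi
  obtain ⟨b, hbK, hb⟩ := (lines 𝔄 𝔅 j).exists_exit hS hK hj
  -- just before `a` and just after `b`, the two worldlines are causally unrelated
  have hev := Spacetime.eventually_not_causalLE hS (h a b haK hbK)
  rw [nhds_prod_eq] at hev
  obtain ⟨P, hP, Q, hQ, hPQ⟩ := Filter.eventually_prod_iff.1 hev
  obtain ⟨s, hs, hsP⟩ := exists_lt_forall_Icc ((lines 𝔄 𝔅 i).continuous.continuousAt.eventually hP)
  obtain ⟨t, ht, htQ⟩ := exists_gt_forall_Icc ((lines 𝔄 𝔅 j).continuous.continuousAt.eventually hQ)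
  have h1 : ¬ S.CausalLE (lines 𝔄 𝔅 i s) (lines 𝔄 𝔅 j t) :=
    hPQ (hsP s ⟨le_rfl, hs.le⟩) (htQ t ⟨ht.le, le_rfl⟩)
  have h2 : ¬ S.CausalLE (lines 𝔄 𝔅 j t) (lines 𝔄 𝔅 i s) := fun hle ↦
    ha s hs (Spacetime.JPlus_of_le hbK.1 (((lines 𝔄 𝔅 j).causalLE ht.le).trans hle))
  obtain ⟨V, W, hsV, htW, hV, hW, hd⟩ := Spacetime.exists_causallyDisjoint hS h1 h2
  obtain ⟨L, hLU, hsL, hL⟩ := hS.1 _ (V ∩ S.MMinus μ.K)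
    ((hV.1.inter (Spacetime.isOpen_MMinus hS hK)).mem_nhds ⟨hsV, ha s hs⟩)
  obtain ⟨L', hLU', htL', hL'⟩ := hS.1 _ (W ∩ S.MPlus μ.K)
    ((hW.1.inter (Spacetime.isOpen_MPlus hS hK)).mem_nhds ⟨htW, hb t ht⟩)
  refine μ.commute_scattering hL hL' (fun p hp ↦ (hLU hp).2) (fun p hp ↦ (hLU' hp).2)
    (fun p hp ↦ ?_) (factor_le_uncoupled ⟨s, hsL⟩ hx) (factor_le_uncoupled ⟨t, htL'⟩ hy)
  obtain ⟨h3, h4⟩ := Spacetime.mem_perp.1 (hd (hLU hp).1)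
  exact Spacetime.mem_perp.2 ⟨fun h ↦ h3 (Spacetime.JPlus_mono (fun q hq ↦ (hLU' hq).1) h),
    fun h ↦ h4 (Spacetime.JMinus_mono (fun q hq ↦ (hLU' hq).1) h)⟩

/-- Let `x` be a point of Bob's worldline in the future of the coupling zone that is causally
unrelated to the part of worldline `i` within the hull of the coupling zone, and that is not in the
future of the entry of worldline `k` into the hull. Then there is a time slice which contains `x`
and points of `i` and `k` just before their entry into the hull. Near this slice, the coupled
theory is generated by incoming observables of `i` and by operators that commute with both the
incoming and the outgoing observables of `i`. So the outgoing observables of `i` are among the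
incoming ones. -/
theorem scattering_mem_factor_of_slice {i k b : Fin 2 ⊕ Fin 1} (hikb : ∀ j, j = i ∨ j = k ∨ j = b)
    (hib : b ≠ i) (hik : k ≠ i) {a a' c u : ℝ}
    (haK : lines 𝔄 𝔅 i a ∈ S.hull μ.K) (ha : ∀ t < a, lines 𝔄 𝔅 i t ∉ S.JPlus μ.K)
    (ha' : ∀ t > a', lines 𝔄 𝔅 i t ∉ S.JMinus μ.K)
    (hc : ∀ t < c, lines 𝔄 𝔅 k t ∉ S.JPlus μ.K)
    (hu : lines 𝔄 𝔅 b u ∈ S.JPlus μ.K)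
    (h1 : ¬ S.CausalLE (lines 𝔄 𝔅 b u) (lines 𝔄 𝔅 i a'))
    (h2 : ¬ S.CausalLE (lines 𝔄 𝔅 i a) (lines 𝔄 𝔅 b u))
    (h3 : ¬ S.CausalLE (lines 𝔄 𝔅 k c) (lines 𝔄 𝔅 b u))
    (h4 : ¬ S.CausalLE (lines 𝔄 𝔅 i a) (lines 𝔄 𝔅 k c))
    (h5 : ¬ S.CausalLE (lines 𝔄 𝔅 k c) (lines 𝔄 𝔅 i a')) :
    ∀ r ∈ factor 𝔄 𝔅 i, μ.scattering r ∈ factor 𝔄 𝔅 i := by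
  classical
  set γi := lines 𝔄 𝔅 i with hγi
  set γk := lines 𝔄 𝔅 k with hγk
  set γb := lines 𝔄 𝔅 b with hγb
  have haa' : a ≤ a' := by
    by_contra hlt
    exact ha' a (not_le.1 hlt) haK.2
  have hle := γi.causalLE haa'
  -- the incoming part of `i`
  have evi : ∀ᶠ t in 𝓝 a, (¬ S.CausalLE (γi t) (γb u) ∧ ¬ S.CausalLE (γb u) (γi t)) ∧
      ¬ S.CausalLE (γi t) (γk c) ∧ ¬ S.CausalLE (γk c) (γi t) := by
    have o1 := ((Spacetime.isClosed_JMinus_singleton hS (γb u)).isOpen_compl.preimage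
      γi.continuous).mem_nhds (x := a) (by simpa [Spacetime.mem_JMinus_singleton] using h2)
    have o2 := ((Spacetime.isClosed_JPlus_singleton hS (γb u)).isOpen_compl.preimage
      γi.continuous).mem_nhds (x := a)
      (by simpa [Spacetime.mem_JPlus_singleton] using fun h ↦ h1 (h.trans hle))
    have o3 := ((Spacetime.isClosed_JMinus_singleton hS (γk c)).isOpen_compl.preimage
      γi.continuous).mem_nhds (x := a) (by simpa [Spacetime.mem_JMinus_singleton] using h4)
    have o4 := ((Spacetime.isClosed_JPlus_singleton hS (γk c)).isOpen_compl.preimage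
      γi.continuous).mem_nhds (x := a)
      (by simpa [Spacetime.mem_JPlus_singleton] using fun h ↦ h5 (h.trans hle))
    filter_upwards [o1, o2, o3, o4] with t q1 q2 q3 q4
    simp only [Set.mem_preimage, Set.mem_compl_iff, Spacetime.mem_JMinus_singleton,
      Spacetime.mem_JPlus_singleton] at q1 q2 q3 q4
    exact ⟨⟨q1, q2⟩, q3, q4⟩
  -- points unrelated to the entry and the exit of `i`
  have open_unrel : ∀ (γ : S.Worldline) (w : ℝ), ¬ S.CausalLE (γi a) (γ w) →
      ¬ S.CausalLE (γ w) (γi a') → ∀ᶠ t in 𝓝 w, ¬ S.CausalLE (γi a) (γ t) ∧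
        ¬ S.CausalLE (γ t) (γi a') := by
    intro γ w g1 g2
    have o1 := ((Spacetime.isClosed_JPlus_singleton hS (γi a)).isOpen_compl.preimage
      γ.continuous).mem_nhds (x := w) (by simpa [Spacetime.mem_JPlus_singleton] using g1)
    have o2 := ((Spacetime.isClosed_JMinus_singleton hS (γi a')).isOpen_compl.preimage
      γ.continuous).mem_nhds (x := w) (by simpa [Spacetime.mem_JMinus_singleton] using g2)
    filter_upwards [o1, o2] with t q1 q2
    simp only [Set.mem_preimage, Set.mem_compl_iff, Spacetime.mem_JMinus_singleton,
      Spacetime.mem_JPlus_singleton] at q1 q2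
    exact ⟨q1, q2⟩
  have evk3 : ∀ᶠ t in 𝓝 c, ¬ S.CausalLE (γk t) (γb u) := by
    have o1 := ((Spacetime.isClosed_JMinus_singleton hS (γb u)).isOpen_compl.preimage
      γk.continuous).mem_nhds (x := c) (by simpa [Spacetime.mem_JMinus_singleton] using h3)
    filter_upwards [o1] with t q1
    simpa only [Set.mem_preimage, Set.mem_compl_iff, Spacetime.mem_JMinus_singleton] using q1
  obtain ⟨a₁, ha₁, Hi⟩ := exists_lt_forall_Icc evi
  obtain ⟨c₁, hc₁, Hk⟩ := exists_lt_forall_Icc ((open_unrel γk c h4 h5).and evk3)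
  obtain ⟨u₂, hu₂, Hb⟩ := exists_gt_forall_Icc (open_unrel γb u h2 h1)
  obtain ⟨a₂, ha₁₂, ha₂⟩ := exists_between ha₁
  obtain ⟨c₂, hc₁₂, hc₂⟩ := exists_between hc₁
  have Hi2 := Hi a₂ ⟨ha₁₂.le, ha₂.le⟩
  have Hk2 := Hk c₂ ⟨hc₁₂.le, hc₂.le⟩
  have Hb2 := Hb u₂ ⟨hu₂.le, le_rfl⟩
  -- the slice
  set X : Set M := {γi a₁, γb u, γk c₁} with hX
  set Y : Set M := {γi a₂, γb u₂, γk c₂} with hY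
  have hXc : IsCompact X := (Set.toFinite X).isCompact
  have hYc : IsCompact Y := (Set.toFinite Y).isCompact
  have hXY : ∀ x ∈ X, ∀ y ∈ Y, ¬ S.CausalLE y x := by
    have g1 : ∀ y, ¬ S.CausalLE y (γi a') → ¬ S.CausalLE y (γi a₁) := fun y hy h ↦
      hy (h.trans (γi.causalLE (ha₁.le.trans haa')))
    rintro x (rfl | rfl | rfl) y (rfl | rfl | rfl)
    · exact γi.not_causalLE hS ha₁₂
    · exact g1 _ Hb2.2
    · exact g1 _ Hk2.1.2
    · exact Hi2.1.1
    · exact γb.not_causalLE hS hu₂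
    · exact Hk2.2
    · exact fun h ↦ Hi2.2.1 (h.trans (γk.causalLE hc₁.le))
    · exact fun h ↦ hc c₁ hc₁ (Spacetime.JPlus_of_le hu ((γb.causalLE hu₂.le).trans h))
    · exact γk.not_causalLE hS hc₁₂
  set O : Set M := S.MPlus X ∩ S.MMinus Y with hO
  have hOreg : S.IsRegion O := Spacetime.isRegion_slice hS hXc hYc
  have htime : ∀ (γ : S.Worldline) (s t' t : ℝ), γ s ∈ X → γ t' ∈ Y → γ t ∈ O →
      t ∈ Set.Ioo s t' := by
    intro γ s t' t hs ht' ht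
    refine ⟨not_le.1 fun h ↦ ht.1 ⟨_, hs, γ.causalLE h⟩,
      not_le.1 fun h ↦ ht.2 ⟨_, ht', γ.causalLE h⟩⟩
  have htop : μ.coupled.net O = ⊤ := by
    rw [← top_le_iff, ← μ.isAQFT.global]
    exact μ.isAQFT.diamond O Set.univ hOreg S.isRegion_univ
      (by rw [hO, Spacetime.D_slice hS hXc hYc hXY])
  -- the operators that commute with the incoming and the outgoing observables of `i`
  let Z : Set (Op (𝔄.Idx × 𝔅.Idx)) :=
    μ.respMinus '' (factor 𝔄 𝔅 i : Set _) ∪ μ.respPlus '' (factor 𝔄 𝔅 i : Set _)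
  let D : StarSubalgebra ℂ (Op (𝔄.Idx × 𝔅.Idx)) :=
    (StarSubalgebra.centralizer ℂ Z).comap μ.respMinus.toStarAlgHom
  have hDmem : ∀ d, d ∈ D ↔ ∀ r ∈ factor 𝔄 𝔅 i,
      Commute (μ.respMinus r) (μ.respMinus d) ∧ Commute (μ.respPlus r) (μ.respMinus d) := by
    intro d
    rw [StarSubalgebra.mem_comap, StarSubalgebra.mem_centralizer_iff]
    constructor
    · exact fun h r hr ↦ ⟨(h _ (Or.inl ⟨r, hr, rfl⟩)).1, (h _ (Or.inr ⟨r, hr, rfl⟩)).1⟩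
    · rintro h z (⟨r, hr, rfl⟩ | ⟨r, hr, rfl⟩)
      · refine ⟨(h r hr).1, ?_⟩
        rw [← map_star]
        exact (h _ (star_mem hr)).1
      · refine ⟨(h r hr).2, ?_⟩
        rw [← map_star]
        exact (h _ (star_mem hr)).2
  have hunrel : ∀ (j : Fin 2 ⊕ Fin 1) (t : ℝ), t ∉ μ.coupled.cuts j →
      ¬ S.CausalLE (γi a) (lines 𝔄 𝔅 j t) → ¬ S.CausalLE (lines 𝔄 𝔅 j t) (γi a') →
      ∀ z ∈ μ.coupled.label j t, μ.respMinus.symm z ∈ D := by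
    intro j t ht g1 g2 z hz
    obtain ⟨V, htV, hV, hVc⟩ := μ.exists_commute_respMinus hS (j := i) ha
      (y := lines 𝔄 𝔅 j t) (fun h ↦ g2 (h.trans hle)) g1
    obtain ⟨W, htW, hW, hWc⟩ := μ.exists_commute_respPlus hS (j := i) ha'
      (y := lines 𝔄 𝔅 j t) g2 (fun h ↦ g1 (hle.trans h))
    rw [hDmem]
    intro r hr
    rw [StarAlgEquiv.apply_symm_apply]
    exact ⟨hVc r hr z (μ.coupled.label_le_net ht htV hz),
      hWc r hr z (μ.coupled.label_le_net ht htW hz)⟩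
  have hgen : μ.coupled.net O ≤ (factor 𝔄 𝔅 i ⊔ D).comap μ.respMinus.symm.toStarAlgHom := by
    refine StarAlgebra.adjoin_le ?_
    rintro z ⟨j, t, ht, htO, hz⟩
    change μ.respMinus.symm z ∈ factor 𝔄 𝔅 i ⊔ D
    rcases hikb j with rfl | rfl | rfl
    · -- a small region around the point meets no worldline but `i`
      have htI := htime γi a₁ a₂ t (by simp [hX]) (by simp [hY]) htO
      have hta : t < a := htI.2.trans ha₂
      have Ht := Hi t ⟨htI.1.le, hta.le⟩
      refine le_sup_left (a := factor 𝔄 𝔅 j) ?_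
      obtain ⟨L, hLU, htL, hL⟩ := hS.1 (γi t)
        ((((S.JMinus {γb u})ᶜ ∩ (S.JPlus {γb u})ᶜ) ∩ ((S.JMinus {γk c})ᶜ ∩ (S.JPlus {γk c})ᶜ)) ∩
          S.MMinus μ.K)
        ((((Spacetime.isClosed_JMinus_singleton hS _).isOpen_compl.inter
          (Spacetime.isClosed_JPlus_singleton hS _).isOpen_compl).inter
          ((Spacetime.isClosed_JMinus_singleton hS _).isOpen_compl.inter
          (Spacetime.isClosed_JPlus_singleton hS _).isOpen_compl)).inter
          (Spacetime.isOpen_MMinus hS μ.isCompact_K) |>.mem_nhds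
          (by
            simp only [Set.mem_inter_iff, Set.mem_compl_iff, Spacetime.mem_JMinus_singleton,
              Spacetime.mem_JPlus_singleton]
            exact ⟨⟨⟨Ht.1.1, Ht.1.2⟩, Ht.2.1, Ht.2.2⟩, ha t hta⟩))
      have hzL := μ.coupled.label_le_net ht htL hz
      rw [← SetLike.mem_coe, ← μ.respMinus_image L hL (fun p hp ↦ (hLU hp).2)] at hzL
      obtain ⟨v, hv, rfl⟩ := hzL
      rw [StarAlgEquiv.symm_apply_apply]
      refine uncoupled_le_factor (fun l hl s hs ↦ ?_) hv
      have off : ∀ (γ : S.Worldline) (w : ℝ), γ s ∈ (S.JMinus {γ w})ᶜ ∩ (S.JPlus {γ w})ᶜ →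
          False := fun γ w ⟨q1, q2⟩ ↦ (le_total s w).elim
        (fun h ↦ q1 (Spacetime.mem_JMinus_singleton.2 (γ.causalLE h)))
        (fun h ↦ q2 (Spacetime.mem_JPlus_singleton.2 (γ.causalLE h)))
      rcases hikb l with rfl | rfl | rfl
      · exact hl rfl
      · exact off γk c (hLU hs).1.2
      · exact off γb u (hLU hs).1.1
    · have htI := htime γk c₁ c₂ t (by simp [hX]) (by simp [hY]) htO
      have Ht := Hk t ⟨htI.1.le, (htI.2.trans hc₂).le⟩
      exact le_sup_right (a := factor 𝔄 𝔅 i) (hunrel _ t ht Ht.1.1 Ht.1.2 z hz)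
    · have htI := htime γb u u₂ t (by simp [hX]) (by simp [hY]) htO
      have Ht := Hb t ⟨htI.1.le, htI.2.le⟩
      exact le_sup_right (a := factor 𝔄 𝔅 i) (hunrel _ t ht Ht.1 Ht.2 z hz)
  have hsup : factor 𝔄 𝔅 i ⊔ D = ⊤ := by
    refine eq_top_iff.2 fun x _ ↦ ?_
    have hx : μ.respMinus x ∈ μ.coupled.net O := htop ▸ trivial
    have := hgen hx
    change μ.respMinus.symm (μ.respMinus x) ∈ factor 𝔄 𝔅 i ⊔ D at this
    rwa [StarAlgEquiv.symm_apply_apply] at this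
  intro r hr
  refine (isFactorization_factor 𝔄 𝔅).mem_of_commute_of_sup_eq_top i (D := D) ?_ hsup ?_
  · intro z hz d hd
    have := ((hDmem d).1 hd z hz).1.map μ.respMinus.symm
    rwa [StarAlgEquiv.symm_apply_apply, StarAlgEquiv.symm_apply_apply] at this
  · intro d hd
    have := ((hDmem d).1 hd r hr).2.symm.map μ.respMinus.symm
    rwa [StarAlgEquiv.symm_apply_apply] at this

end Hausdorff

end FVMeasurement

end CouplingZone

/-! ### Causal curves in the hull of the coupling zone -/

section HullCurve

variable {E M : Type*} [NormedAddCommGroup E] [NormedSpace ℝ E]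
  [TopologicalSpace M] [ChartedSpace E M] [IsManifold 𝓘(ℝ, E) ∞ M] {S : Spacetime E M}
  {𝔄 : HybridTheory S 2} {𝔅 : HybridTheory S 1}

theorem FVMeasurement.scattering_mem_factor_of_commute (μ : FVMeasurement 𝔄 𝔅)
    {i : Fin 2 ⊕ Fin 1}
    (h : ∀ j, j ≠ i → ∀ x ∈ factor 𝔄 𝔅 j, ∀ y ∈ factor 𝔄 𝔅 i, Commute x (μ.scattering y)) :
    ∀ r ∈ factor 𝔄 𝔅 i, μ.scattering r ∈ factor 𝔄 𝔅 i :=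
  fun r hr ↦ (isFactorization_factor 𝔄 𝔅).mem_of_commute i fun j hj x hx ↦ h j hj x hx r hr

/-- If no causal curve in the hull of the coupling zone connects the worldlines of Alice and
Charlie, then the scattering morphism preserves one of their algebras. If Bob cannot signal to
Alice, this is Alice's algebra, and if he cannot signal to Charlie, it is Charlie's. Otherwise one
considers a point of Bob's worldline just after he loses the possibility to reach both. -/
theorem FVMeasurement.scattering_mem_factor [T2Space M] (hS : S.GloballyHyperbolic)
    (μ : FVMeasurement 𝔄 𝔅)
    (H : ∀ s t, lines 𝔄 𝔅 (.inl 1) s ∈ S.hull μ.K → lines 𝔄 𝔅 (.inl 0) t ∈ S.hull μ.K →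
      ¬ S.CausalLE (lines 𝔄 𝔅 (.inl 1) s) (lines 𝔄 𝔅 (.inl 0) t) ∧
      ¬ S.CausalLE (lines 𝔄 𝔅 (.inl 0) t) (lines 𝔄 𝔅 (.inl 1) s)) :
    (∀ r ∈ factor 𝔄 𝔅 (.inl 0), μ.scattering r ∈ factor 𝔄 𝔅 (.inl 0)) ∨
      ∀ r ∈ factor 𝔄 𝔅 (.inl 1), μ.scattering r ∈ factor 𝔄 𝔅 (.inl 1) := by
  have hCA := μ.commute_factor_scattering hS (i := .inl 1) (j := .inl 0) (by decide)
    fun s t hs ht ↦ (H s t hs ht).1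
  have hAC := μ.commute_factor_scattering hS (i := .inl 0) (j := .inl 1) (by decide)
    fun s t hs ht ↦ (H t s ht hs).2
  by_cases hBA : ∀ s t, lines 𝔄 𝔅 (.inr 0) s ∈ S.hull μ.K → lines 𝔄 𝔅 (.inl 0) t ∈ S.hull μ.K →
      ¬ S.CausalLE (lines 𝔄 𝔅 (.inr 0) s) (lines 𝔄 𝔅 (.inl 0) t)
  · exact Or.inl (μ.scattering_mem_factor_of_commute (forall_lines.2
      ⟨fun h ↦ absurd rfl h, fun _ ↦ hCA,
        fun _ ↦ μ.commute_factor_scattering hS (by decide) hBA⟩))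
  by_cases hBC : ∀ s t, lines 𝔄 𝔅 (.inr 0) s ∈ S.hull μ.K → lines 𝔄 𝔅 (.inl 1) t ∈ S.hull μ.K →
      ¬ S.CausalLE (lines 𝔄 𝔅 (.inr 0) s) (lines 𝔄 𝔅 (.inl 1) t)
  · exact Or.inr (μ.scattering_mem_factor_of_commute (forall_lines.2
      ⟨fun _ ↦ hAC, fun h ↦ absurd rfl h,
        fun _ ↦ μ.commute_factor_scattering hS (by decide) hBC⟩))
  push Not at hBA hBC
  obtain ⟨s₁, t₁, hs₁, ht₁, h₁⟩ := hBA
  obtain ⟨s₂, t₂, hs₂, ht₂, h₂⟩ := hBC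
  set γA := lines 𝔄 𝔅 (.inl 0) with hγA
  set γC := lines 𝔄 𝔅 (.inl 1) with hγC
  set γB := lines 𝔄 𝔅 (.inr 0) with hγB
  have hK := μ.isCompact_K
  obtain ⟨a, haK, ha⟩ := γA.exists_entry hS hK ⟨t₁, ht₁⟩
  obtain ⟨a', haK', ha'⟩ := γA.exists_exit hS hK ⟨t₁, ht₁⟩
  obtain ⟨c, hcK, hc⟩ := γC.exists_entry hS hK ⟨t₂, ht₂⟩
  obtain ⟨c', hcK', hc'⟩ := γC.exists_exit hS hK ⟨t₂, ht₂⟩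
  obtain ⟨b, hbK, hb⟩ := γB.exists_entry hS hK ⟨s₁, hs₁⟩
  set U : Set ℝ := γB ⁻¹' S.JMinus {γA a'} ∩ γB ⁻¹' S.JMinus {γC c'} with hU
  have hUmem : ∀ u, u ∈ U ↔ S.CausalLE (γB u) (γA a') ∧ S.CausalLE (γB u) (γC c') := fun u ↦ by
    simp [hU, Spacetime.mem_JMinus_singleton]
  have hUcl : IsClosed U :=
    ((Spacetime.isClosed_JMinus_singleton hS _).preimage γB.continuous).inter
      ((Spacetime.isClosed_JMinus_singleton hS _).preimage γB.continuous)
  have hbU : b ∈ U := (hUmem b).2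
    ⟨((γB.causalLE (not_lt.1 fun h ↦ hb _ h hs₁.1)).trans h₁).trans
      (γA.causalLE (not_lt.1 fun h ↦ ha' _ h ht₁.2)),
      ((γB.causalLE (not_lt.1 fun h ↦ hb _ h hs₂.1)).trans h₂).trans
      (γC.causalLE (not_lt.1 fun h ↦ hc' _ h ht₂.2))⟩
  have hUbdd : BddAbove U := by
    obtain ⟨t, ht⟩ := γB.exists_notMem_JMinus hS (isCompact_singleton (x := γA a'))
    refine ⟨t, fun u hu ↦ not_lt.1 fun h ↦ ht (Spacetime.mem_JMinus_singleton.2 ?_)⟩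
    exact (γB.causalLE h.le).trans ((hUmem u).1 hu).1
  obtain ⟨hmA, hmC⟩ := (hUmem _).1 (hUcl.csSup_mem ⟨b, hbU⟩ hUbdd)
  set m := sSup U
  have o1 := ((Spacetime.isClosed_JPlus_singleton hS (γA a)).isOpen_compl.preimage
    γB.continuous).mem_nhds (x := m) (by
      simpa [Spacetime.mem_JPlus_singleton] using fun h ↦ (H c' a hcK' haK).2 (h.trans hmC))
  have o2 := ((Spacetime.isClosed_JPlus_singleton hS (γC c)).isOpen_compl.preimage
    γB.continuous).mem_nhds (x := m) (by
      simpa [Spacetime.mem_JPlus_singleton] using fun h ↦ (H c a' hcK haK').1 (h.trans hmA))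
  obtain ⟨u, hmu, hu⟩ := exists_gt_forall_Icc (Filter.inter_mem o1 o2)
  obtain ⟨huA, huC⟩ := hu u ⟨hmu.le, le_rfl⟩
  simp only [Set.mem_preimage, Set.mem_compl_iff, Spacetime.mem_JPlus_singleton] at huA huC
  have huK : γB u ∈ S.JPlus μ.K :=
    Spacetime.JPlus_of_le hbK.1 (γB.causalLE ((le_csSup hUbdd hbU).trans hmu.le))
  have huU : u ∉ U := fun h ↦ not_lt.2 (le_csSup hUbdd h) hmu
  rw [hUmem, not_and_or] at huU
  refine huU.imp (fun h ↦ ?_) fun h ↦ ?_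
  · exact μ.scattering_mem_factor_of_slice hS (i := .inl 0) (k := .inl 1) (b := .inr 0)
      (by decide) (by decide) (by decide) haK ha ha' hc huK h huA huC (H c a hcK haK).2
      (H c a' hcK haK').1
  · exact μ.scattering_mem_factor_of_slice hS (i := .inl 1) (k := .inl 0) (b := .inr 0)
      (by decide) (by decide) (by decide) hcK hc hc' ha huK h huC huA (H c a hcK haK).1
      (H c' a hcK' haK).2

/-- If neither `ψ_BC` nor `χ_AB` decomposes, then the hull of the coupling zone contains causally
related points of the worldlines of Alice and Charlie. -/
theorem FVMeasurement.exists_causalLE_of_not_decomposes [T2Space M] (hS : S.GloballyHyperbolic)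
    (μ : FVMeasurement 𝔄 𝔅) {ψ χ} (h : HasForm μ.scattering ψ χ) (hψ : ¬ Decomposes ψ)
    (hχ : ¬ Decomposes χ) :
    ∃ s t, 𝔄.worldline 1 s ∈ S.hull μ.K ∧ 𝔄.worldline 0 t ∈ S.hull μ.K ∧
      (S.CausalLE (𝔄.worldline 1 s) (𝔄.worldline 0 t) ∨
        S.CausalLE (𝔄.worldline 0 t) (𝔄.worldline 1 s)) := by
  by_contra! hcon
  rcases μ.scattering_mem_factor hS hcon with hA | hC
  · exact (h.decomposes_of_opA fun a ↦ hA _ ⟨a, rfl⟩).elim hψ hχ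
  · exact (h.decomposes_of_opC fun c ↦ hC _ ⟨c, rfl⟩).elim hψ hχ

end HullCurve

/-! ### A sequence of two interactions -/

section Stages

theorem IsFactorization.map {N N' : Type*} [Ring N] [StarRing N] [Algebra ℂ N]
    [StarModule ℂ N] [Ring N'] [StarRing N'] [Algebra ℂ N'] [StarModule ℂ N'] {J : Type*}
    {R : J → StarSubalgebra ℂ N} (hR : IsFactorization R) (e : N ≃⋆ₐ[ℂ] N') :
    IsFactorization fun j ↦ (R j).map e.toStarAlgHom where
  matrix j := by
    obtain ⟨κ, i₁, i₂, ρ, hρ⟩ := hR.matrix j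
    refine ⟨κ, i₁, i₂, e.toStarAlgHom.comp ρ, ?_⟩
    rw [← hρ, StarAlgHom.range_eq_map_top, StarAlgHom.range_eq_map_top, StarSubalgebra.map_map]
  commute := by
    rintro i j hij _ ⟨x, hx, rfl⟩ _ ⟨y, hy, rfl⟩
    exact (hR.commute i j hij x hx y hy).map e
  iSup_eq := by
    rw [← (StarSubalgebra.gc_map_comap e.toStarAlgHom).l_iSup, hR.iSup_eq,
      ← StarAlgHom.range_eq_map_top, range_toStarAlgHom]

variable {E M : Type*} [NormedAddCommGroup E] [NormedSpace ℝ E]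
  [TopologicalSpace M] [ChartedSpace E M] [IsManifold 𝓘(ℝ, E) ∞ M] {S : Spacetime E M}
  {𝔄 : HybridTheory S 2} {𝔅 : HybridTheory S 1} (ψ : Aut (IdxBC 𝔄 𝔅)) (χ : Aut (IdxAB 𝔄 𝔅))

/-- In the coupled theory, Bob first interacts with Charlie and then with Alice. So there are three
stages: before, between, and after these interactions. The automorphism of a stage turns the
incoming observables of a worldline into its observables during this stage. -/
def stageAut : Fin 3 → Aut (𝔄.Idx × 𝔅.Idx) :=
  ![StarAlgEquiv.refl ℂ _, autBC ψ, (autAB χ).trans (autBC ψ)]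

/-- The observables of a worldline during a stage. -/
def stageFactor (σ : Fin 3) (j : Fin 2 ⊕ Fin 1) : StarSubalgebra ℂ (Op (𝔄.Idx × 𝔅.Idx)) :=
  (factor 𝔄 𝔅 j).map (stageAut ψ χ σ).toStarAlgHom

theorem isFactorization_stageFactor (σ : Fin 3) : IsFactorization (stageFactor ψ χ σ) :=
  (isFactorization_factor 𝔄 𝔅).map _

theorem stageFactor_zero (j : Fin 2 ⊕ Fin 1) : stageFactor ψ χ 0 j = factor 𝔄 𝔅 j :=
  StarSubalgebra.map_id _

/-- Alice does not take part in the first interaction. -/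
theorem stageFactor_one_alice : stageFactor ψ χ 1 (.inl 0) = stageFactor ψ χ 0 (.inl 0) := by
  rw [stageFactor_zero]
  change (opA 𝔄 𝔅).range.map (autBC ψ).toStarAlgHom = (opA 𝔄 𝔅).range
  rw [StarAlgHom.range_eq_map_top, StarSubalgebra.map_map]
  congr 1
  exact StarAlgHom.ext (autBC_opA ψ)

/-- Charlie does not take part in the second interaction. -/
theorem stageFactor_two_charlie : stageFactor ψ χ 2 (.inl 1) = stageFactor ψ χ 1 (.inl 1) := by
  change (opC 𝔄 𝔅).range.map ((autAB χ).trans (autBC ψ)).toStarAlgHom =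
    (opC 𝔄 𝔅).range.map (autBC ψ).toStarAlgHom
  rw [StarAlgHom.range_eq_map_top, StarSubalgebra.map_map, StarSubalgebra.map_map]
  congr 1
  exact StarAlgHom.ext fun c ↦ congrArg (autBC ψ) (autAB_opC χ c)

theorem map_range_of_aut {N N' : Type*} [Ring N] [StarRing N] [Algebra ℂ N]
    [StarModule ℂ N] [Ring N'] [StarRing N'] [Algebra ℂ N'] [StarModule ℂ N'] (f : N →⋆ₐ[ℂ] N')
    (e : N ≃⋆ₐ[ℂ] N) (e' : N' ≃⋆ₐ[ℂ] N') (h : ∀ x, e' (f x) = f (e x)) :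
    f.range.map e'.toStarAlgHom = f.range := by
  rw [StarAlgHom.range_eq_map_top, StarSubalgebra.map_map]
  conv_rhs => rw [← range_toStarAlgHom e, StarAlgHom.range_eq_map_top, StarSubalgebra.map_map]
  congr 1
  exact StarAlgHom.ext h

theorem stageFactor_one_sup :
    stageFactor ψ χ 1 (.inr 0) ⊔ stageFactor ψ χ 1 (.inl 1) =
      stageFactor ψ χ 0 (.inr 0) ⊔ stageFactor ψ χ 0 (.inl 1) := by
  rw [stageFactor_zero, stageFactor_zero, stageFactor, stageFactor, ← StarSubalgebra.map_sup]
  change ((opB 𝔄 𝔅).range ⊔ (opC 𝔄 𝔅).range).map (autBC ψ).toStarAlgHom =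
    (opB 𝔄 𝔅).range ⊔ (opC 𝔄 𝔅).range
  rw [← opBC_range_eq]
  exact map_range_of_aut _ ψ _ (autBC_opBC ψ)

theorem stageFactor_two_sup :
    stageFactor ψ χ 2 (.inl 0) ⊔ stageFactor ψ χ 2 (.inr 0) =
      stageFactor ψ χ 1 (.inl 0) ⊔ stageFactor ψ χ 1 (.inr 0) := by
  simp only [stageFactor, ← StarSubalgebra.map_sup]
  change ((opA 𝔄 𝔅).range ⊔ (opB 𝔄 𝔅).range).map
      ((autBC ψ).toStarAlgHom.comp (autAB χ).toStarAlgHom) =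
    ((opA 𝔄 𝔅).range ⊔ (opB 𝔄 𝔅).range).map (autBC ψ).toStarAlgHom
  rw [← opAB_range_eq, ← StarSubalgebra.map_map, map_range_of_aut _ χ _ (autAB_opAB χ)]

end Stages

/-! ### The coupled theory of two successive interactions -/

section TwoMeetings

variable {E M : Type*} [NormedAddCommGroup E] [NormedSpace ℝ E]
  [TopologicalSpace M] [ChartedSpace E M] [IsManifold 𝓘(ℝ, E) ∞ M] {S : Spacetime E M}

/-- The parameters at which Bob meets Charlie and then Alice. -/
structure Meetings (𝔄 : HybridTheory S 2) (𝔅 : HybridTheory S 1) where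
  /-- Charlie's parameter of the first meeting -/
  sC : ℝ
  /-- Alice's parameter of the second meeting -/
  sA : ℝ
  /-- Bob's parameter of the first meeting -/
  tC : ℝ
  /-- Bob's parameter of the second meeting -/
  tA : ℝ
  le : tC ≤ tA
  meet_C : 𝔄.worldline 1 sC = 𝔅.worldline 0 tC
  meet_A : 𝔄.worldline 0 sA = 𝔅.worldline 0 tA

namespace Meetings

variable {𝔄 : HybridTheory S 2} {𝔅 : HybridTheory S 1} (m : Meetings 𝔄 𝔅)

/-- The event at which Bob and Charlie meet. -/
def pC : M := 𝔅.worldline 0 m.tC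

/-- The event at which Bob and Alice meet. -/
def pA : M := 𝔅.worldline 0 m.tA

theorem pC_le_pA : S.CausalLE m.pC m.pA := (𝔅.worldline 0).causalLE m.le

/-- The closed part of a worldline that belongs to a stage. As Alice is not affected by the first
interaction, her stages `0` and `1` are the same, and similarly for Charlie's stages `1` and `2`. -/
def segment : Fin 3 → Fin 2 ⊕ Fin 1 → Set ℝ :=
  ![Sum.elim ![Set.Iic m.sA, Set.Iic m.sC] fun _ ↦ Set.Iic m.tC,
    Sum.elim ![Set.Iic m.sA, Set.Ici m.sC] fun _ ↦ Set.Icc m.tC m.tA,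
    Sum.elim ![Set.Ici m.sA, Set.Ici m.sC] fun _ ↦ Set.Ici m.tA]

theorem forall_stage {P : Fin 3 → Prop} : (∀ σ, P σ) ↔ P 0 ∧ P 1 ∧ P 2 :=
  ⟨fun h ↦ ⟨h 0, h 1, h 2⟩, fun ⟨h0, h1, h2⟩ σ ↦ by fin_cases σ <;> assumption⟩

theorem isPreconnected_segment : ∀ σ j, IsPreconnected (m.segment σ j) :=
  forall_stage.2 ⟨forall_lines.2 ⟨isPreconnected_Iic, isPreconnected_Iic, isPreconnected_Iic⟩,
    forall_lines.2 ⟨isPreconnected_Iic, isPreconnected_Ici, isPreconnected_Icc⟩,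
    forall_lines.2 ⟨isPreconnected_Ici, isPreconnected_Ici, isPreconnected_Ici⟩⟩

theorem le_pC : ∀ j : Fin 2 ⊕ Fin 1, j ≠ .inl 0 →
    ∀ t ∈ m.segment 0 j, S.CausalLE (lines 𝔄 𝔅 j t) m.pC := by
  refine forall_lines.2 ⟨fun h ↦ absurd rfl h, fun _ t ht ↦ ?_, fun _ t ht ↦ ?_⟩
  · exact ((𝔄.worldline 1).causalLE ht).trans (m.meet_C ▸ .refl _)
  · exact (𝔅.worldline 0).causalLE ht

theorem pC_le_one : ∀ j : Fin 2 ⊕ Fin 1, j ≠ .inl 0 →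
    ∀ t ∈ m.segment 1 j, S.CausalLE m.pC (lines 𝔄 𝔅 j t) := by
  refine forall_lines.2 ⟨fun h ↦ absurd rfl h, fun _ t ht ↦ ?_, fun _ t ht ↦ ?_⟩
  · exact .trans (m.meet_C ▸ .refl _) ((𝔄.worldline 1).causalLE ht)
  · exact (𝔅.worldline 0).causalLE ht.1

theorem one_le_pA : ∀ j : Fin 2 ⊕ Fin 1, j ≠ .inl 1 →
    ∀ t ∈ m.segment 1 j, S.CausalLE (lines 𝔄 𝔅 j t) m.pA := by
  refine forall_lines.2 ⟨fun _ t ht ↦ ?_, fun h ↦ absurd rfl h, fun _ t ht ↦ ?_⟩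
  · exact ((𝔄.worldline 0).causalLE ht).trans (m.meet_A ▸ .refl _)
  · exact (𝔅.worldline 0).causalLE ht.2

theorem pA_le : ∀ j : Fin 2 ⊕ Fin 1, j ≠ .inl 1 →
    ∀ t ∈ m.segment 2 j, S.CausalLE m.pA (lines 𝔄 𝔅 j t) := by
  refine forall_lines.2 ⟨fun _ t ht ↦ ?_, fun h ↦ absurd rfl h, fun _ t ht ↦ ?_⟩
  · exact .trans (m.meet_A ▸ .refl _) ((𝔄.worldline 0).causalLE ht)
  · exact (𝔅.worldline 0).causalLE ht

theorem zero_le_pA (j : Fin 2 ⊕ Fin 1) :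
    ∀ t ∈ m.segment 0 j, S.CausalLE (lines 𝔄 𝔅 j t) m.pA := by
  by_cases hj : j = .inl 0
  · subst hj
    exact m.one_le_pA (.inl 0) (by decide)
  · exact fun t ht ↦ (m.le_pC j hj t ht).trans m.pC_le_pA

theorem pC_le_two (j : Fin 2 ⊕ Fin 1) :
    ∀ t ∈ m.segment 2 j, S.CausalLE m.pC (lines 𝔄 𝔅 j t) := by
  by_cases hj : j = .inl 1
  · subst hj
    exact m.pC_le_one (.inl 1) (by decide)
  · exact fun t ht ↦ m.pC_le_pA.trans (m.pA_le j hj t ht)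

/-- The parameters at which the worldlines are cut. -/
def cuts : Fin 2 ⊕ Fin 1 → Finset ℝ := Sum.elim ![{m.sA}, {m.sC}] fun _ ↦ {m.tC, m.tA}

/-- The stage to which the parameter `t` of the worldline `j` belongs. -/
def stageAt (j : Fin 2 ⊕ Fin 1) (t : ℝ) : Fin 3 :=
  Sum.elim ![if t < m.sA then 0 else 2, if t < m.sC then 0 else 2]
    (fun _ ↦ if t < m.tC then 0 else if t < m.tA then 1 else 2) j

theorem mem_segment_stageAt : ∀ j t, t ∈ m.segment (m.stageAt j t) j := by
  refine forall_lines.2 ⟨fun t ↦ ?_, fun t ↦ ?_, fun t ↦ ?_⟩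
  · change t ∈ m.segment (if t < m.sA then 0 else 2) _
    split_ifs with h
    exacts [h.le, not_lt.1 h]
  · change t ∈ m.segment (if t < m.sC then 0 else 2) _
    split_ifs with h
    exacts [h.le, not_lt.1 h]
  · change t ∈ m.segment (if t < m.tC then 0 else if t < m.tA then 1 else 2) _
    split_ifs with h h'
    exacts [h.le, ⟨not_lt.1 h, h'.le⟩, not_lt.1 h']

variable (ψ : Aut (IdxBC 𝔄 𝔅)) (χ : Aut (IdxAB 𝔄 𝔅))

theorem stageFactor_stageAt : ∀ σ j, ∀ t ∈ m.segment σ j, t ∉ m.cuts j →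
    stageFactor ψ χ (m.stageAt j t) j = stageFactor ψ χ σ j := by
  have hA := stageFactor_one_alice ψ χ
  have hC := stageFactor_two_charlie ψ χ
  have eA : ∀ t, m.stageAt (.inl 0) t = if t < m.sA then 0 else 2 := fun _ ↦ rfl
  have eC : ∀ t, m.stageAt (.inl 1) t = if t < m.sC then 0 else 2 := fun _ ↦ rfl
  have eB : ∀ t, m.stageAt (.inr 0) t = if t < m.tC then 0 else if t < m.tA then 1 else 2 :=
    fun _ ↦ rfl
  have nA : ∀ t, t ∉ m.cuts (.inl 0) → t ≠ m.sA := fun t h ↦ by simpa [cuts] using h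
  have nC : ∀ t, t ∉ m.cuts (.inl 1) → t ≠ m.sC := fun t h ↦ by simpa [cuts] using h
  have nB : ∀ t, t ∉ m.cuts (.inr 0) → t ≠ m.tC ∧ t ≠ m.tA := fun t h ↦ by simpa [cuts] using h
  have hle := m.le
  refine forall_stage.2 ⟨forall_lines.2 ⟨fun t ht hc ↦ ?_, fun t ht hc ↦ ?_, fun t ht hc ↦ ?_⟩,
    forall_lines.2 ⟨fun t ht hc ↦ ?_, fun t ht hc ↦ ?_, fun t ht hc ↦ ?_⟩,
    forall_lines.2 ⟨fun t ht hc ↦ ?_, fun t ht hc ↦ ?_, fun t ht hc ↦ ?_⟩⟩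
  · rw [eA, if_pos (ht.lt_of_ne (nA t hc))]
  · rw [eC, if_pos (ht.lt_of_ne (nC t hc))]
  · rw [eB, if_pos (ht.lt_of_ne (nB t hc).1)]
  · rw [eA, if_pos (ht.lt_of_ne (nA t hc)), hA]
  · rw [eC, if_neg (not_lt.2 ht), hC]
  · rw [eB, if_neg (not_lt.2 ht.1), if_pos (ht.2.lt_of_ne (nB t hc).2)]
  · rw [eA, if_neg (not_lt.2 ht)]
  · rw [eC, if_neg (not_lt.2 ht)]
  · rw [eB, if_neg (not_lt.2 (hle.trans ht)), if_neg (not_lt.2 ht)]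

/-- The coupled theory: away from the meetings, each worldline carries its observables of the
present stage. -/
def coupled : SegmentedTheory (lines 𝔄 𝔅) (Op (𝔄.Idx × 𝔅.Idx)) where
  cuts := m.cuts
  label j t := stageFactor ψ χ (m.stageAt j t) j
  label_eq := by
    have key : ∀ {c s t : ℝ}, s ≤ t → c ∉ Set.Icc s t → (s < c ↔ t < c) := fun hst hc ↦
      ⟨fun h ↦ not_le.1 fun h' ↦ hc ⟨h.le, h'⟩, fun h ↦ hst.trans_lt h⟩
    suffices ∀ j s t, s ≤ t → (∀ b ∈ m.cuts j, b ∉ Set.Icc s t) →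
        m.stageAt j s = m.stageAt j t from fun j s t hst h ↦ by rw [this j s t hst h]
    refine forall_lines.2 ⟨fun s t hst h ↦ ?_, fun s t hst h ↦ ?_, fun s t hst h ↦ ?_⟩
    · change (if s < m.sA then (0 : Fin 3) else 2) = if t < m.sA then 0 else 2
      simp only [key hst (h m.sA (by simp [cuts]))]
    · change (if s < m.sC then (0 : Fin 3) else 2) = if t < m.sC then 0 else 2
      simp only [key hst (h m.sC (by simp [cuts]))]
    · change (if s < m.tC then (0 : Fin 3) else if s < m.tA then 1 else 2) =
        if t < m.tC then 0 else if t < m.tA then 1 else 2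
      simp only [key hst (h m.tC (by simp [cuts])), key hst (h m.tA (by simp [cuts]))]

theorem net_le {O : Set M} {R : StarSubalgebra ℂ (Op (𝔄.Idx × 𝔅.Idx))}
    (h : ∀ σ j, ∀ t ∈ m.segment σ j, lines 𝔄 𝔅 j t ∈ O → stageFactor ψ χ σ j ≤ R) :
    (m.coupled ψ χ).net O ≤ R := by
  refine StarAlgebra.adjoin_le ?_
  rintro x ⟨j, t, -, htO, hx⟩
  exact h _ j t (m.mem_segment_stageAt j t) htO hx

theorem net_mono {O O' : Set M} (h : O ⊆ O') :
    (m.coupled ψ χ).net O ≤ (m.coupled ψ χ).net O' :=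
  StarAlgebra.adjoin_mono fun _ ⟨j, t, ht, htO, hx⟩ ↦ ⟨j, t, ht, h htO, hx⟩

theorem segment_subset_closure (σ : Fin 3) (j : Fin 2 ⊕ Fin 1)
    (hne : ¬ (σ = 1 ∧ j = .inr 0 ∧ m.tC = m.tA)) :
    m.segment σ j ⊆ closure (m.segment σ j \ m.cuts j) := by
  have hle := m.le
  have nA : ∀ t, t ≠ m.sA → t ∉ (m.cuts (.inl 0) : Set ℝ) := fun t h ↦ by simpa [cuts] using h
  have nC : ∀ t, t ≠ m.sC → t ∉ (m.cuts (.inl 1) : Set ℝ) := fun t h ↦ by simpa [cuts] using h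
  have nB : ∀ t, t ≠ m.tC → t ≠ m.tA → t ∉ (m.cuts (.inr 0) : Set ℝ) := fun t h h' ↦ by
    simpa [cuts] using ⟨h, h'⟩
  have kIic : ∀ {c : ℝ} {s : Finset ℝ}, (∀ t < c, t ∉ (s : Set ℝ)) →
      Set.Iic c ⊆ closure (Set.Iic c \ s) := fun {c s} h ↦
    (closure_Iio c).ge.trans (closure_mono fun t (ht : _ < _) ↦ ⟨ht.le, h t ht⟩)
  have kIci : ∀ {c : ℝ} {s : Finset ℝ}, (∀ t > c, t ∉ (s : Set ℝ)) →
      Set.Ici c ⊆ closure (Set.Ici c \ s) := fun {c s} h ↦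
    (closure_Ioi c).ge.trans (closure_mono fun t (ht : _ < _) ↦ ⟨ht.le, h t ht⟩)
  revert σ j
  refine forall_stage.2 ⟨forall_lines.2 ⟨fun _ ↦ ?_, fun _ ↦ ?_, fun _ ↦ ?_⟩,
    forall_lines.2 ⟨fun _ ↦ ?_, fun _ ↦ ?_, fun h ↦ ?_⟩,
    forall_lines.2 ⟨fun _ ↦ ?_, fun _ ↦ ?_, fun _ ↦ ?_⟩⟩
  · exact kIic fun t ht ↦ nA t ht.ne
  · exact kIic fun t ht ↦ nC t ht.ne
  · exact kIic fun t ht ↦ nB t ht.ne (ht.trans_le hle).ne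
  · exact kIic fun t ht ↦ nA t ht.ne
  · exact kIci fun t ht ↦ nC t ht.ne'
  · have hlt : m.tC ≠ m.tA := fun h' ↦ h ⟨rfl, rfl, h'⟩
    exact (closure_Ioo hlt).ge.trans (closure_mono fun t ht ↦
      ⟨⟨ht.1.le, ht.2.le⟩, nB t ht.1.ne' ht.2.ne⟩)
  · exact kIci fun t ht ↦ nA t ht.ne'
  · exact kIci fun t ht ↦ nC t ht.ne'
  · exact kIci fun t ht ↦ nB t (hle.trans_lt ht).ne' ht.ne'

theorem stageFactor_le_net {O : Set M} (hO : IsOpen O) {σ : Fin 3} {j : Fin 2 ⊕ Fin 1} {t : ℝ}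
    (ht : t ∈ m.segment σ j) (htO : lines 𝔄 𝔅 j t ∈ O) :
    stageFactor ψ χ σ j ≤ (m.coupled ψ χ).net O := by
  have key : ∀ {σ j t}, ¬ (σ = 1 ∧ j = .inr 0 ∧ m.tC = m.tA) → t ∈ m.segment σ j →
      lines 𝔄 𝔅 j t ∈ O → stageFactor ψ χ σ j ≤ (m.coupled ψ χ).net O := by
    intro σ j t hne ht htO
    obtain ⟨t', ht'O, ht', hc⟩ := mem_closure_iff_nhds.1 (m.segment_subset_closure σ j hne ht) _
      ((lines 𝔄 𝔅 j).continuous.continuousAt.preimage_mem_nhds (hO.mem_nhds htO))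
    rw [← m.stageFactor_stageAt ψ χ σ j t' ht' hc]
    exact (m.coupled ψ χ).label_le_net hc ht'O
  by_cases hne : σ = 1 ∧ j = .inr 0 ∧ m.tC = m.tA
  · -- both meetings are at the same event, and `O` contains it; so `O` meets the stage `0` of all
    -- three worldlines
    obtain ⟨rfl, rfl, heq⟩ := hne
    obtain rfl : t = m.tC := le_antisymm (heq ▸ ht.2) ht.1
    have h0 : ∀ j, stageFactor ψ χ 0 j ≤ (m.coupled ψ χ).net O := forall_lines.2
      ⟨key (t := m.sA) (by simp) (Set.mem_Iic.2 le_rfl) (by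
        change 𝔄.worldline 0 m.sA ∈ O
        rw [m.meet_A, ← heq]
        exact htO),
        key (t := m.sC) (by simp) (Set.mem_Iic.2 le_rfl) (by
        change 𝔄.worldline 1 m.sC ∈ O
        rw [m.meet_C]
        exact htO), key (t := m.tC) (by simp) (Set.mem_Iic.2 le_rfl) htO⟩
    have := iSup_le h0
    rw [(isFactorization_stageFactor ψ χ 0).iSup_eq] at this
    exact le_top.trans this
  · exact key hne ht htO

end Meetings

end TwoMeetings

/-! ### The axioms for the coupled theory -/

section CoupledAxioms

variable {E M : Type*} [NormedAddCommGroup E] [NormedSpace ℝ E]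
  [TopologicalSpace M] [ChartedSpace E M] [IsManifold 𝓘(ℝ, E) ∞ M] {S : Spacetime E M}

namespace Meetings

variable {𝔄 : HybridTheory S 2} {𝔅 : HybridTheory S 1} (m : Meetings 𝔄 𝔅)
  (ψ : Aut (IdxBC 𝔄 𝔅)) (χ : Aut (IdxAB 𝔄 𝔅))

/-- Segments that are causally unrelated belong to a common stage. -/
theorem exists_stage {σ σ' : Fin 3} (hσ : σ < σ') {j j' : Fin 2 ⊕ Fin 1} {t t' : ℝ}
    (ht : t ∈ m.segment σ j) (ht' : t' ∈ m.segment σ' j')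
    (hle : ¬ S.CausalLE (lines 𝔄 𝔅 j t) (lines 𝔄 𝔅 j' t')) :
    ∃ ρ, stageFactor ψ χ σ j = stageFactor ψ χ ρ j ∧
      stageFactor ψ χ σ' j' = stageFactor ψ χ ρ j' := by
  have hA := stageFactor_one_alice ψ χ
  have hC := stageFactor_two_charlie ψ χ
  have hcases : (σ = 0 ∧ σ' = 1) ∨ (σ = 1 ∧ σ' = 2) ∨ (σ = 0 ∧ σ' = 2) := by
    clear ht ht'
    revert σ σ'
    decide
  rcases hcases with ⟨rfl, rfl⟩ | ⟨rfl, rfl⟩ | ⟨rfl, rfl⟩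
  · by_cases hj : j = .inl 0
    · subst hj; exact ⟨1, hA.symm, rfl⟩
    by_cases hj' : j' = .inl 0
    · subst hj'; exact ⟨0, rfl, hA⟩
    exact absurd ((m.le_pC j hj t ht).trans (m.pC_le_one j' hj' t' ht')) hle
  · by_cases hj : j = .inl 1
    · subst hj; exact ⟨2, hC.symm, rfl⟩
    by_cases hj' : j' = .inl 1
    · subst hj'; exact ⟨1, rfl, hC⟩
    exact absurd ((m.one_le_pA j hj t ht).trans (m.pA_le j' hj' t' ht')) hle
  · by_cases hj : j = .inl 0
    · by_cases hj' : j' = .inl 1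
      · subst hj hj'; exact ⟨1, hA.symm, hC⟩
      · exact absurd ((m.zero_le_pA j t ht).trans (m.pA_le j' hj' t' ht')) hle
    · exact absurd ((m.le_pC j hj t ht).trans (m.pC_le_two j' t' ht')) hle

theorem einstein {O₁ O₂ : Set M} (hd : S.CausallyDisjoint O₁ O₂) :
    ∀ a ∈ (m.coupled ψ χ).net O₁, ∀ b ∈ (m.coupled ψ χ).net O₂, Commute a b := by
  have hun : ∀ p ∈ O₁, ∀ q ∈ O₂, ¬ S.CausalLE p q ∧ ¬ S.CausalLE q p := fun p hp q hq ↦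
    ⟨fun h ↦ hd hp (Or.inr ⟨q, hq, h⟩), fun h ↦ hd hp (Or.inl ⟨q, hq, h⟩)⟩
  have key : ∀ {σ σ' j j' t t'}, t ∈ m.segment σ j → lines 𝔄 𝔅 j t ∈ O₁ →
      t' ∈ m.segment σ' j' → lines 𝔄 𝔅 j' t' ∈ O₂ → ∀ x ∈ stageFactor ψ χ σ j,
      ∀ y ∈ stageFactor ψ χ σ' j', Commute x y := by
    intro σ σ' j j' t t' ht hO ht' hO' x hx y hy
    obtain ⟨h1, h2⟩ := hun _ hO _ hO'
    have hjj' : j ≠ j' := by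
      rintro rfl
      exact (le_total t t').elim (fun h ↦ h1 ((lines 𝔄 𝔅 j).causalLE h))
        fun h ↦ h2 ((lines 𝔄 𝔅 j).causalLE h)
    have hρ : ∃ ρ, stageFactor ψ χ σ j = stageFactor ψ χ ρ j ∧
        stageFactor ψ χ σ' j' = stageFactor ψ χ ρ j' := by
      rcases lt_trichotomy σ σ' with hσ | rfl | hσ
      · exact m.exists_stage ψ χ hσ ht ht' h1
      · exact ⟨σ, rfl, rfl⟩
      · obtain ⟨ρ, e1, e2⟩ := m.exists_stage ψ χ hσ ht' ht h2
        exact ⟨ρ, e2, e1⟩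
    obtain ⟨ρ, e1, e2⟩ := hρ
    exact (isFactorization_stageFactor ψ χ ρ).commute j j' hjj' x (e1 ▸ hx) y (e2 ▸ hy)
  rw [← le_centralizer_iff]
  refine m.net_le ψ χ fun σ j t ht hO ↦ ?_
  rw [le_centralizer_iff]
  intro x hx y hy
  suffices h : (m.coupled ψ χ).net O₂ ≤
      StarSubalgebra.centralizer ℂ (stageFactor ψ χ σ j : Set _) from
    (le_centralizer_iff.1 h y hy x hx).symm
  refine m.net_le ψ χ fun σ' j' t' ht' hO' ↦ le_centralizer_iff.2 fun y hy x hx ↦ ?_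
  exact (key ht hO ht' hO' x hx y hy).symm

/-- A worldline in `D⁺(O)` is followed into the past until it meets `O` or its stage begins; in the
latter case the meeting at which the stage begins is in `D⁺(O)`, so both participants are in `D⁺(O)`
at the end of the previous stage, and together their algebras are the same in both stages. -/
theorem stageFactor_le_net_of_mem_DPlus {O : Set M} (hO : IsOpen O) : ∀ σ j, ∀ t ∈ m.segment σ j,
    lines 𝔄 𝔅 j t ∈ S.DPlus O → stageFactor ψ χ σ j ≤ (m.coupled ψ χ).net O := by
  have hC := stageFactor_two_charlie ψ χ
  have eA : lines 𝔄 𝔅 (.inl 0) m.sA = m.pA := m.meet_A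
  have eC : lines 𝔄 𝔅 (.inl 1) m.sC = m.pC := m.meet_C
  -- segments without a lower end
  have early : ∀ {σ j} (c : ℝ), m.segment σ j = Set.Iic c → ∀ t ∈ m.segment σ j,
      lines 𝔄 𝔅 j t ∈ S.DPlus O → stageFactor ψ χ σ j ≤ (m.coupled ψ χ).net O := by
    intro σ j c hc t ht hD
    obtain ⟨u, hu, huO⟩ := (lines 𝔄 𝔅 j).exists_le_mem_of_mem_DPlus hD
    rw [hc] at ht
    exact m.stageFactor_le_net ψ χ hO (hc ▸ Set.mem_Iic.2 (hu.trans ht)) huO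
  -- segments with the lower end `c`
  have late : ∀ {σ j} (c : ℝ), (∀ t ∈ m.segment σ j, c ≤ t ∧ Set.Icc c t ⊆ m.segment σ j) →
      (lines 𝔄 𝔅 j c ∈ S.DPlus O → stageFactor ψ χ σ j ≤ (m.coupled ψ χ).net O) →
      ∀ t ∈ m.segment σ j,
      lines 𝔄 𝔅 j t ∈ S.DPlus O → stageFactor ψ χ σ j ≤ (m.coupled ψ χ).net O := by
    intro σ j c hc h t ht hD
    rcases (lines 𝔄 𝔅 j).mem_DPlus_of_le (hc t ht).1 hD with ⟨u, hu, huO⟩ | hD'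
    · exact m.stageFactor_le_net ψ χ hO ((hc t ht).2 hu) huO
    · exact h hD'
  have hpC : m.pC ∈ S.DPlus O → stageFactor ψ χ 1 (.inr 0) ⊔ stageFactor ψ χ 1 (.inl 1) ≤
      (m.coupled ψ χ).net O := fun h ↦ by
    rw [stageFactor_one_sup]
    refine sup_le (early (j := .inr 0) m.tC rfl m.tC Set.self_mem_Iic h)
      (early (j := .inl 1) m.sC rfl m.sC Set.self_mem_Iic (eC ▸ h))
  have h1B : ∀ t ∈ m.segment 1 (.inr 0), lines 𝔄 𝔅 (.inr 0) t ∈ S.DPlus O →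
      stageFactor ψ χ 1 (.inr 0) ≤ (m.coupled ψ χ).net O :=
    late m.tC (fun t ht ↦ ⟨ht.1, Set.Icc_subset_Icc_right ht.2⟩) fun h ↦ le_sup_left.trans (hpC h)
  have h1C : ∀ t ∈ m.segment 1 (.inl 1), lines 𝔄 𝔅 (.inl 1) t ∈ S.DPlus O →
      stageFactor ψ χ 1 (.inl 1) ≤ (m.coupled ψ χ).net O :=
    late m.sC (fun t ht ↦ ⟨ht, Set.Icc_subset_Ici_self⟩) fun h ↦
      le_sup_right.trans (hpC (eC ▸ h))
  have hpA : m.pA ∈ S.DPlus O → stageFactor ψ χ 2 (.inl 0) ⊔ stageFactor ψ χ 2 (.inr 0) ≤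
      (m.coupled ψ χ).net O := fun h ↦ by
    rw [stageFactor_two_sup]
    refine sup_le (early (j := .inl 0) m.sA rfl m.sA Set.self_mem_Iic (eA ▸ h))
      (h1B m.tA ⟨m.le, le_rfl⟩ h)
  refine forall_stage.2 ⟨forall_lines.2 ⟨early _ rfl, early _ rfl, early _ rfl⟩,
    forall_lines.2 ⟨early _ rfl, h1C, h1B⟩, forall_lines.2 ⟨?_, ?_, ?_⟩⟩
  · exact late m.sA (fun t ht ↦ ⟨ht, Set.Icc_subset_Ici_self⟩) fun h ↦
      le_sup_left.trans (hpA (eA ▸ h))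
  · rw [hC]
    exact h1C
  · exact late m.tA (fun t ht ↦ ⟨ht, Set.Icc_subset_Ici_self⟩) fun h ↦
      le_sup_right.trans (hpA h)

theorem stageFactor_le_net_of_mem_DMinus {O : Set M} (hO : IsOpen O) : ∀ σ j, ∀ t ∈ m.segment σ j,
    lines 𝔄 𝔅 j t ∈ S.DMinus O → stageFactor ψ χ σ j ≤ (m.coupled ψ χ).net O := by
  have hA := stageFactor_one_alice ψ χ
  have eA : lines 𝔄 𝔅 (.inl 0) m.sA = m.pA := m.meet_A
  have eC : lines 𝔄 𝔅 (.inl 1) m.sC = m.pC := m.meet_C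
  -- segments without an upper end
  have late : ∀ {σ j} (c : ℝ), m.segment σ j = Set.Ici c → ∀ t ∈ m.segment σ j,
      lines 𝔄 𝔅 j t ∈ S.DMinus O → stageFactor ψ χ σ j ≤ (m.coupled ψ χ).net O := by
    intro σ j c hc t ht hD
    obtain ⟨u, hu, huO⟩ := (lines 𝔄 𝔅 j).exists_ge_mem_of_mem_DMinus hD
    rw [hc] at ht
    exact m.stageFactor_le_net ψ χ hO (hc ▸ Set.mem_Ici.2 (le_trans ht hu)) huO
  -- segments with the upper end `c`
  have early : ∀ {σ j} (c : ℝ), (∀ t ∈ m.segment σ j, t ≤ c ∧ Set.Icc t c ⊆ m.segment σ j) →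
      (lines 𝔄 𝔅 j c ∈ S.DMinus O → stageFactor ψ χ σ j ≤ (m.coupled ψ χ).net O) →
      ∀ t ∈ m.segment σ j,
      lines 𝔄 𝔅 j t ∈ S.DMinus O → stageFactor ψ χ σ j ≤ (m.coupled ψ χ).net O := by
    intro σ j c hc h t ht hD
    rcases (lines 𝔄 𝔅 j).mem_DMinus_of_le (hc t ht).1 hD with ⟨u, hu, huO⟩ | hD'
    · exact m.stageFactor_le_net ψ χ hO ((hc t ht).2 hu) huO
    · exact h hD'
  have hpA : m.pA ∈ S.DMinus O → stageFactor ψ χ 1 (.inl 0) ⊔ stageFactor ψ χ 1 (.inr 0) ≤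
      (m.coupled ψ χ).net O := fun h ↦ by
    rw [← stageFactor_two_sup]
    refine sup_le (late (j := .inl 0) m.sA rfl m.sA Set.self_mem_Ici (eA ▸ h))
      (late (j := .inr 0) m.tA rfl m.tA Set.self_mem_Ici h)
  have h1A : ∀ t ∈ m.segment 1 (.inl 0), lines 𝔄 𝔅 (.inl 0) t ∈ S.DMinus O →
      stageFactor ψ χ 1 (.inl 0) ≤ (m.coupled ψ χ).net O :=
    early m.sA (fun t ht ↦ ⟨ht, Set.Icc_subset_Iic_self⟩) fun h ↦
      le_sup_left.trans (hpA (eA ▸ h))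
  have h1B : ∀ t ∈ m.segment 1 (.inr 0), lines 𝔄 𝔅 (.inr 0) t ∈ S.DMinus O →
      stageFactor ψ χ 1 (.inr 0) ≤ (m.coupled ψ χ).net O :=
    early m.tA (fun t ht ↦ ⟨ht.2, Set.Icc_subset_Icc_left ht.1⟩) fun h ↦ le_sup_right.trans (hpA h)
  have hpC : m.pC ∈ S.DMinus O → stageFactor ψ χ 0 (.inr 0) ⊔ stageFactor ψ χ 0 (.inl 1) ≤
      (m.coupled ψ χ).net O := fun h ↦ by
    rw [← stageFactor_one_sup]
    refine sup_le (h1B m.tC ⟨le_rfl, m.le⟩ h)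
      (late (j := .inl 1) m.sC rfl m.sC Set.self_mem_Ici (eC ▸ h))
  refine forall_stage.2 ⟨forall_lines.2 ⟨?_, ?_, ?_⟩,
    forall_lines.2 ⟨h1A, late _ rfl, h1B⟩,
    forall_lines.2 ⟨late _ rfl, late _ rfl, late _ rfl⟩⟩
  · rw [← hA]
    exact h1A
  · exact early m.sC (fun t ht ↦ ⟨ht, Set.Icc_subset_Iic_self⟩) fun h ↦
      le_sup_right.trans (hpC (eC ▸ h))
  · exact early m.tC (fun t ht ↦ ⟨ht, Set.Icc_subset_Iic_self⟩) fun h ↦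
      le_sup_left.trans (hpC h)

theorem segment_zero_nonempty : ∀ j, (m.segment 0 j).Nonempty :=
  forall_lines.2 ⟨Set.nonempty_Iic, Set.nonempty_Iic, Set.nonempty_Iic⟩

theorem isAQFT_coupled : IsAQFT S (m.coupled ψ χ).net where
  global := by
    rw [← top_le_iff, ← (isFactorization_stageFactor ψ χ 0).iSup_eq]
    refine iSup_le fun j ↦ ?_
    obtain ⟨t, ht⟩ := m.segment_zero_nonempty j
    exact m.stageFactor_le_net ψ χ isOpen_univ ht trivial
  isotony _ _ _ _ h := m.net_mono ψ χ h
  einstein _ _ _ _ h := m.einstein ψ χ h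
  diamond O O' hO _ h := m.net_le ψ χ fun σ j t ht hO' ↦ (h hO').elim
    (m.stageFactor_le_net_of_mem_DPlus ψ χ hO.1 σ j t ht)
    (m.stageFactor_le_net_of_mem_DMinus ψ χ hO.1 σ j t ht)

/-- If a worldline meets neither the causal complement of `K` nor its hull during a given stage,
then this stage of it lies entirely to the future or entirely to the past of `K`. Neither is
possible for the last stage which begins in the past of `K`, where the first stage counts as
beginning there. An operator that commutes with the algebra of the causal complement of `K`
commutes with the factors of this stage whose worldlines meet the complement, so it lies in the
product of the other factors, whose worldlines meet the hull of `K`. -/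
theorem haagProperty_coupled [T2Space M] (hS : S.GloballyHyperbolic) :
    HaagProperty S (m.coupled ψ χ).net := by
  intro K hK a ha L hL _ hKL
  obtain ⟨σ, hσ⟩ : ∃ σ, ∀ j, (∃ t ∈ m.segment σ j, lines 𝔄 𝔅 j t ∈ S.hull K) ∨
      ∃ t ∈ m.segment σ j, lines 𝔄 𝔅 j t ∈ S.perp K := by
    suffices h : ∃ σ, ∀ j,
        (∃ t ∈ m.segment σ j, lines 𝔄 𝔅 j t ∈ S.JMinus K ∨ lines 𝔄 𝔅 j t ∉ S.JPlus K) ∧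
        ∃ t ∈ m.segment σ j, lines 𝔄 𝔅 j t ∈ S.JPlus K ∨ lines 𝔄 𝔅 j t ∉ S.JMinus K from
      h.imp fun σ hσ j ↦ (lines 𝔄 𝔅 j).exists_mem_hull_or_perp hS hK
        (m.isPreconnected_segment σ j) (hσ j).1 (hσ j).2
    have low : ∀ j (c : ℝ), ∃ t ∈ Set.Iic c,
        lines 𝔄 𝔅 j t ∈ S.JMinus K ∨ lines 𝔄 𝔅 j t ∉ S.JPlus K := fun j c ↦ by
      obtain ⟨t, ht⟩ := (lines 𝔄 𝔅 j).exists_notMem_JPlus hS hK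
      exact ⟨min t c, Set.mem_Iic.2 (min_le_right _ _), Or.inr fun h ↦
        ht (Spacetime.JPlus_of_le h ((lines 𝔄 𝔅 j).causalLE (min_le_left _ _)))⟩
    have up : ∀ j (c : ℝ), ∃ t ∈ Set.Ici c,
        lines 𝔄 𝔅 j t ∈ S.JPlus K ∨ lines 𝔄 𝔅 j t ∉ S.JMinus K := fun j c ↦ by
      obtain ⟨t, ht⟩ := (lines 𝔄 𝔅 j).exists_notMem_JMinus hS hK
      exact ⟨max t c, Set.mem_Ici.2 (le_max_right _ _), Or.inr fun h ↦
        ht (Spacetime.JMinus_of_le h ((lines 𝔄 𝔅 j).causalLE (le_max_left _ _)))⟩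
    have eA : lines 𝔄 𝔅 (.inl 0) m.sA = m.pA := m.meet_A
    have eC : lines 𝔄 𝔅 (.inl 1) m.sC = m.pC := m.meet_C
    by_cases hA : m.pA ∈ S.JMinus K
    · have hC := Spacetime.JMinus_of_le hA m.pC_le_pA
      exact ⟨2, forall_lines.2
        ⟨⟨⟨m.sA, Set.self_mem_Ici, Or.inl (eA ▸ hA)⟩, up _ _⟩,
        ⟨⟨m.sC, Set.self_mem_Ici, Or.inl (eC ▸ hC)⟩, up _ _⟩,
        ⟨⟨m.tA, Set.self_mem_Ici, Or.inl hA⟩, up _ _⟩⟩⟩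
    by_cases hC : m.pC ∈ S.JMinus K
    · exact ⟨1, forall_lines.2
        ⟨⟨low _ _, ⟨m.sA, Set.self_mem_Iic, Or.inr (eA ▸ hA)⟩⟩,
        ⟨⟨m.sC, Set.self_mem_Ici, Or.inl (eC ▸ hC)⟩, up _ _⟩,
        ⟨⟨m.tC, ⟨le_rfl, m.le⟩, Or.inl hC⟩, ⟨m.tA, ⟨m.le, le_rfl⟩, Or.inr hA⟩⟩⟩⟩
    · exact ⟨0, forall_lines.2
        ⟨⟨low _ _, ⟨m.sA, Set.self_mem_Iic, Or.inr (eA ▸ hA)⟩⟩,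
        ⟨low _ _, ⟨m.sC, Set.self_mem_Iic, Or.inr (eC ▸ hC)⟩⟩,
        ⟨low _ _, ⟨m.tC, Set.self_mem_Iic, Or.inr hC⟩⟩⟩⟩
  have h1 := (isFactorization_stageFactor ψ χ σ).mem_iSup_of_commute
    {j | ∃ t ∈ m.segment σ j, lines 𝔄 𝔅 j t ∈ S.perp K} (x := a) fun j ⟨t, ht, htK⟩ z hz ↦
      (ha z (m.stageFactor_le_net ψ χ (Spacetime.isOpen_perp hS hK) ht htK hz)).symm
  refine (iSup_le fun j ↦ iSup_le fun hj ↦ ?_ : _ ≤ (m.coupled ψ χ).net L) h1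
  obtain ⟨t, ht, htK⟩ := (hσ j).resolve_right hj
  exact m.stageFactor_le_net ψ χ hL.1 ht (hL.hull_subset hKL htK)

end Meetings

end CoupledAxioms

/-! ### The measurement with two successive interactions -/

section MeetingsMeasurement

variable {E M : Type*} [NormedAddCommGroup E] [NormedSpace ℝ E]
  [TopologicalSpace M] [ChartedSpace E M] [IsManifold 𝓘(ℝ, E) ∞ M] {S : Spacetime E M}

namespace Meetings

variable {𝔄 : HybridTheory S 2} {𝔅 : HybridTheory S 1} (m : Meetings 𝔄 𝔅)
  (ψ : Aut (IdxBC 𝔄 𝔅)) (χ : Aut (IdxAB 𝔄 𝔅))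

/-- Bob's worldline between the two meetings. -/
def zone : Set M := 𝔅.worldline 0 '' Set.Icc m.tC m.tA

theorem pC_mem_zone : m.pC ∈ m.zone := ⟨m.tC, ⟨le_rfl, m.le⟩, rfl⟩

theorem pA_mem_zone : m.pA ∈ m.zone := ⟨m.tA, ⟨m.le, le_rfl⟩, rfl⟩

theorem mem_JPlus_of_pC_le {x : M} (h : S.CausalLE m.pC x) : x ∈ S.JPlus m.zone :=
  ⟨_, m.pC_mem_zone, h⟩

theorem mem_JMinus_of_le_pA {x : M} (h : S.CausalLE x m.pA) : x ∈ S.JMinus m.zone :=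
  ⟨_, m.pA_mem_zone, h⟩

theorem zone_notMem_perp (j : Fin 2 ⊕ Fin 1) (t : ℝ) : lines 𝔄 𝔅 j t ∉ S.perp m.zone := by
  rw [Spacetime.mem_perp]
  rintro ⟨h1, h2⟩
  have ht := m.mem_segment_stageAt j t
  generalize m.stageAt j t = σ at ht
  revert ht
  refine (forall_stage (P := fun σ ↦ t ∈ m.segment σ j → False)).2
    ⟨fun h ↦ ?_, fun h ↦ ?_, fun h ↦ ?_⟩ σ
  · exact h2 (m.mem_JMinus_of_le_pA (m.zero_le_pA j t h))
  · by_cases hj : j = .inl 0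
    · exact h2 (m.mem_JMinus_of_le_pA (m.one_le_pA j (by simp [hj]) t h))
    · exact h1 (m.mem_JPlus_of_pC_le (m.pC_le_one j hj t h))
  · exact h1 (m.mem_JPlus_of_pC_le (m.pC_le_two j t h))

/-- Outside the future of the zone, only incoming observables are met. -/
theorem net_eq_of_subset_MMinus {L : Set M} (hL : IsOpen L) (h : L ⊆ S.MMinus m.zone) :
    (m.coupled ψ χ).net L = uncoupled 𝔄 𝔅 L := by
  have hA := stageFactor_one_alice ψ χ
  apply le_antisymm
  · refine m.net_le ψ χ fun σ j t ht htL ↦ le_trans ?_ (factor_le_uncoupled ⟨t, htL⟩)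
    have hn : ¬ S.CausalLE m.pC (lines 𝔄 𝔅 j t) := fun h' ↦ h htL (m.mem_JPlus_of_pC_le h')
    rw [← stageFactor_zero ψ χ]
    revert ht
    refine (forall_stage (P := fun σ ↦ t ∈ m.segment σ j → stageFactor ψ χ σ j ≤ _)).2
      ⟨fun _ ↦ le_rfl, fun ht ↦ ?_, fun ht ↦ ?_⟩ σ
    · by_cases hj : j = .inl 0
      · rw [hj, hA]
      · exact absurd (m.pC_le_one j hj t ht) hn
    · exact absurd (m.pC_le_two j t ht) hn
  · rw [uncoupled_eq]
    refine iSup_le fun j ↦ iSup_le fun ⟨t, htL⟩ ↦ ?_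
    have hn : ¬ S.CausalLE m.pC (lines 𝔄 𝔅 j t) := fun h' ↦ h htL (m.mem_JPlus_of_pC_le h')
    rw [← stageFactor_zero ψ χ]
    have ht := m.mem_segment_stageAt j t
    generalize m.stageAt j t = σ at ht
    revert ht
    refine (forall_stage (P := fun σ ↦ t ∈ m.segment σ j → _)).2
      ⟨fun ht ↦ ?_, fun ht ↦ ?_, fun ht ↦ ?_⟩ σ
    · exact m.stageFactor_le_net ψ χ hL ht htL
    · by_cases hj : j = .inl 0
      · subst hj
        exact hA ▸ m.stageFactor_le_net ψ χ hL ht htL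
      · exact absurd (m.pC_le_one j hj t ht) hn
    · exact absurd (m.pC_le_two j t ht) hn

/-- Outside the past of the zone, only outgoing observables are met. -/
theorem net_eq_of_subset_MPlus {L : Set M} (hL : IsOpen L) (h : L ⊆ S.MPlus m.zone) :
    (m.coupled ψ χ).net L = (uncoupled 𝔄 𝔅 L).map (stageAut ψ χ 2).toStarAlgHom := by
  have hC := stageFactor_two_charlie ψ χ
  have hmap : (uncoupled 𝔄 𝔅 L).map (stageAut ψ χ 2).toStarAlgHom =
      ⨆ j, ⨆ (_ : ∃ t, lines 𝔄 𝔅 j t ∈ L), stageFactor ψ χ 2 j := by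
    rw [uncoupled_eq, (StarSubalgebra.gc_map_comap _).l_iSup₂]
    rfl
  rw [hmap]
  apply le_antisymm
  · refine m.net_le ψ χ fun σ j t ht htL ↦ le_trans ?_ (le_iSup₂_of_le
      (f := fun j (_ : ∃ t, lines 𝔄 𝔅 j t ∈ L) ↦ stageFactor ψ χ 2 j) j ⟨t, htL⟩ le_rfl)
    have hn : ¬ S.CausalLE (lines 𝔄 𝔅 j t) m.pA := fun h' ↦ h htL (m.mem_JMinus_of_le_pA h')
    revert ht
    refine (forall_stage (P := fun σ ↦ t ∈ m.segment σ j → stageFactor ψ χ σ j ≤ _)).2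
      ⟨fun ht ↦ ?_, fun ht ↦ ?_, fun _ ↦ le_rfl⟩ σ
    · exact absurd (m.zero_le_pA j t ht) hn
    · by_cases hj : j = .inl 1
      · rw [hj, hC]
      · exact absurd (m.one_le_pA j hj t ht) hn
  · refine iSup_le fun j ↦ iSup_le fun ⟨t, htL⟩ ↦ ?_
    have hn : ¬ S.CausalLE (lines 𝔄 𝔅 j t) m.pA := fun h' ↦ h htL (m.mem_JMinus_of_le_pA h')
    have ht := m.mem_segment_stageAt j t
    generalize m.stageAt j t = σ at ht
    revert ht
    refine (forall_stage (P := fun σ ↦ t ∈ m.segment σ j → _)).2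
      ⟨fun ht ↦ ?_, fun ht ↦ ?_, fun ht ↦ ?_⟩ σ
    · exact absurd (m.zero_le_pA j t ht) hn
    · by_cases hj : j = .inl 1
      · subst hj
        exact hC ▸ m.stageFactor_le_net ψ χ hL ht htL
      · exact absurd (m.one_le_pA j hj t ht) hn
    · exact m.stageFactor_le_net ψ χ hL ht htL

/-- The measurement in which Bob first interacts with Charlie and then with Alice. Its coupled
theory is described in terms of incoming observables, so that the retarded response map is the
identity. -/
def measurement (τ : OpState 𝔅.Idx) (b : Op 𝔅.Idx) : FVMeasurement 𝔄 𝔅 where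
  K := m.zone
  isCompact_K := isCompact_Icc.image (𝔅.worldline 0).continuous
  coupled := m.coupled ψ χ
  isAQFT := m.isAQFT_coupled ψ χ
  respPlus := stageAut ψ χ 2
  respMinus := StarAlgEquiv.refl ℂ _
  respPlus_image L hL h := by
    rw [m.net_eq_of_subset_MPlus ψ χ hL.1 h]
    rfl
  respMinus_image L hL h := by
    rw [m.net_eq_of_subset_MMinus ψ χ hL.1 h]
    exact Set.image_id _
  agree u hu := by
    -- no worldline meets the causal complement of the zone, so `u` is a scalar
    have hbot : uncoupled 𝔄 𝔅 (S.perp m.zone) = ⊥ := by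
      rw [uncoupled_eq, eq_bot_iff]
      exact iSup_le fun j ↦ iSup_le fun ⟨t, ht⟩ ↦ absurd ht (m.zone_notMem_perp j t)
    rw [hbot] at hu
    obtain ⟨z, rfl⟩ := StarSubalgebra.mem_bot.1 hu
    rw [Algebra.algebraMap_eq_smul_one, map_smul, map_smul, map_one, map_one]
  probeState := τ
  probeObs := b

theorem hasForm_measurement (τ : OpState 𝔅.Idx) (b : Op 𝔅.Idx) :
    HasForm (m.measurement ψ χ τ b).scattering ψ χ :=
  hasForm_iff.2 fun _ ↦ rfl

end Meetings

end MeetingsMeasurement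

end HybridAQFT

end

theorem theorem5p2 {E M : Type*} [NormedAddCommGroup E] [NormedSpace ℝ E] [FiniteDimensional ℝ E]
    [TopologicalSpace M] [T2Space M] [SecondCountableTopology M]
    [ChartedSpace E M] [IsManifold 𝓘(ℝ, E) ∞ M]
    (S : HybridAQFT.Spacetime E M) (hS : S.GloballyHyperbolic)
    (𝔄 : HybridAQFT.HybridTheory S 2)
    (O_A O_C : Set M) (hO_A : S.IsRegion O_A) (hO_C : S.IsRegion O_C)
    (hA : ∃ t, 𝔄.worldline 0 t ∈ O_A) (hC : ∃ t, 𝔄.worldline 1 t ∈ O_C)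
    (hAC : S.CausallyDisjoint O_A O_C) :
    -- (i)
    (∀ (O_B : Set M), S.IsRegion O_B →
      ∀ r : Set M → Set M → Prop, S.IsCausalOrder {O_A, O_B, O_C} r → r O_A O_B → r O_B O_C →
      ∀ (n : ℕ) (𝔅 : HybridAQFT.HybridTheory S n) (μ : HybridAQFT.FVMeasurement 𝔄 𝔅),
      μ.K ⊆ O_B →
      ∃ ψ χ, HybridAQFT.HasForm μ.scattering ψ χ) ∧
    -- (ii), existence
    (∀ (𝔅 : HybridAQFT.HybridTheory S 1),
      (∃ t_C t_A, t_C ≤ t_A ∧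
        𝔅.worldline 0 t_C ∈ Set.range (𝔄.worldline 1) ∧
        𝔅.worldline 0 t_A ∈ Set.range (𝔄.worldline 0)) →
      ∀ ψ χ (σ : HybridAQFT.OpState 𝔅.Idx) (b : HybridAQFT.Op 𝔅.Idx),
      ∃ μ : HybridAQFT.FVMeasurement 𝔄 𝔅,
        HybridAQFT.HasForm μ.scattering ψ χ ∧
        HybridAQFT.HaagProperty S μ.coupled.net ∧
        μ.probeState = σ ∧ μ.probeObs = b) ∧
    -- (ii), the coupling zone
    (∀ (𝔅 : HybridAQFT.HybridTheory S 1) (μ : HybridAQFT.FVMeasurement 𝔄 𝔅) (ψ χ),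
      HybridAQFT.HasForm μ.scattering ψ χ →
      ¬ HybridAQFT.Decomposes ψ → ¬ HybridAQFT.Decomposes χ →
      ∃ s t, 𝔄.worldline 1 s ∈ S.hull μ.K ∧ 𝔄.worldline 0 t ∈ S.hull μ.K ∧
        (S.CausalLE (𝔄.worldline 1 s) (𝔄.worldline 0 t) ∨
          S.CausalLE (𝔄.worldline 0 t) (𝔄.worldline 1 s))) := by
  refine ⟨?_, ?_, ?_⟩
  · intro O_B _ r hr hAB hBC n 𝔅 μ hK
    exact HybridAQFT.exists_hasForm μ.scattering
      (μ.commute_opA_scattering_opC hO_A hO_C hA hC hAC hr hAB hBC hK)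
  · rintro 𝔅 ⟨t_C, t_A, hle, ⟨s_C, hC'⟩, ⟨s_A, hA'⟩⟩ ψ χ σ b
    let m : HybridAQFT.Meetings 𝔄 𝔅 := ⟨s_C, s_A, t_C, t_A, hle, hC', hA'⟩
    exact ⟨m.measurement ψ χ σ b, m.hasForm_measurement ψ χ σ b, m.haagProperty_coupled ψ χ hS,
      rfl, rfl⟩
  · intro 𝔅 μ ψ χ h hψ hχ
    exact μ.exists_causalLE_of_not_decomposes hS h hψ hχ
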